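/- Let $R$ be a commutative ring with $1$; $\otimes=\otimes_R$, all gradings are by $\mathbb Z$, differentials have degree $-1$, and tensor products carry the usual signs: $(a\otimes b)(a'\otimes b')=(-1)^{|b||a'|}aa'\otimes bb'$, $d(a\otimes b)=da\otimes b+(-1)^{|a|}a\otimes db$, $T(a\otimes b)=(-1)^{|a||b|}b\otimes a$. **Definitions.** Let $A,B$ be differential graded algebras (dga's), associative and unital. * Linear maps $f,g\colon A\to B$ are *derivation homotopic*, $f\simeq g$, if there is a linear $s\colon A\to B$ of degree $1$ with $sd_A+d_Bs=f-g$ and $s(xy)=(-1)^{|x|}f(x)s(y)+s(x)g(y)$. * A *Hopf algebra up to homotopy* (Hah) is a dga $(A,d)$ with dga maps $\psi\colon A\to A\otimes A$ and $\varepsilon\colon A\to R$ such that $(\varepsilon\otimes1)\psi=1=(1\otimes\varepsilon)\psi$, $(\psi\otimes1)\psi\simeq(1\otimes\psi)\psi$ and $\psi\simeq T\psi$. A *morphism* of Hah's is a dga map $f$ that preserves counits and satisfies $(f\otimes f)\psi\simeq\psi f$; an *isomorphism* is a morphism with a two-sided inverse that is a morphism. Two morphisms are *homotopic* if they are derivation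 homotopic. * A *graded Hopf algebra* $H$ is a graded algebra with graded algebra maps $\Delta_H\colon H\to H\otimes H$, strictly coassociative, and $\varepsilon\colon H\to R$, a strict counit; it is regarded as a dga with $d=0$. * A *Hopf resolution* of $H$ is a Hah $(RH,d,\Delta)$ with a dga map $\rho\colon RH\to H$ such that: $RH=T(V)$ is the tensor algebra of a free bigraded module $V=\bigoplus_{q\ge0,\,m\in\mathbb Z}V_{q,m}$, with the induced bigrading ($R_qH$ denotes the part of resolution degree $q$; bidegree $(q,m)$ has total degree $q+m$); $d$ has bidegree $(-1,0)$; $\Delta(R_qH)\subset\bigoplus_{i+j=q}R_iH\otimes R_jH$; $\rho$ vanishes on $R_qH$ for $q>0$, preserves coproducts and counits, and is a homology isomorphism. * A *perturbation* of $(RH,d,\Delta)$ is a pair $(h,\nu)$, where $h$ is a derivation of $RH$ of total degree $-1$ with $h(R_qH)\subset\bigoplus_{i\le q-2}R_iH$, and $\nu\colon RH\to RH\otimes RH$ is linear of total degree $0$ with $\nu(R_qH)\subset\bigoplus_{i+j\le q-1}R_iH\otimes R_jH$, such that $(RH,d_h,\Delta_\nu)$, with $d_h=d+h$, $\Delta_\nu=\Delta+\nu$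 and the counit of $RH$, is a Hah. **Theorem 5.1.** Let $H$ be a graded Hopf algebra that is flat over $R$ (when $R\subseteq\mathbb Q$: torsion free), and fix a Hopf resolution $\rho\colon(RH,d,\Delta)\to H$. Let $(A,d,\psi)$ be a Hah whose underlying complex is K-flat over $R$, i.e. $A\otimes N$ is acyclic for every acyclic complex $N$ of $R$-modules (for example, $A$ bounded below with every $A_n$ free or flat). Let $i_A\colon H\to H(A,d)$ be an isomorphism of graded algebras compatible with counits and coproducts; the latter means that $H\xrightarrow{\Delta_H}H\otimes H\xrightarrow{i_A\otimes i_A}H(A)\otimes H(A)\to H(A\otimes A)$, the last arrow being the Künneth map, equals $H(\psi)\circ i_A$. * *Existence.* There are a perturbation $(h,\nu)$ of $(RH,d,\Delta)$ and a morphism of Hah's $k\colon(RH,d_h,\Delta_\nu)\to(A,d,\psi)$ that is a homology isomorphism and such that for every $x\in R_0H$ the element $k(x)$ is a cycle of homology class $i_A(\rho(x))$. * *Uniqueness.* If $(h,\nu,k)$ and $(\bar h,\bar\nu,\bar k)$ are two triples as in the existence part, there is an isomorphism of Hah's $p\colon(RH,d_h,\Delta_\nu)\to(RH,d_{\bar h},\Delta_{\bar\nu})$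 of the form $p=1+p'$ with $p'(R_qH)\subset\bigoplus_{i\le q-1}R_iH$ for all $q$, and $k$ is homotopic to $\bar k\circ p$. -/

import Mathlib

open scoped TensorProduct DirectSum

universe u

namespace HopfPert

/-! ### The grading of a graded tensor product of graded algebras -/

section TensorGrading

variable {R : Type u} [CommRing R] {A B : Type u} [Ring A] [Ring B] [Algebra R A] [Algebra R B]
  (𝒜 : ℤ → Submodule R A) (ℬ : ℤ → Submodule R B) [GradedAlgebra 𝒜] [GradedAlgebra ℬ]

/-- The degree `n` part of `A ⊗ B`, spanned by `a ⊗ b` with `|a| + |b| = n`. -/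
noncomputable def tensorGrading (n : ℤ) : Submodule R (𝒜 ᵍ⊗[R] ℬ) :=
  Submodule.span R {t | ∃ (i j : ℤ) (a : A) (b : B),
    i + j = n ∧ a ∈ 𝒜 i ∧ b ∈ ℬ j ∧ t = a ᵍ⊗ₜ[R] b}

theorem tmul_mem {i j n : ℤ} (hn : i + j = n) {a : A} (ha : a ∈ 𝒜 i) {b : B} (hb : b ∈ ℬ j) :
    (a ᵍ⊗ₜ[R] b : 𝒜 ᵍ⊗[R] ℬ) ∈ tensorGrading 𝒜 ℬ n :=
  Submodule.subset_span ⟨i, j, a, b, hn, ha, hb, rfl⟩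

/-- `a ⊗ b ↦ a ⊗ b` for homogeneous `a`, `b`, with values in the homogeneous component. -/
noncomputable def tmulHom (i j : ℤ) : 𝒜 i →ₗ[R] ℬ j →ₗ[R] tensorGrading 𝒜 ℬ (i + j) :=
  LinearMap.mk₂ R (fun a b => ⟨(a : A) ᵍ⊗ₜ[R] (b : B), tmul_mem 𝒜 ℬ rfl a.2 b.2⟩)
    (fun a a' b => Subtype.ext (TensorProduct.add_tmul (a : A) (a' : A) (b : B)))
    (fun c a b => Subtype.ext (TensorProduct.smul_tmul' c (a : A) (b : B)).symm)
    (fun a b b' => Subtype.ext (TensorProduct.tmul_add (a : A) (b : B) (b' : B)))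
    (fun c a b => Subtype.ext (TensorProduct.tmul_smul c (a : A) (b : B)))

/-- The decomposition of an element of `A ⊗ B` into homogeneous components. -/
noncomputable def tensorDecompose : (𝒜 ᵍ⊗[R] ℬ) →ₗ[R] ⨁ n, tensorGrading 𝒜 ℬ n :=
  TensorProduct.lift
      (DirectSum.toModule R ℤ _ (fun i =>
        (DirectSum.toModule R ℤ (𝒜 i →ₗ[R] ⨁ n, tensorGrading 𝒜 ℬ n) (fun j =>
          ((tmulHom 𝒜 ℬ i j).compr₂ (DirectSum.lof R ℤ (fun n => tensorGrading 𝒜 ℬ n) (i + j))).flip)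
        ).flip))
    ∘ₗ (GradedTensorProduct.auxEquiv R 𝒜 ℬ).toLinearMap

theorem tensorDecompose_tmul {i j : ℤ} (a : 𝒜 i) (b : ℬ j) :
    tensorDecompose 𝒜 ℬ ((a : A) ᵍ⊗ₜ[R] (b : B))
      = DirectSum.lof R ℤ (fun n => tensorGrading 𝒜 ℬ n) (i + j) (tmulHom 𝒜 ℬ i j a b) := by
  simp only [tensorDecompose, LinearMap.comp_apply, LinearEquiv.coe_coe,
    GradedTensorProduct.auxEquiv_tmul, DirectSum.decompose_coe, TensorProduct.lift.tmul]
  simp only [← DirectSum.lof_eq_of R]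
  simp [DirectSum.toModule_lof]

noncomputable instance tensorDecomposition : DirectSum.Decomposition (tensorGrading 𝒜 ℬ) :=
  DirectSum.Decomposition.ofLinearMap _ (tensorDecompose 𝒜 ℬ)
    (by
      refine GradedTensorProduct.hom_ext 𝒜 ℬ (TensorProduct.ext ?_)
      refine DirectSum.decompose_lhom_ext 𝒜 fun i => ?_
      ext a : 1
      refine DirectSum.decompose_lhom_ext ℬ fun j => ?_
      ext b : 1
      change DirectSum.coeLinearMap _ (tensorDecompose 𝒜 ℬ ((a : A) ᵍ⊗ₜ[R] (b : B))) = _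
      rw [tensorDecompose_tmul, DirectSum.lof_eq_of, DirectSum.coeLinearMap_of]
      rfl)
    (by
      ext n ⟨t, ht⟩ : 2
      simp only [LinearMap.comp_apply, DirectSum.lof_eq_of, DirectSum.coeLinearMap_of,
        LinearMap.id_apply]
      induction ht using Submodule.span_induction with
      | mem t h =>
        obtain ⟨i, j, a, b, rfl, ha, hb, rfl⟩ := h
        exact tensorDecompose_tmul 𝒜 ℬ ⟨a, ha⟩ ⟨b, hb⟩
      | zero =>
        rw [map_zero]; exact (map_zero (DirectSum.of (fun n => tensorGrading 𝒜 ℬ n) n)).symm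
      | add x y hx hy h1 h2 =>
        rw [map_add, h1, h2]
        exact (map_add (DirectSum.of (fun n => tensorGrading 𝒜 ℬ n) n) ⟨x, hx⟩ ⟨y, hy⟩).symm
      | smul c x hx h =>
        rw [map_smul, h]
        exact (map_smul (DirectSum.lof R ℤ (fun n => tensorGrading 𝒜 ℬ n) n) c ⟨x, hx⟩).symm)

noncomputable instance tensorGradedAlgebra : GradedAlgebra (tensorGrading 𝒜 ℬ) where
  one_mem := tmul_mem 𝒜 ℬ (add_zero 0) SetLike.GradedOne.one_mem SetLike.GradedOne.one_mem
  mul_mem := by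
    intro m n x y hx hy
    induction hx using Submodule.span_induction with
    | zero => rw [zero_mul]; exact Submodule.zero_mem _
    | add x x' _ _ h1 h2 => rw [add_mul]; exact Submodule.add_mem _ h1 h2
    | smul c x _ h => rw [GradedTensorProduct.mul_def, LinearMap.map_smul₂]; exact Submodule.smul_mem _ c h
    | mem x h =>
      obtain ⟨i, j, a, b, rfl, ha, hb, rfl⟩ := h
      induction hy using Submodule.span_induction with
      | zero => rw [mul_zero]; exact Submodule.zero_mem _
      | add x x' _ _ h1 h2 => rw [mul_add]; exact Submodule.add_mem _ h1 h2
      | smul c x _ h => rw [GradedTensorProduct.mul_def, map_smul]; exact Submodule.smul_mem _ c h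
      | mem y h =>
        obtain ⟨i', j', a', b', rfl, ha', hb', rfl⟩ := h
        have key := GradedTensorProduct.tmul_coe_mul_coe_tmul (R := R) 𝒜 ℬ a ⟨b, hb⟩ ⟨a', ha'⟩ b'
        simp only at key
        rw [key]
        have hm : ((a * a' : A) ᵍ⊗ₜ[R] (b * b' : B) : 𝒜 ᵍ⊗[R] ℬ)
            ∈ tensorGrading 𝒜 ℬ (i + j + (i' + j')) :=
          tmul_mem 𝒜 ℬ (by ring) (SetLike.mul_mem_graded ha ha') (SetLike.mul_mem_graded hb hb')
        rcases Int.units_eq_one_or ((-1 : ℤˣ) ^ (j * i')) with h | h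
        · rw [h, one_smul]; exact hm
        · rw [h, Units.neg_smul, one_smul]; exact Submodule.neg_mem _ hm

end TensorGrading

/-! ### Graded algebras and their maps -/

/-- A `ℤ`-graded associative unital `R`-algebra. -/
structure GrAlg (R : Type u) [CommRing R] where
  carrier : Type u
  [ring : Ring carrier]
  [algebra : Algebra R carrier]
  gr : ℤ → Submodule R carrier
  [graded : GradedAlgebra gr]

namespace GrAlg

variable {R : Type u} [CommRing R]

instance : CoeSort (GrAlg R) (Type u) := ⟨GrAlg.carrier⟩

attribute [instance] GrAlg.ring GrAlg.algebra GrAlg.graded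

/-- The tensor product, with `(a ⊗ b)(a' ⊗ b') = (-1)^{|b||a'|} aa' ⊗ bb'`. -/
noncomputable def tensor (A B : GrAlg R) : GrAlg R where
  carrier := A.gr ᵍ⊗[R] B.gr
  gr := tensorGrading A.gr B.gr

/-- The element `a ⊗ b` of `A ⊗ B`. -/
noncomputable def tmul {A B : GrAlg R} (a : A) (b : B) : A.tensor B :=
  GradedTensorProduct.tmul R (𝒜 := A.gr) (ℬ := B.gr) a b

/-- The sign operator `a ↦ (-1)^{|a|} a`. -/
noncomputable def sign (A : GrAlg R) : A →ₗ[R] A :=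
  DirectSum.toModule R ℤ A (fun n => ((n.negOnePow : ℤˣ) : ℤ) • (A.gr n).subtype)
    ∘ₗ (DirectSum.decomposeLinearEquiv A.gr).toLinearMap

theorem sign_of_mem (A : GrAlg R) {n : ℤ} {a : A} (ha : a ∈ A.gr n) :
    A.sign a = ((n.negOnePow : ℤˣ) : ℤ) • a := by
  simp only [sign, LinearMap.comp_apply, LinearEquiv.coe_coe,
    DirectSum.decomposeLinearEquiv_apply]
  rw [DirectSum.decompose_of_mem A.gr ha, ← DirectSum.lof_eq_of R, DirectSum.toModule_lof]
  simp

/-- `f ⊗ g` for linear maps `f`, `g` of degree `0` (no sign enters). -/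
noncomputable def tensorMap {A B C D : GrAlg R} (f : A →ₗ[R] C) (g : B →ₗ[R] D) :
    A.tensor B →ₗ[R] C.tensor D :=
  (GradedTensorProduct.of R C.gr D.gr).toLinearMap ∘ₗ TensorProduct.map f g
    ∘ₗ (GradedTensorProduct.of R A.gr B.gr).symm.toLinearMap

/-- The differential `d(a ⊗ b) = da ⊗ b + (-1)^{|a|} a ⊗ db` of a tensor product. -/
noncomputable def tensorD {A B : GrAlg R} (dA : A →ₗ[R] A) (dB : B →ₗ[R] B) :
    A.tensor B →ₗ[R] A.tensor B :=
  tensorMap dA LinearMap.id + tensorMap A.sign dB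

/-- The associativity isomorphism `(a ⊗ b) ⊗ c ↦ a ⊗ (b ⊗ c)`. -/
noncomputable def assoc (A B C : GrAlg R) :
    (A.tensor B).tensor C →ₗ[R] A.tensor (B.tensor C) :=
  (GradedTensorProduct.of R A.gr (B.tensor C).gr).toLinearMap
    ∘ₗ TensorProduct.map LinearMap.id (GradedTensorProduct.of R B.gr C.gr).toLinearMap
    ∘ₗ (TensorProduct.assoc R A B C).toLinearMap
    ∘ₗ TensorProduct.map (GradedTensorProduct.of R A.gr B.gr).symm.toLinearMap LinearMap.id
    ∘ₗ (GradedTensorProduct.of R (A.tensor B).gr C.gr).symm.toLinearMap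

/-- The interchange map `T(a ⊗ b) = (-1)^{|a||b|} b ⊗ a`. -/
noncomputable def swap (A B : GrAlg R) : A.tensor B →ₗ[R] B.tensor A :=
  (GradedTensorProduct.comm A.gr B.gr).toLinearMap

/-- `(e ⊗ 1) : A ⊗ B → R ⊗ B = B`. -/
noncomputable def contractLeft {A B : GrAlg R} (e : A →ₗ[R] R) : A.tensor B →ₗ[R] B :=
  (TensorProduct.lid R B).toLinearMap ∘ₗ TensorProduct.map e LinearMap.id
    ∘ₗ (GradedTensorProduct.of R A.gr B.gr).symm.toLinearMap

/-- `(1 ⊗ e) : A ⊗ B → A ⊗ R = A`. -/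
noncomputable def contractRight {A B : GrAlg R} (e : B →ₗ[R] R) : A.tensor B →ₗ[R] A :=
  (TensorProduct.rid R A).toLinearMap ∘ₗ TensorProduct.map LinearMap.id e
    ∘ₗ (GradedTensorProduct.of R A.gr B.gr).symm.toLinearMap

/-- `f` raises degrees by `r`. -/
def HasDegree {A B : GrAlg R} (r : ℤ) (f : A →ₗ[R] B) : Prop :=
  ∀ n, ∀ x ∈ A.gr n, f x ∈ B.gr (n + r)

/-- A derivation of degree `-1`: `θ(xy) = θ(x) y + (-1)^{|x|} x θ(y)`. -/
structure IsDerivation {A : GrAlg R} (θ : A →ₗ[R] A) : Prop where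
  degree : HasDegree (-1) θ
  leibniz : ∀ x y, θ (x * y) = θ x * y + A.sign x * θ y

/-- `(A, d)` is a differential graded algebra. -/
structure IsDGA {A : GrAlg R} (d : A →ₗ[R] A) : Prop extends IsDerivation d where
  sq : ∀ x, d (d x) = 0

/-- `f : (A, dA) → (B, dB)` is a map of dga's. -/
structure IsDGAHom {A B : GrAlg R} (dA : A →ₗ[R] A) (dB : B →ₗ[R] B) (f : A →ₗ[R] B) :
    Prop where
  degree : HasDegree 0 f
  map_one : f 1 = 1
  map_mul : ∀ x y, f (x * y) = f x * f y
  map_d : ∀ x, f (dA x) = dB (f x)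

/-- `f` and `g` are derivation homotopic: there is `s` of degree `1` with `s dA + dB s = f - g`
and `s(xy) = (-1)^{|x|} f(x) s(y) + s(x) g(y)`. -/
def DerivationHomotopic {A B : GrAlg R} (dA : A →ₗ[R] A) (dB : B →ₗ[R] B) (f g : A →ₗ[R] B) :
    Prop :=
  ∃ s : A →ₗ[R] B, HasDegree 1 s ∧ (∀ x, s (dA x) + dB (s x) = f x - g x) ∧
    ∀ x y, s (x * y) = f (A.sign x) * s y + s x * g y

/-- The complex `(A, d)` is K-flat: tensoring with it preserves acyclicity of complexes. -/
def IsKFlat {A : GrAlg R} (d : A →ₗ[R] A) : Prop :=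
  ∀ (N : Type u) [AddCommGroup N] [Module R N] (𝒩 : ℤ → Submodule R N)
    [DirectSum.Decomposition 𝒩] (δ : N →ₗ[R] N),
    (∀ n, ∀ x ∈ 𝒩 n, δ x ∈ 𝒩 (n - 1)) → Function.Exact δ δ →
    Function.Exact
      (TensorProduct.map d LinearMap.id + TensorProduct.map A.sign δ : A ⊗[R] N →ₗ[R] A ⊗[R] N)
      (TensorProduct.map d LinearMap.id + TensorProduct.map A.sign δ : A ⊗[R] N →ₗ[R] A ⊗[R] N)

/-! ### Homology -/

/-- `ker d / im d`. -/
abbrev Homology {A : GrAlg R} (d : A →ₗ[R] A) : Type u :=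
  LinearMap.ker d ⧸ (LinearMap.range d).comap (LinearMap.ker d).subtype

/-- The element `x` is a cycle of homology class `c`. -/
def Represents {A : GrAlg R} (d : A →ₗ[R] A) (x : A) (c : Homology d) : Prop :=
  ∃ hx : x ∈ LinearMap.ker d, Submodule.Quotient.mk ⟨x, hx⟩ = c

/-- The map induced in homology by a chain map. -/
noncomputable def homologyMap {A B : GrAlg R} {dA : A →ₗ[R] A} {dB : B →ₗ[R] B} (f : A →ₗ[R] B)
    (hf : ∀ x, f (dA x) = dB (f x)) : Homology dA →ₗ[R] Homology dB :=
  Submodule.mapQ _ _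
    (f.restrict (p := LinearMap.ker dA) (q := LinearMap.ker dB) (fun x hx => by
      rw [LinearMap.mem_ker] at hx ⊢; rw [← hf, hx, map_zero]))
    (by
      rintro ⟨x, hx⟩ ⟨y, hy⟩
      exact ⟨f y, by rw [← hf, hy]; rfl⟩)

/-- `f` is a chain map inducing an isomorphism in homology. -/
def IsHomologyIso {A B : GrAlg R} (dA : A →ₗ[R] A) (dB : B →ₗ[R] B) (f : A →ₗ[R] B) : Prop :=
  ∃ hf : ∀ x, f (dA x) = dB (f x), Function.Bijective (homologyMap f hf)

theorem zero_tmul {A B : GrAlg R} (b : B) : tmul (0 : A) b = 0 :=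
  TensorProduct.zero_tmul (M := A) (N := B) (R := R) b

theorem tmul_zero {A B : GrAlg R} (a : A) : tmul a (0 : B) = 0 :=
  TensorProduct.tmul_zero (M := A) (N := B) (R := R) a

theorem tensorMap_tmul {A B C D : GrAlg R} (f : A →ₗ[R] C) (g : B →ₗ[R] D) (a : A) (b : B) :
    tensorMap f g (tmul a b) = tmul (f a) (g b) := rfl

theorem tensorD_tmul {A B : GrAlg R} (dA : A →ₗ[R] A) (dB : B →ₗ[R] B) (a : A) (b : B) :
    tensorD dA dB (tmul a b)
      = tmul (dA a) b + tmul (A.sign a) (dB b) := rfl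

theorem sign_sign (A : GrAlg R) (a : A) : A.sign (A.sign a) = a := by
  induction a using DirectSum.Decomposition.inductionOn A.gr with
  | zero => simp
  | add x y hx hy => rw [map_add, map_add, hx, hy]
  | @homogeneous n x =>
    rw [sign_of_mem A x.2, map_zsmul, sign_of_mem A x.2, smul_smul, ← Units.val_mul,
      Int.units_mul_self, Units.val_one, one_smul]

theorem d_sign {A : GrAlg R} {d : A →ₗ[R] A} (hd : HasDegree (-1) d) (a : A) :
    d (A.sign a) = - A.sign (d a) := by
  induction a using DirectSum.Decomposition.inductionOn A.gr with
  | zero => simp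
  | add x y hx hy => simp only [map_add, hx, hy, neg_add]
  | @homogeneous n x =>
    rw [sign_of_mem A x.2, sign_of_mem A (hd n x x.2), map_zsmul, ← sub_eq_add_neg,
      Int.negOnePow_sub, Int.negOnePow_one]
    simp

/-- `[x] ⊗ y ↦ [x ⊗ y]` for cycles, as a map out of cycles. -/
noncomputable def kunnethAux {A B : GrAlg R} (dA : A →ₗ[R] A) (dB : B →ₗ[R] B) :
    LinearMap.ker dA →ₗ[R] LinearMap.ker dB →ₗ[R] Homology (tensorD dA dB) :=
  LinearMap.mk₂ R (fun x y => Submodule.Quotient.mk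
      ⟨tmul (x : A) (y : B), by
        rw [LinearMap.mem_ker, tensorD_tmul, LinearMap.mem_ker.1 x.2, LinearMap.mem_ker.1 y.2,
          zero_tmul, tmul_zero, add_zero]⟩)
    (fun x x' y => by
      rw [← Submodule.Quotient.mk_add]
      exact congrArg _ (Subtype.ext (TensorProduct.add_tmul (x : A) (x' : A) (y : B))))
    (fun c x y => by
      rw [← Submodule.Quotient.mk_smul]
      exact congrArg _ (Subtype.ext (TensorProduct.smul_tmul' c (x : A) (y : B)).symm))
    (fun x y y' => by
      rw [← Submodule.Quotient.mk_add]
      exact congrArg _ (Subtype.ext (TensorProduct.tmul_add (x : A) (y : B) (y' : B))))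
    (fun c x y => by
      rw [← Submodule.Quotient.mk_smul]
      exact congrArg _ (Subtype.ext (TensorProduct.tmul_smul c (x : A) (y : B))))

/-- The Künneth map `H(A) ⊗ H(B) → H(A ⊗ B)`, `[x] ⊗ [y] ↦ [x ⊗ y]`. -/
noncomputable def kunneth {A B : GrAlg R} {dA : A →ₗ[R] A} {dB : B →ₗ[R] B} (hA : IsDGA dA) :
    Homology dA ⊗[R] Homology dB →ₗ[R] Homology (tensorD dA dB) :=
  TensorProduct.lift
    (Submodule.liftQ _
      (LinearMap.flip (Submodule.liftQ _ (kunnethAux dA dB).flip (by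
        rintro ⟨y, hy⟩ ⟨z, hz⟩
        rw [LinearMap.mem_ker]
        ext ⟨x, hx⟩
        refine (Submodule.Quotient.mk_eq_zero _).2 ⟨tmul (A.sign x) z, ?_⟩
        rw [tensorD_tmul, d_sign hA.degree, LinearMap.mem_ker.1 hx, sign_sign, hz, map_zero,
          neg_zero, zero_tmul, zero_add]
        rfl)))
      (by
        rintro ⟨x, hx⟩ ⟨z, hz⟩
        rw [LinearMap.mem_ker]
        refine LinearMap.ext fun c => ?_
        obtain ⟨⟨y, hy⟩, rfl⟩ := Submodule.Quotient.mk_surjective _ c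
        refine (Submodule.Quotient.mk_eq_zero _).2 ⟨tmul z y, ?_⟩
        rw [tensorD_tmul, LinearMap.mem_ker.1 hy, hz, tmul_zero, add_zero]
        rfl))

theorem kunneth_mk {A B : GrAlg R} {dA : A →ₗ[R] A} {dB : B →ₗ[R] B} (hA : IsDGA dA)
    {x : A} {y : B} {a : Homology dA} {b : Homology dB} (hx : Represents dA x a)
    (hy : Represents dB y b) :
    Represents (tensorD dA dB) (tmul x y) (kunneth (dB := dB) hA (a ⊗ₜ[R] b)) := by
  obtain ⟨hx, rfl⟩ := hx
  obtain ⟨hy, rfl⟩ := hy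
  exact ⟨_, rfl⟩

end GrAlg

open GrAlg

/-! ### Hopf algebras, strict and up to homotopy -/

/-- A graded algebra with a linear endomorphism `d`, a coproduct and a counit.
The laws are in the predicates below. -/
structure CoDGA (R : Type u) [CommRing R] where
  alg : GrAlg R
  d : alg →ₗ[R] alg
  comul : alg →ₗ[R] alg.tensor alg
  counit : alg →ₗ[R] R

namespace CoDGA

variable {R : Type u} [CommRing R]

/-- The differential of `X ⊗ X`. -/
noncomputable abbrev d₂ (X : CoDGA R) : X.alg.tensor X.alg →ₗ[R] X.alg.tensor X.alg :=
  tensorD X.d X.d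

/-- The differential of `X ⊗ X ⊗ X`. -/
noncomputable abbrev d₃ (X : CoDGA R) :
    X.alg.tensor (X.alg.tensor X.alg) →ₗ[R] X.alg.tensor (X.alg.tensor X.alg) :=
  tensorD X.d X.d₂

/-- `(Δ ⊗ 1) Δ`, with values in `X ⊗ (X ⊗ X)`. -/
noncomputable def comulLeft (X : CoDGA R) : X.alg →ₗ[R] X.alg.tensor (X.alg.tensor X.alg) :=
  assoc X.alg X.alg X.alg ∘ₗ tensorMap X.comul LinearMap.id ∘ₗ X.comul

/-- `(1 ⊗ Δ) Δ`. -/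
noncomputable def comulRight (X : CoDGA R) : X.alg →ₗ[R] X.alg.tensor (X.alg.tensor X.alg) :=
  tensorMap LinearMap.id X.comul ∘ₗ X.comul

/-- A dga with a counital coproduct, both coproduct and counit being maps of dga's. -/
structure IsCounital (X : CoDGA R) : Prop where
  isDGA : IsDGA X.d
  comul_hom : IsDGAHom X.d X.d₂ X.comul
  counit_one : X.counit 1 = 1
  counit_mul : ∀ x y, X.counit (x * y) = X.counit x * X.counit y
  counit_degree : ∀ n, n ≠ 0 → ∀ x ∈ X.alg.gr n, X.counit x = 0
  counit_d : ∀ x, X.counit (X.d x) = 0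
  counit_left : ∀ x, contractLeft X.counit (X.comul x) = x
  counit_right : ∀ x, contractRight X.counit (X.comul x) = x

/-- A Hopf algebra up to homotopy: the coproduct is coassociative and cocommutative up to
derivation homotopy. -/
structure IsHah (X : CoDGA R) : Prop extends IsCounital X where
  coassoc : DerivationHomotopic X.d X.d₃ X.comulLeft X.comulRight
  cocomm : DerivationHomotopic X.d X.d₂ X.comul (swap X.alg X.alg ∘ₗ X.comul)

/-- A graded Hopf algebra (with zero differential and strictly coassociative coproduct). -/
structure IsGradedHopf (X : CoDGA R) : Prop extends IsCounital X where
  d_eq_zero : X.d = 0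
  coassoc : X.comulLeft = X.comulRight

/-- Morphisms of Hopf algebras up to homotopy: maps of augmented dga's commuting with the
coproducts up to derivation homotopy. -/
structure IsHahHom (X Y : CoDGA R) (f : X.alg →ₗ[R] Y.alg) : Prop where
  hom : IsDGAHom X.d Y.d f
  counit : ∀ x, Y.counit (f x) = X.counit x
  comul : DerivationHomotopic X.d Y.d₂ (tensorMap f f ∘ₗ X.comul) (Y.comul ∘ₗ f)

/-- Isomorphisms of Hopf algebras up to homotopy. -/
def IsHahIso (X Y : CoDGA R) (f : X.alg →ₗ[R] Y.alg) : Prop :=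
  IsHahHom X Y f ∧ ∃ g : Y.alg →ₗ[R] X.alg, IsHahHom Y X g ∧
    g ∘ₗ f = LinearMap.id ∧ f ∘ₗ g = LinearMap.id

/-- An isomorphism `H ≅ H(A)` of graded Hopf algebras, where the coproduct of `H(A)` is the map
`H(A) → H(A ⊗ A)` induced by `ψ`, compared with `H ⊗ H` through the Künneth map. -/
structure HomologyIso (H A : CoDGA R) (hA : A.IsHah) where
  toEquiv : H.alg ≃ₗ[R] Homology A.d
  degree : ∀ n, ∀ a ∈ H.alg.gr n, ∃ x ∈ A.alg.gr n, Represents A.d x (toEquiv a)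
  map_one : Represents A.d 1 (toEquiv 1)
  map_mul : ∀ a b x y, Represents A.d x (toEquiv a) → Represents A.d y (toEquiv b) →
    Represents A.d (x * y) (toEquiv (a * b))
  map_counit : ∀ a x, Represents A.d x (toEquiv a) → A.counit x = H.counit a
  map_comul : ∀ a, homologyMap A.comul hA.comul_hom.map_d (toEquiv a) =
    kunneth hA.isDGA (TensorProduct.map toEquiv.toLinearMap toEquiv.toLinearMap
      ((GradedTensorProduct.of R H.alg.gr H.alg.gr).symm (H.comul a)))

end CoDGA

/-! ### Hopf resolutions and their perturbations -/

/-- A presentation of `A` as the tensor algebra of a free bigraded module: `X` is a homogeneous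
basis of the module; `x` has resolution degree `res x`, internal degree `int x`, and total degree
`res x + int x`. -/
structure FreeGens {R : Type u} [CommRing R] (A : GrAlg R) where
  X : Type u
  gen : X → A
  res : X → ℕ
  int : X → ℤ
  gen_mem : ∀ x, gen x ∈ A.gr (res x + int x)
  free : Function.Bijective (FreeAlgebra.lift R gen)

namespace FreeGens

variable {R : Type u} [CommRing R] {A : GrAlg R}

/-- The component of bidegree `(q, m)`, spanned by the monomials of that bidegree. -/
def bideg (V : FreeGens A) (q : ℕ) (m : ℤ) : Submodule R A :=
  Submodule.span R {a | ∃ l : List V.X, (l.map V.res).sum = q ∧ (l.map V.int).sum = m ∧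
    a = (l.map V.gen).prod}

/-- The component of resolution degree `q`. -/
def resDeg (V : FreeGens A) (q : ℕ) : Submodule R A := ⨆ m : ℤ, V.bideg q m

/-- The sum of the components of resolution degree at most `n`. -/
def resFilt (V : FreeGens A) (n : ℤ) : Submodule R A :=
  ⨆ (q : ℕ) (_ : (q : ℤ) ≤ n), V.resDeg q

/-- The sum of the `R_i ⊗ R_j`, `i + j = q`. -/
noncomputable def tensorResDeg (V : FreeGens A) (q : ℕ) : Submodule R (A.tensor A) :=
  Submodule.span R {t | ∃ (i j : ℕ) (a b : A), i + j = q ∧ a ∈ V.resDeg i ∧ b ∈ V.resDeg j ∧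
    t = tmul a b}

/-- The sum of the `R_i ⊗ R_j`, `i + j ≤ n`. -/
noncomputable def tensorResFilt (V : FreeGens A) (n : ℤ) : Submodule R (A.tensor A) :=
  ⨆ (q : ℕ) (_ : (q : ℤ) ≤ n), V.tensorResDeg q

end FreeGens

variable {R : Type u} [CommRing R]

/-- A Hopf resolution `ρ : (RH, d, Δ) → H`. -/
structure HopfResolution (H : CoDGA R) where
  RH : CoDGA R
  isHah : RH.IsHah
  V : FreeGens RH.alg
  d_zero : ∀ x ∈ V.resDeg 0, RH.d x = 0
  d_succ : ∀ q m, ∀ x ∈ V.bideg (q + 1) m, RH.d x ∈ V.bideg q m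
  comul_res : ∀ q, ∀ x ∈ V.resDeg q, RH.comul x ∈ V.tensorResDeg q
  ρ : RH.alg →ₗ[R] H.alg
  ρ_hom : IsDGAHom RH.d H.d ρ
  ρ_res : ∀ q, 0 < q → ∀ x ∈ V.resDeg q, ρ x = 0
  ρ_homologyIso : IsHomologyIso RH.d H.d ρ
  ρ_comul : ∀ x, tensorMap ρ ρ (RH.comul x) = H.comul (ρ x)
  ρ_counit : ∀ x, H.counit (ρ x) = RH.counit x

namespace HopfResolution

variable {H : CoDGA R}

/-- `(RH, d + h, Δ + ν)`. -/
noncomputable def perturb (K : HopfResolution H) (h : K.RH.alg →ₗ[R] K.RH.alg)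
    (ν : K.RH.alg →ₗ[R] K.RH.alg.tensor K.RH.alg) : CoDGA R where
  alg := K.RH.alg
  d := K.RH.d + h
  comul := K.RH.comul + ν
  counit := K.RH.counit

/-- `(h, ν)` is a perturbation of `(RH, d, Δ)`. -/
structure IsPerturbation (K : HopfResolution H) (h : K.RH.alg →ₗ[R] K.RH.alg)
    (ν : K.RH.alg →ₗ[R] K.RH.alg.tensor K.RH.alg) : Prop where
  h_derivation : IsDerivation h
  h_res : ∀ q : ℕ, ∀ x ∈ K.V.resDeg q, h x ∈ K.V.resFilt (q - 2)
  ν_degree : HasDegree 0 ν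
  ν_res : ∀ q : ℕ, ∀ x ∈ K.V.resDeg q, ν x ∈ K.V.tensorResFilt (q - 1)
  isHah : (K.perturb h ν).IsHah

/-- `(h, ν)` is a perturbation and `k : (RH, d_h, Δ_ν) → A` is a morphism of Hopf algebras up to
homotopy, a homology isomorphism, inducing `i_A ∘ ρ` on `R_0 H`. -/
structure IsModel (K : HopfResolution H) {A : CoDGA R} {hA : A.IsHah} (i : H.HomologyIso A hA)
    (h : K.RH.alg →ₗ[R] K.RH.alg) (ν : K.RH.alg →ₗ[R] K.RH.alg.tensor K.RH.alg)
    (k : K.RH.alg →ₗ[R] A.alg) : Prop where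
  isPerturbation : K.IsPerturbation h ν
  hom : CoDGA.IsHahHom (K.perturb h ν) A k
  homologyIso : IsHomologyIso (K.perturb h ν).d A.d k
  restrict : ∀ x ∈ K.V.resDeg 0, Represents A.d (k x) (i.toEquiv (K.ρ x))

end HopfResolution

end HopfPert

namespace HopfPert

open GrAlg

/-! The tensor algebra RH is semifree: the differential of a generator lies in strictly lower
resolution filtration. Algebra maps, derivations and homotopies out of RH can therefore be built by
recursion on the resolution degree of the generators (`exists_of_rank_local`), and each step is a
linear problem whose obstruction is a cycle. Quasi-isomorphisms enter as acyclicity of the mapping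
cone (`QIso`): a cycle, together with a chain bounding its image, can be bounded compatibly on both
sides. This is the shape in which the obstructions arise.

Homotopy. Adding two derivation homotopies does not give a derivation homotopy. For maps out of a
tensor algebra the failure is repaired by a second-order homotopy, which is the corner entry of an
algebra map into upper triangular 3 by 3 matrices (`exists_twisted`). This yields transitivity
(`homotopic_trans`) and, by recursion on generators, the fact that a quasi-isomorphism reflects
homotopy (`homotopic_reflect`). Symmetry is the case of the identity map.

The differential. In `exists_perturbed_differential` the derivation h and the map k are constructed
together. On a generator of resolution degree 0, k picks a cycle in the prescribed class. On a
higher generator v one corrects dv to a cycle of d + h whose image in A is a boundary. The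
correction has filtration two below v: exactness of the resolution makes it a cycle
(`exists_primitive`), and an element of resolution degree 0 removes the remaining class in A. The
same argument shows that k is a quasi-isomorphism.

The coproduct. RH is semifree and A is K-flat, so the tensor square and cube of k are
quasi-isomorphisms. Lifting the map ψk along the square of k, with Δ as leading term, gives Δ + ν
(`exists_filtered_lift`). Flatness of H makes RH ⊗ RH exact in positive resolution degree, so
corrections can be moved into low filtration (`exists_sub_boundary_mem`) and ν lowers the
filtration. Keeping the corrections in the tensor square of the augmentation ideal preserves the
counit laws strictly. Coassociativity and cocommutativity up to homotopy hold after applying tensor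
powers of k, hence they hold in RH (`IsCounital.isHah`).

Uniqueness. The same lifting lemma, applied to k along the other model map with the identity as
leading term, gives p. It is unipotent for the filtration, hence bijective. Its compatibility with
the coproducts is checked in A ⊗ A and reflected back. -/

/-- The sign `(-1)^n`. -/
def sg (n : ℤ) : ℤ := ((n.negOnePow : ℤˣ) : ℤ)

theorem sg_add (m n : ℤ) : sg (m + n) = sg m * sg n := by
  simp [sg, Int.negOnePow_add]

theorem sg_zero : sg 0 = 1 := by simp [sg]

theorem sg_one : sg 1 = -1 := by simp [sg]

theorem sg_neg (n : ℤ) : sg (-n) = sg n := by simp [sg, Int.negOnePow_neg]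

theorem sg_sub (m n : ℤ) : sg (m - n) = sg m * sg n := by
  rw [sub_eq_add_neg, sg_add, sg_neg]

theorem sg_eq (n : ℤ) : sg n = 1 ∨ sg n = -1 := by
  rcases Int.units_eq_one_or n.negOnePow with h | h <;> simp [sg, h]

/-! ### Signs, homogeneous components and maps of given degree. -/

namespace GrAlg

variable {R : Type u} [CommRing R] {A B C D : GrAlg R}

theorem sign_mem {n : ℤ} {a : A} (ha : a ∈ A.gr n) : A.sign a = sg n • a :=
  sign_of_mem A ha

theorem homog_induction {P : A → Prop} (a : A) (zero : P 0) (add : ∀ x y, P x → P y → P (x + y))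
    (homog : ∀ n, ∀ x ∈ A.gr n, P x) : P a :=
  DirectSum.Decomposition.inductionOn A.gr zero (fun x => homog _ x x.2) add a

theorem zsmul_mem_gr {n k : ℤ} {a : A} (ha : a ∈ A.gr n) : k • a ∈ A.gr n :=
  zsmul_mem ha k

theorem mul_mem_gr {i j n : ℤ} {a b : A} (ha : a ∈ A.gr i) (hb : b ∈ A.gr j) (h : i + j = n) :
    a * b ∈ A.gr n := h ▸ SetLike.mul_mem_graded ha hb

theorem one_mem_gr : (1 : A) ∈ A.gr 0 := SetLike.GradedOne.one_mem

theorem sign_mul (a b : A) : A.sign (a * b) = A.sign a * A.sign b := by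
  induction a using homog_induction with
  | zero => simp
  | add x y hx hy => simp only [add_mul, map_add, hx, hy]
  | homog n a ha =>
    induction b using homog_induction with
    | zero => simp
    | add x y hx hy => simp only [mul_add, map_add, hx, hy]
    | homog m b hb =>
      rw [sign_mem ha, sign_mem hb, sign_mem (mul_mem_gr ha hb rfl), sg_add, smul_mul_smul_comm]

theorem sign_one : A.sign 1 = 1 := by rw [sign_mem one_mem_gr, sg_zero, one_smul]

/-- The sign operator as an algebra map. -/
noncomputable def signHom (A : GrAlg R) : A →ₐ[R] A :=
  AlgHom.ofLinearMap A.sign sign_one sign_mul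

theorem signHom_apply (a : A) : A.signHom a = A.sign a := rfl

theorem sign_mem_gr {n : ℤ} {a : A} (ha : a ∈ A.gr n) : A.sign a ∈ A.gr n := by
  rw [sign_mem ha]; exact zsmul_mem_gr ha

/-- The homogeneous component of degree `n`. -/
noncomputable def comp (A : GrAlg R) (n : ℤ) : A →ₗ[R] A :=
  (A.gr n).subtype ∘ₗ DirectSum.component R ℤ _ n ∘ₗ (DirectSum.decomposeLinearEquiv A.gr).toLinearMap

theorem comp_mem_gr (n : ℤ) (a : A) : A.comp n a ∈ A.gr n := SetLike.coe_mem _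

theorem comp_of_mem {n : ℤ} {a : A} (ha : a ∈ A.gr n) : A.comp n a = a :=
  DirectSum.decompose_of_mem_same A.gr ha

theorem comp_of_mem_ne {m n : ℤ} {a : A} (ha : a ∈ A.gr m) (h : m ≠ n) : A.comp n a = 0 :=
  DirectSum.decompose_of_mem_ne A.gr ha h

/-- This allows a solution of a linear equation between homogeneous maps to be replaced by one of
its homogeneous components. -/
theorem HasDegree.comp_eq {r : ℤ} {f : A →ₗ[R] B} (hf : HasDegree r f) (n : ℤ) (a : A) :
    f (A.comp n a) = B.comp (n + r) (f a) := by
  induction a using homog_induction with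
  | zero => simp
  | add x y hx hy => simp only [map_add, hx, hy]
  | homog m a ha =>
    by_cases h : m = n
    · subst h; rw [comp_of_mem ha, comp_of_mem (hf m a ha)]
    · rw [comp_of_mem_ne ha h, comp_of_mem_ne (hf m a ha) (by omega), map_zero]

theorem HasDegree.sign {r : ℤ} {f : A →ₗ[R] B} (hf : HasDegree r f) (a : A) :
    B.sign (f a) = sg r • f (A.sign a) := by
  induction a using homog_induction with
  | zero => simp
  | add x y hx hy => simp only [map_add, hx, hy, smul_add]
  | homog m a ha => rw [sign_mem ha, sign_mem (hf m a ha), sg_add, map_zsmul, smul_smul, mul_comm]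

theorem HasDegree.sign₀ {f : A →ₗ[R] B} (hf : HasDegree 0 f) (a : A) :
    B.sign (f a) = f (A.sign a) := by rw [hf.sign, sg_zero, one_smul]

theorem HasDegree.sign₁ {f : A →ₗ[R] B} (hf : HasDegree 1 f) (a : A) :
    B.sign (f a) = - f (A.sign a) := by rw [hf.sign, sg_one, neg_smul, one_smul]

theorem HasDegree.sign₂ {f : A →ₗ[R] B} (hf : HasDegree 2 f) (a : A) :
    B.sign (f a) = f (A.sign a) := by
  rw [hf.sign, show (2 : ℤ) = 1 + 1 from rfl, sg_add, sg_one]; simp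

theorem HasDegree.comp {r s : ℤ} {f : A →ₗ[R] B} {g : B →ₗ[R] C} (hg : HasDegree s g)
    (hf : HasDegree r f) {t : ℤ} (h : r + s = t) : HasDegree t (g ∘ₗ f) := by
  intro n x hx
  have := hg _ _ (hf n x hx)
  rwa [add_assoc, h] at this

theorem HasDegree.add {r : ℤ} {f g : A →ₗ[R] B} (hf : HasDegree r f)
    (hg : HasDegree r g) : HasDegree r (f + g) :=
  fun n x hx => add_mem (hf n x hx) (hg n x hx)

theorem HasDegree.sub {r : ℤ} {f g : A →ₗ[R] B} (hf : HasDegree r f)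
    (hg : HasDegree r g) : HasDegree r (f - g) :=
  fun n x hx => sub_mem (hf n x hx) (hg n x hx)

theorem hasDegree_id : HasDegree 0 (LinearMap.id : A →ₗ[R] A) :=
  fun n x hx => by rw [add_zero]; exact hx

theorem hasDegree_sign : HasDegree 0 A.sign :=
  fun n x hx => by rw [add_zero]; exact sign_mem_gr hx

/-! ### Elements of tensor products -/

/-- `a ⊗ b` as a bilinear function. -/
noncomputable def tmulₗ (A B : GrAlg R) : A →ₗ[R] B →ₗ[R] A.tensor B :=
  TensorProduct.mk R A B

theorem tmulₗ_apply (a : A) (b : B) : tmulₗ A B a b = tmul a b := rfl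

theorem add_tmul (a a' : A) (b : B) : tmul (a + a') b = tmul a b + tmul a' b := by
  simp only [← tmulₗ_apply, map_add, LinearMap.add_apply]

theorem tmul_add (a : A) (b b' : B) : tmul a (b + b') = tmul a b + tmul a b' := by
  simp only [← tmulₗ_apply, map_add]

theorem sub_tmul (a a' : A) (b : B) : tmul (a - a') b = tmul a b - tmul a' b := by
  simp only [← tmulₗ_apply, map_sub, LinearMap.sub_apply]

theorem tmul_sub (a : A) (b b' : B) : tmul a (b - b') = tmul a b - tmul a b' := by
  simp only [← tmulₗ_apply, map_sub]

theorem neg_tmul (a : A) (b : B) : tmul (-a) b = -tmul a b := by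
  simp only [← tmulₗ_apply, map_neg, LinearMap.neg_apply]

theorem zsmul_tmul (k : ℤ) (a : A) (b : B) : tmul (k • a) b = k • tmul a b := by
  simp only [← tmulₗ_apply, map_zsmul, LinearMap.smul_apply]

theorem tmul_zsmul (k : ℤ) (a : A) (b : B) : tmul a (k • b) = k • tmul a b := by
  simp only [← tmulₗ_apply, map_zsmul]

theorem smul_tmul (k : R) (a : A) (b : B) : tmul (k • a) b = k • tmul a b := by
  simp only [← tmulₗ_apply, map_smul, LinearMap.smul_apply]

theorem tmul_smul (k : R) (a : A) (b : B) : tmul a (k • b) = k • tmul a b := by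
  simp only [← tmulₗ_apply, map_smul]

theorem tmul_mem_gr {i j n : ℤ} {a : A} {b : B} (ha : a ∈ A.gr i) (hb : b ∈ B.gr j)
    (h : i + j = n) : tmul a b ∈ (A.tensor B).gr n :=
  tmul_mem A.gr B.gr h ha hb

theorem tensor_induction' {P : A.tensor B → Prop} (t : A.tensor B) (zero : P 0)
    (add : ∀ x y, P x → P y → P (x + y)) (tmul : ∀ a b, P (tmul a b)) : P t :=
  TensorProduct.induction_on (motive := P) t zero tmul add

theorem tensor_induction {P : A.tensor B → Prop} (t : A.tensor B) (zero : P 0)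
    (add : ∀ x y, P x → P y → P (x + y))
    (tmul : ∀ i j a b, a ∈ A.gr i → b ∈ B.gr j → P (tmul a b)) : P t := by
  induction t using tensor_induction' with
  | zero => exact zero
  | add x y hx hy => exact add x y hx hy
  | tmul a b =>
    induction a using homog_induction with
    | zero => rw [zero_tmul]; exact zero
    | add x y hx hy => rw [add_tmul]; exact add _ _ hx hy
    | homog i a ha =>
      induction b using homog_induction with
      | zero => rw [tmul_zero]; exact zero
      | add x y hx hy => rw [tmul_add]; exact add _ _ hx hy
      | homog j b hb => exact tmul i j a b ha hb

theorem tensor_ext {M : Type*} [AddCommGroup M] [Module R M] {f g : A.tensor B →ₗ[R] M}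
    (h : ∀ a b, f (tmul a b) = g (tmul a b)) : f = g := by
  ext t
  induction t using tensor_induction' with
  | zero => simp
  | add x y hx hy => rw [map_add, map_add, hx, hy]
  | tmul a b => exact h a b

theorem tmul_mul {i j : ℤ} (a : A) {b : B} (hb : b ∈ B.gr j) {a' : A} (ha' : a' ∈ A.gr i) (b' : B) :
    tmul a b * tmul a' b' = sg (j * i) • tmul (a * a') (b * b') :=
  GradedTensorProduct.tmul_coe_mul_coe_tmul (R := R) A.gr B.gr a ⟨b, hb⟩ ⟨a', ha'⟩ b'

theorem one_eq_tmul : (1 : A.tensor B) = tmul 1 1 := rfl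

theorem sign_tmul (a : A) (b : B) : (A.tensor B).sign (tmul a b) = tmul (A.sign a) (B.sign b) := by
  induction a using homog_induction with
  | zero => simp [zero_tmul]
  | add x y hx hy => simp only [map_add, add_tmul, hx, hy]
  | homog i a ha =>
    induction b using homog_induction with
    | zero => simp [tmul_zero]
    | add x y hx hy => simp only [map_add, tmul_add, hx, hy]
    | homog j b hb =>
      rw [sign_mem ha, sign_mem hb, sign_mem (tmul_mem_gr ha hb rfl), zsmul_tmul, tmul_zsmul,
        smul_smul, sg_add]

theorem hasDegree_tensor {r : ℤ} {f : A.tensor B →ₗ[R] C}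
    (h : ∀ i j a b, a ∈ A.gr i → b ∈ B.gr j → f (tmul a b) ∈ C.gr (i + j + r)) :
    HasDegree r f := by
  intro n x hx
  change x ∈ tensorGrading A.gr B.gr n at hx
  induction hx using Submodule.span_induction with
  | mem x hx =>
    obtain ⟨i, j, a, b, rfl, ha, hb, rfl⟩ := hx
    exact h i j a b ha hb
  | zero => rw [map_zero]; exact zero_mem _
  | add x y _ _ hx hy => rw [map_add]; exact add_mem hx hy
  | smul c x _ hx => rw [map_smul]; exact Submodule.smul_mem _ c hx

theorem hasDegree_tensorMap {r s t : ℤ} {f : A →ₗ[R] C} {g : B →ₗ[R] D} (hf : HasDegree r f)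
    (hg : HasDegree s g) (h : r + s = t) : HasDegree t (tensorMap f g) :=
  hasDegree_tensor fun i j a b ha hb => by
    rw [tensorMap_tmul]
    exact tmul_mem_gr (hf i a ha) (hg j b hb) (by omega)

theorem swap_tmul {i j : ℤ} {a : A} {b : B} (ha : a ∈ A.gr i) (hb : b ∈ B.gr j) :
    swap A B (tmul a b) = sg (j * i) • tmul b a :=
  GradedTensorProduct.comm_coe_tmul_coe A.gr B.gr ⟨a, ha⟩ ⟨b, hb⟩

theorem assoc_tmul (a : A) (b : B) (c : C) :
    assoc A B C (tmul (tmul a b) c) = tmul a (tmul b c) := rfl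

theorem contractLeft_tmul (e : A →ₗ[R] R) (a : A) (b : B) :
    contractLeft e (tmul a b) = e a • b := rfl

theorem contractRight_tmul (e : B →ₗ[R] R) (a : A) (b : B) :
    contractRight e (tmul a b) = e b • a := rfl

theorem tensor_assoc_induction {P : (A.tensor B).tensor C → Prop} (t : (A.tensor B).tensor C)
    (zero : P 0) (add : ∀ x y, P x → P y → P (x + y))
    (tmul : ∀ i j k a b c, a ∈ A.gr i → b ∈ B.gr j → c ∈ C.gr k → P (tmul (tmul a b) c)) : P t := by
  induction t using tensor_induction' with
  | zero => exact zero
  | add x y hx hy => exact add x y hx hy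
  | tmul x c =>
    induction x using tensor_induction with
    | zero => rw [zero_tmul]; exact zero
    | add x y hx hy => rw [add_tmul]; exact add _ _ hx hy
    | tmul i j a b ha hb =>
      induction c using homog_induction with
      | zero => rw [tmul_zero]; exact zero
      | add x y hx hy => rw [tmul_add]; exact add _ _ hx hy
      | homog k c hc => exact tmul i j k a b c ha hb hc

end GrAlg

/-! ### Tensor products of dga's, their structure maps, and contraction with a counit. -/

namespace GrAlg

variable {R : Type u} [CommRing R] {A B C D : GrAlg R}

theorem tensorMap_mul {f : A →ₗ[R] C} {g : B →ₗ[R] D} (hf : HasDegree 0 f)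
    (hg : HasDegree 0 g) (hfm : ∀ x y, f (x * y) = f x * f y) (hgm : ∀ x y, g (x * y) = g x * g y)
    (x y : A.tensor B) : tensorMap f g (x * y) = tensorMap f g x * tensorMap f g y := by
  induction x using tensor_induction with
  | zero => simp
  | add x x' h h' => rw [add_mul, map_add, map_add, h, h', add_mul]
  | tmul i j a b ha hb =>
    induction y using tensor_induction with
    | zero => simp
    | add x x' h h' => rw [mul_add, map_add, map_add, h, h', mul_add]
    | tmul i' j' a' b' ha' hb' =>
      have h1 := hg j b hb
      have h2 := hf i' a' ha'
      rw [add_zero] at h1 h2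
      rw [tmul_mul a hb ha' b', map_zsmul, tensorMap_tmul, tensorMap_tmul, tensorMap_tmul, hfm, hgm,
        tmul_mul _ h1 h2]

theorem IsDGAHom.tensor {dA : A →ₗ[R] A} {dB : B →ₗ[R] B} {dC : C →ₗ[R] C} {dD : D →ₗ[R] D}
    {f : A →ₗ[R] C} {g : B →ₗ[R] D} (hf : IsDGAHom dA dC f) (hg : IsDGAHom dB dD g) :
    IsDGAHom (tensorD dA dB) (tensorD dC dD) (tensorMap f g) where
  degree := hasDegree_tensorMap hf.degree hg.degree (add_zero 0)
  map_one := by rw [one_eq_tmul, tensorMap_tmul, hf.map_one, hg.map_one]; rfl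
  map_mul := tensorMap_mul hf.degree hg.degree hf.map_mul hg.map_mul
  map_d x := by
    induction x using tensor_induction' with
    | zero => simp
    | add x x' h h' => simp only [map_add, h, h']
    | tmul a b =>
      simp only [tensorD_tmul, map_add, tensorMap_tmul, hf.map_d, hg.map_d, hf.degree.sign₀]

theorem isDGAHom_id (dA : A →ₗ[R] A) : IsDGAHom dA dA LinearMap.id :=
  ⟨hasDegree_id, rfl, fun _ _ => rfl, fun _ => rfl⟩

theorem IsDGAHom.comp {dA : A →ₗ[R] A} {dB : B →ₗ[R] B} {dC : C →ₗ[R] C}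
    {f : A →ₗ[R] B} {g : B →ₗ[R] C} (hg : IsDGAHom dB dC g) (hf : IsDGAHom dA dB f) :
    IsDGAHom dA dC (g ∘ₗ f) where
  degree := hg.degree.comp hf.degree (add_zero 0)
  map_one := by rw [LinearMap.comp_apply, hf.map_one, hg.map_one]
  map_mul x y := by simp only [LinearMap.comp_apply, hf.map_mul, hg.map_mul]
  map_d x := by simp only [LinearMap.comp_apply, hf.map_d, hg.map_d]

theorem hasDegree_tensorD {dA : A →ₗ[R] A} {dB : B →ₗ[R] B} (hA : HasDegree (-1) dA)
    (hB : HasDegree (-1) dB) : HasDegree (-1) (tensorD dA dB) :=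
  (hasDegree_tensorMap hA hasDegree_id (add_zero _)).add
    (hasDegree_tensorMap hasDegree_sign hB (zero_add _))

theorem isDGA_tensorD {dA : A →ₗ[R] A} {dB : B →ₗ[R] B} (hA : IsDGA dA) (hB : IsDGA dB) :
    IsDGA (tensorD dA dB) where
  degree := hasDegree_tensorD hA.degree hB.degree
  leibniz x y := by
    induction x using tensor_induction with
    | zero => simp
    | add x x' h h' => simp only [add_mul, map_add, h, h']; abel
    | tmul i j a b ha hb =>
      induction y using tensor_induction with
      | zero => simp
      | add x x' h h' => simp only [mul_add, map_add, h, h']; abel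
      | tmul i' j' a' b' ha' hb' =>
        rw [tmul_mul a hb ha' b', map_zsmul, tensorD_tmul, tensorD_tmul, tensorD_tmul, sign_tmul,
          add_mul, mul_add, hA.leibniz, hB.leibniz, sign_mul, sign_mem ha, sign_mem hb,
          sign_mem ha', tmul_mul _ hb ha', tmul_mul _ (hB.degree j b hb) ha',
          tmul_mul _ (zsmul_mem_gr hb) (hA.degree i' a' ha'),
          tmul_mul _ (zsmul_mem_gr hb) (zsmul_mem_gr ha')]
        simp only [add_tmul, tmul_add, smul_mul_assoc, mul_smul_comm, zsmul_tmul, tmul_zsmul,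
          ← sub_eq_add_neg, sub_mul, mul_sub, one_mul, mul_one, sg_sub]
        match_scalars
        · ring
        · rcases sg_eq j with h | h <;> simp [h]
        · rcases sg_eq i' with h | h <;> simp [h]
        · ring
  sq x := by
    induction x using tensor_induction' with
    | zero => simp
    | add x x' h h' => simp only [map_add, h, h', add_zero]
    | tmul a b =>
      simp only [tensorD_tmul, map_add, hA.sq, hB.sq, zero_tmul, tmul_zero, d_sign hA.degree,
        neg_tmul]
      abel

theorem isDGAHom_swap {dA : A →ₗ[R] A} {dB : B →ₗ[R] B} (hA : HasDegree (-1) dA)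
    (hB : HasDegree (-1) dB) : IsDGAHom (tensorD dA dB) (tensorD dB dA) (swap A B) where
  degree := hasDegree_tensor fun i j a b ha hb => by
    rw [swap_tmul ha hb]
    exact zsmul_mem_gr (tmul_mem_gr hb ha (by ring))
  map_one := map_one (GradedTensorProduct.comm A.gr B.gr)
  map_mul := map_mul (GradedTensorProduct.comm A.gr B.gr)
  map_d x := by
    induction x using tensor_induction with
    | zero => simp
    | add x x' h h' => simp only [map_add, h, h']
    | tmul i j a b ha hb =>
      rw [tensorD_tmul, sign_mem ha, zsmul_tmul, map_add, map_zsmul, swap_tmul (hA i a ha) hb,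
        swap_tmul ha (hB j b hb), swap_tmul ha hb, map_zsmul, tensorD_tmul, sign_mem hb,
        zsmul_tmul]
      simp only [← sub_eq_add_neg, sub_mul, mul_sub, one_mul, mul_one, sg_sub]
      match_scalars
      · ring
      · rcases sg_eq i with h | h <;> simp [h]

theorem isDGAHom_assoc (dA : A →ₗ[R] A) (dB : B →ₗ[R] B) (dC : C →ₗ[R] C) :
    IsDGAHom (tensorD (tensorD dA dB) dC) (tensorD dA (tensorD dB dC)) (assoc A B C) where
  degree n x hx := by
    -- Membership in a degree cannot be tested on triple tensors directly. It is restated as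
    -- invariance under a component projection, which is linear in x.
    have h : (assoc A B C) x = (A.tensor (B.tensor C)).comp n (assoc A B C x) := by
      conv_lhs => rw [← comp_of_mem hx]
      clear hx
      induction x using tensor_assoc_induction with
      | zero => simp
      | add x y hx hy => simp only [map_add, hx, hy]
      | tmul i j k a b c ha hb hc =>
        have h1 := tmul_mem_gr (tmul_mem_gr ha hb rfl) hc rfl
        have h2 := tmul_mem_gr ha (tmul_mem_gr hb hc rfl) (add_assoc i j k).symm
        by_cases h : i + j + k = n
        · subst h
          rw [comp_of_mem h1, assoc_tmul, comp_of_mem h2]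
        · rw [comp_of_mem_ne h1 h, assoc_tmul, comp_of_mem_ne h2 h, map_zero]
    rw [h, add_zero]
    exact comp_mem_gr _ _
  map_one := rfl
  map_mul x y := by
    induction x using tensor_assoc_induction with
    | zero => simp
    | add x x' h h' => simp only [add_mul, map_add, h, h']
    | tmul i j k a b c ha hb hc =>
      induction y using tensor_assoc_induction with
      | zero => simp
      | add x x' h h' => simp only [mul_add, map_add, h, h']
      | tmul i' j' k' a' b' c' ha' hb' hc' =>
        rw [tmul_mul _ hc (tmul_mem_gr ha' hb' rfl), tmul_mul _ hb ha', map_zsmul, zsmul_tmul,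
          map_zsmul, assoc_tmul, assoc_tmul, assoc_tmul, tmul_mul _ (tmul_mem_gr hb hc rfl) ha',
          tmul_mul _ hc hb', tmul_zsmul, smul_smul, smul_smul, mul_add, add_mul, sg_add, sg_add]
        congr 1; ring
  map_d x := by
    induction x using tensor_assoc_induction with
    | zero => simp
    | add x x' h h' => simp only [map_add, h, h']
    | tmul i j k a b c ha hb hc =>
      simp only [tensorD_tmul, map_add, add_tmul, tmul_add, assoc_tmul, sign_tmul, add_assoc]

/-- Outside degree 0 the augmentation vanishes, and in degree 0 the sign is trivial. Koszul signs
are therefore invisible after contraction. -/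
theorem apply_eq_zero_of_degree {e : A →ₗ[R] R} (he : ∀ n, n ≠ 0 → ∀ x ∈ A.gr n, e x = 0)
    {i : ℤ} {a : A} (ha : a ∈ A.gr i) (j : ℤ) : sg (j * i) • e a = e a := by
  by_cases h : i = 0
  · subst h; rw [mul_zero, sg_zero, one_smul]
  · rw [he i h a ha, smul_zero]

theorem apply_sign_of_degree {e : A →ₗ[R] R} (he : ∀ n, n ≠ 0 → ∀ x ∈ A.gr n, e x = 0)
    (a : A) : e (A.sign a) = e a := by
  induction a using homog_induction with
  | zero => simp
  | add x y hx hy => simp only [map_add, hx, hy]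
  | homog n a ha => rw [sign_mem ha, map_zsmul, ← one_mul n, apply_eq_zero_of_degree he ha]

theorem contractLeft_mul {e : A →ₗ[R] R} (he : ∀ n, n ≠ 0 → ∀ x ∈ A.gr n, e x = 0)
    (hm : ∀ x y, e (x * y) = e x * e y) (x y : A.tensor B) :
    contractLeft e (x * y) = contractLeft e x * contractLeft e y := by
  induction x using tensor_induction with
  | zero => simp
  | add x x' h h' => simp only [add_mul, map_add, h, h']
  | tmul i j a b ha hb =>
    induction y using tensor_induction with
    | zero => simp
    | add x x' h h' => simp only [mul_add, map_add, h, h']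
    | tmul i' j' a' b' ha' hb' =>
      rw [tmul_mul a hb ha' b', map_zsmul, contractLeft_tmul, contractLeft_tmul, contractLeft_tmul,
        hm, smul_mul_smul_comm, ← smul_assoc (sg (j * i')) (e a * e a'), ← mul_smul_comm _ (e a) (e a'),
        apply_eq_zero_of_degree he ha']

theorem contractRight_mul {e : B →ₗ[R] R} (he : ∀ n, n ≠ 0 → ∀ x ∈ B.gr n, e x = 0)
    (hm : ∀ x y, e (x * y) = e x * e y) (x y : A.tensor B) :
    contractRight e (x * y) = contractRight e x * contractRight e y := by
  induction x using tensor_induction with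
  | zero => simp
  | add x x' h h' => simp only [add_mul, map_add, h, h']
  | tmul i j a b ha hb =>
    induction y using tensor_induction with
    | zero => simp
    | add x x' h h' => simp only [mul_add, map_add, h, h']
    | tmul i' j' a' b' ha' hb' =>
      rw [tmul_mul a hb ha' b', map_zsmul, contractRight_tmul, contractRight_tmul,
        contractRight_tmul, hm, smul_mul_smul_comm, ← smul_assoc (sg (j * i')) (e b * e b'),
        ← smul_mul_assoc _ (e b) (e b'), mul_comm j i', apply_eq_zero_of_degree he hb]

theorem contractLeft_d {e : A →ₗ[R] R} (he : ∀ n, n ≠ 0 → ∀ x ∈ A.gr n, e x = 0)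
    {dA : A →ₗ[R] A} (hd : ∀ x, e (dA x) = 0) (dB : B →ₗ[R] B) (x : A.tensor B) :
    contractLeft e (tensorD dA dB x) = dB (contractLeft e x) := by
  induction x using tensor_induction' with
  | zero => simp
  | add x x' h h' => simp only [map_add, h, h']
  | tmul a b =>
    rw [tensorD_tmul, map_add, contractLeft_tmul, contractLeft_tmul, contractLeft_tmul, hd,
      zero_smul, zero_add, map_smul, apply_sign_of_degree he]

theorem contractRight_d {e : B →ₗ[R] R} {dB : B →ₗ[R] B} (hd : ∀ x, e (dB x) = 0)
    (dA : A →ₗ[R] A) (x : A.tensor B) :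
    contractRight e (tensorD dA dB x) = dA (contractRight e x) := by
  induction x using tensor_induction' with
  | zero => simp
  | add x x' h h' => simp only [map_add, h, h']
  | tmul a b =>
    rw [tensorD_tmul, map_add, contractRight_tmul, contractRight_tmul, contractRight_tmul, hd,
      zero_smul, add_zero, map_smul]

theorem contractLeft_tensorMap {e : A →ₗ[R] R} {e' : C →ₗ[R] R} {f : A →ₗ[R] C} (g : B →ₗ[R] D)
    (h : ∀ x, e' (f x) = e x) (x : A.tensor B) :
    contractLeft e' (tensorMap f g x) = g (contractLeft e x) := by
  induction x using tensor_induction' with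
  | zero => simp
  | add x x' h h' => simp only [map_add, h, h']
  | tmul a b => rw [tensorMap_tmul, contractLeft_tmul, contractLeft_tmul, h, map_smul]

theorem contractRight_tensorMap {e : B →ₗ[R] R} {e' : D →ₗ[R] R} (f : A →ₗ[R] C) {g : B →ₗ[R] D}
    (h : ∀ x, e' (g x) = e x) (x : A.tensor B) :
    contractRight e' (tensorMap f g x) = f (contractRight e x) := by
  induction x using tensor_induction' with
  | zero => simp
  | add x x' h h' => simp only [map_add, h, h']
  | tmul a b => rw [tensorMap_tmul, contractRight_tmul, contractRight_tmul, h, map_smul]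

/-! ### Derivation homotopies and composition -/

theorem DerivationHomotopic.postcomp {dA : A →ₗ[R] A} {dB : B →ₗ[R] B} {dC : C →ₗ[R] C}
    {f g : A →ₗ[R] B} (h : DerivationHomotopic dA dB f g) {k : B →ₗ[R] C} (hk : IsDGAHom dB dC k) :
    DerivationHomotopic dA dC (k ∘ₗ f) (k ∘ₗ g) := by
  obtain ⟨s, h1, h2, h3⟩ := h
  refine ⟨k ∘ₗ s, hk.degree.comp h1 (add_zero 1), fun x => ?_, fun x y => ?_⟩
  · simp only [LinearMap.comp_apply]
    rw [← hk.map_d, ← map_add, h2, map_sub]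
  · simp only [LinearMap.comp_apply, h3, map_add, hk.map_mul]

theorem DerivationHomotopic.precomp {dA : A →ₗ[R] A} {dB : B →ₗ[R] B} {dC : C →ₗ[R] C}
    {f g : B →ₗ[R] C} (h : DerivationHomotopic dB dC f g) {k : A →ₗ[R] B} (hk : IsDGAHom dA dB k) :
    DerivationHomotopic dA dC (f ∘ₗ k) (g ∘ₗ k) := by
  obtain ⟨s, h1, h2, h3⟩ := h
  refine ⟨s ∘ₗ k, h1.comp hk.degree (zero_add 1), fun x => ?_, fun x y => ?_⟩
  · simp only [LinearMap.comp_apply, hk.map_d, h2]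
  · simp only [LinearMap.comp_apply, h3, hk.map_mul, hk.degree.sign₀]

/-- The homotopy is s ⊗ k. Only one tensor factor varies at a time; changing both is left to
transitivity. -/
theorem DerivationHomotopic.tensor_left {dA : A →ₗ[R] A} {dB : B →ₗ[R] B} {dC : C →ₗ[R] C}
    {dD : D →ₗ[R] D} {f g : A →ₗ[R] C} (h : DerivationHomotopic dA dC f g)
    (hg : HasDegree 0 g) {k : B →ₗ[R] D} (hk : IsDGAHom dB dD k) :
    DerivationHomotopic (tensorD dA dB) (tensorD dC dD) (tensorMap f k) (tensorMap g k) := by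
  obtain ⟨s, h1, h2, h3⟩ := h
  refine ⟨tensorMap s k, hasDegree_tensorMap h1 hk.degree (add_zero 1), fun x => ?_, fun x y => ?_⟩
  · induction x using tensor_induction' with
    | zero => simp
    | add x x' h h' =>
      simp only [map_add]
      rw [add_add_add_comm, h, h']; abel
    | tmul a b =>
      simp only [tensorD_tmul, map_add, tensorMap_tmul, hk.map_d, h1.sign₁, neg_tmul]
      rw [← sub_tmul, ← h2, add_tmul]; abel
  · induction x using tensor_induction with
    | zero => simp
    | add x x' h h' => simp only [add_mul, map_add, h, h']; abel
    | tmul i j a b ha hb =>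
      induction y using tensor_induction with
      | zero => simp
      | add x x' h h' => simp only [mul_add, map_add, h, h']; abel
      | tmul i' j' a' b' ha' hb' =>
        have k1 := hk.degree j b hb
        have g1 := hg i' a' ha'
        rw [add_zero] at k1 g1
        rw [tmul_mul a hb ha' b', map_zsmul, sign_tmul]
        simp only [tensorMap_tmul]
        rw [sign_mem ha, sign_mem hb, map_zsmul, map_zsmul,
          tmul_mul _ (zsmul_mem_gr k1) (h1 i' a' ha'), tmul_mul _ k1 g1, h3, hk.map_mul,
          sign_mem ha, map_zsmul]
        simp only [smul_mul_assoc, add_tmul, zsmul_tmul, tmul_zsmul, mul_add, mul_one, sg_add]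
        match_scalars
        · rcases sg_eq j with h | h <;> simp [h]
        · ring

/-- The homotopy sends b ⊗ a to (-1)^{|b|} k(b) ⊗ s(a), the sign being that of moving s past b. -/
theorem DerivationHomotopic.tensor_right {dA : A →ₗ[R] A} {dB : B →ₗ[R] B} {dC : C →ₗ[R] C}
    {dD : D →ₗ[R] D} {f g : A →ₗ[R] C} (h : DerivationHomotopic dA dC f g) (hf : HasDegree 0 f)
    {k : B →ₗ[R] D} (hk : IsDGAHom dB dD k) (hB : HasDegree (-1) dB) :
    DerivationHomotopic (tensorD dB dA) (tensorD dD dC) (tensorMap k f) (tensorMap k g) := by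
  obtain ⟨s, h1, h2, h3⟩ := h
  refine ⟨tensorMap (k ∘ₗ B.sign) s,
    hasDegree_tensorMap (hk.degree.comp hasDegree_sign (add_zero 0)) h1 (zero_add 1),
    fun x => ?_, fun x y => ?_⟩
  · induction x using tensor_induction' with
    | zero => simp
    | add x x' h h' =>
      simp only [map_add]
      rw [add_add_add_comm, h, h']; abel
    | tmul b a =>
      simp only [tensorD_tmul, map_add, tensorMap_tmul, LinearMap.comp_apply, ← hk.map_d,
        d_sign hB, sign_sign, hk.degree.sign₀, map_neg, neg_tmul]
      rw [← tmul_sub, ← h2, tmul_add]; abel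
  · induction x using tensor_induction with
    | zero => simp
    | add x x' h h' => simp only [add_mul, map_add, h, h']; abel
    | tmul j i b a hb ha =>
      induction y using tensor_induction with
      | zero => simp
      | add x x' h h' => simp only [mul_add, map_add, h, h']; abel
      | tmul j' i' b' a' hb' ha' =>
        have k1 := hk.degree j' b' hb'
        rw [add_zero] at k1
        rw [tmul_mul b ha hb' a', map_zsmul, sign_tmul]
        simp only [tensorMap_tmul, LinearMap.comp_apply, sign_mul, hk.map_mul]
        have k2 := hk.degree j' _ (sign_mem_gr hb')
        have f1 := hf i _ (sign_mem_gr ha)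
        rw [add_zero] at k2 f1
        rw [tmul_mul _ f1 k2, tmul_mul _ (h1 i a ha) k1, h3, sign_mem hb', map_zsmul]
        simp only [mul_smul_comm, tmul_add, zsmul_tmul, smul_add, smul_smul, add_mul, one_mul,
          sg_add]

end GrAlg

/-! ### Modules with a ranked basis -/

section RankedBasis

variable {R ι M : Type*} [CommRing R] [AddCommGroup M] [Module R M]

/-- The span of the basis elements of rank `q`. -/
def rankDeg (b : Module.Basis ι R M) (r : ι → ℕ) (q : ℕ) : Submodule R M :=
  Submodule.span R (b '' {i | r i = q})

/-- The span of the basis elements of rank at most `n`. -/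
def rankFilt (b : Module.Basis ι R M) (r : ι → ℕ) (n : ℤ) : Submodule R M :=
  Submodule.span R (b '' {i | (r i : ℤ) ≤ n})

variable {b : Module.Basis ι R M} {r : ι → ℕ}

theorem mem_rankFilt {n : ℤ} {x : M} :
    x ∈ rankFilt b r n ↔ ∀ i, b.repr x i ≠ 0 → (r i : ℤ) ≤ n := by
  rw [rankFilt, Module.Basis.mem_span_image]
  exact ⟨fun h i hi => h (Finsupp.mem_support_iff.2 hi),
    fun h i hi => h i (Finsupp.mem_support_iff.1 hi)⟩

theorem basis_mem_rankDeg (i : ι) : b i ∈ rankDeg b r (r i) :=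
  Submodule.subset_span ⟨i, rfl, rfl⟩

theorem basis_mem_rankFilt {i : ι} {n : ℤ} (h : (r i : ℤ) ≤ n) : b i ∈ rankFilt b r n :=
  Submodule.subset_span ⟨i, h, rfl⟩

theorem rankFilt_mono {m n : ℤ} (h : m ≤ n) : rankFilt b r m ≤ rankFilt b r n :=
  Submodule.span_mono (Set.image_mono fun _ hi => le_trans hi h)

theorem rankDeg_le_rankFilt {q : ℕ} {n : ℤ} (h : (q : ℤ) ≤ n) : rankDeg b r q ≤ rankFilt b r n :=
  Submodule.span_mono (Set.image_mono fun i hi => by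
    change r i = q at hi; change (r i : ℤ) ≤ n; rw [hi]; exact h)

theorem rankFilt_neg {n : ℤ} (h : n < 0) : rankFilt b r n = ⊥ := by
  rw [rankFilt, Submodule.span_eq_bot]
  rintro _ ⟨i, hi, rfl⟩
  change (r i : ℤ) ≤ n at hi
  omega

theorem rankFilt_le_iff {n : ℤ} {S : Submodule R M} :
    rankFilt b r n ≤ S ↔ ∀ i, (r i : ℤ) ≤ n → b i ∈ S := by
  rw [rankFilt, Submodule.span_le, Set.image_subset_iff]; rfl

theorem rankDeg_le_iff {q : ℕ} {S : Submodule R M} :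
    rankDeg b r q ≤ S ↔ ∀ i, r i = q → b i ∈ S := by
  rw [rankDeg, Submodule.span_le, Set.image_subset_iff]; rfl

theorem exists_mem_rankFilt (x : M) : ∃ n : ℕ, x ∈ rankFilt b r n := by
  refine ⟨(b.repr x).support.sup r, mem_rankFilt.2 fun i hi => ?_⟩
  exact_mod_cast Finset.le_sup (f := r) (Finsupp.mem_support_iff.2 hi)

theorem rankFilt_eq_iSup (n : ℤ) : rankFilt b r n = ⨆ (q : ℕ) (_ : (q : ℤ) ≤ n), rankDeg b r q := by
  apply le_antisymm
  · refine rankFilt_le_iff.2 fun i hi => ?_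
    exact Submodule.mem_iSup_of_mem (r i) (Submodule.mem_iSup_of_mem hi (basis_mem_rankDeg i))
  · exact iSup₂_le fun q hq => rankDeg_le_rankFilt hq

/-- The projection to the span of the basis elements of rank `q`. -/
noncomputable def rankProj (b : Module.Basis ι R M) (r : ι → ℕ) (q : ℕ) : M →ₗ[R] M :=
  b.constr R (fun i => if r i = q then b i else 0)

theorem rankProj_basis (q : ℕ) (i : ι) : rankProj b r q (b i) = if r i = q then b i else 0 := by
  rw [rankProj, Module.Basis.constr_basis]

theorem rankProj_mem (q : ℕ) (x : M) : rankProj b r q x ∈ rankDeg b r q := by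
  have : (⊤ : Submodule R M) ≤ (rankDeg b r q).comap (rankProj b r q) := by
    rw [← b.span_eq, Submodule.span_le]
    rintro _ ⟨i, rfl⟩
    change rankProj b r q (b i) ∈ rankDeg b r q
    rw [rankProj_basis]
    split_ifs with h
    · exact h ▸ basis_mem_rankDeg i
    · exact zero_mem _
  exact this (Submodule.mem_top (x := x))

theorem rankProj_of_mem {q : ℕ} {x : M} (hx : x ∈ rankDeg b r q) : rankProj b r q x = x := by
  have : rankDeg b r q ≤ LinearMap.ker (rankProj b r q - LinearMap.id) :=
    rankDeg_le_iff.2 fun i hi => by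
      rw [LinearMap.mem_ker, LinearMap.sub_apply, rankProj_basis, if_pos hi, LinearMap.id_apply,
        sub_self]
  exact sub_eq_zero.1 (this hx)

theorem rankProj_of_mem_ne {p q : ℕ} {x : M} (hx : x ∈ rankDeg b r p) (h : p ≠ q) :
    rankProj b r q x = 0 := by
  have : rankDeg b r p ≤ LinearMap.ker (rankProj b r q) :=
    rankDeg_le_iff.2 fun i hi => by
      rw [LinearMap.mem_ker, rankProj_basis, if_neg (by omega)]
  exact this hx

theorem rankProj_of_mem_filt {q : ℕ} {n : ℤ} {x : M} (hx : x ∈ rankFilt b r n) (h : n < q) :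
    rankProj b r q x = 0 := by
  have : rankFilt b r n ≤ LinearMap.ker (rankProj b r q) :=
    rankFilt_le_iff.2 fun i hi => by
      rw [LinearMap.mem_ker, rankProj_basis, if_neg (by omega)]
  exact this hx

theorem sub_rankProj_mem {n : ℕ} {x : M} (hx : x ∈ rankFilt b r n) :
    x - rankProj b r n x ∈ rankFilt b r ((n : ℤ) - 1) := by
  have : rankFilt b r n ≤ (rankFilt b r ((n : ℤ) - 1)).comap (LinearMap.id - rankProj b r n) :=
    rankFilt_le_iff.2 fun i hi => by
      rw [Submodule.mem_comap, LinearMap.sub_apply, rankProj_basis, LinearMap.id_apply]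
      split_ifs with h
      · rw [sub_self]; exact zero_mem _
      · rw [sub_zero]; exact basis_mem_rankFilt (by omega)
  exact this hx

/-- A map lowering the rank by one commutes with the projections. -/
theorem rankProj_comm {d : M →ₗ[R] M} (h0 : ∀ x ∈ rankDeg b r 0, d x = 0)
    (h1 : ∀ q, ∀ x ∈ rankDeg b r (q + 1), d x ∈ rankDeg b r q) (q : ℕ) (x : M) :
    rankProj b r q (d x) = d (rankProj b r (q + 1) x) := by
  have : (⊤ : Submodule R M) ≤
      LinearMap.ker (rankProj b r q ∘ₗ d - d ∘ₗ rankProj b r (q + 1)) := by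
    rw [← b.span_eq, Submodule.span_le]
    rintro _ ⟨i, rfl⟩
    rw [SetLike.mem_coe, LinearMap.mem_ker, LinearMap.sub_apply, LinearMap.comp_apply,
      LinearMap.comp_apply, rankProj_basis, sub_eq_zero]
    rcases hr : r i with _ | p
    · rw [h0 _ (hr ▸ basis_mem_rankDeg i), if_neg (by omega), map_zero, map_zero]
    · have hm := h1 p _ (hr ▸ basis_mem_rankDeg (b := b) (r := r) i)
      by_cases hp : p = q
      · subst hp; rw [if_pos rfl, rankProj_of_mem hm]
      · rw [if_neg (by omega), rankProj_of_mem_ne hm hp, map_zero]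
  exact sub_eq_zero.1 (this (Submodule.mem_top (x := x)))

theorem rankFilt_map_le {M' : Type*} [AddCommGroup M'] [Module R M'] (f : M →ₗ[R] M')
    {S : ℤ → Submodule R M'} (hS : Monotone S) {c : ℤ}
    (h : ∀ q : ℕ, ∀ x ∈ rankDeg b r q, f x ∈ S (q + c)) {n : ℤ} {x : M}
    (hx : x ∈ rankFilt b r n) : f x ∈ S (n + c) := by
  have : rankFilt b r n ≤ (S (n + c)).comap f :=
    rankFilt_le_iff.2 fun i hi => hS (by omega) (h (r i) _ (basis_mem_rankDeg i))
  exact this hx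

end RankedBasis

/-! ### Words as a basis of the tensor algebra, and the resolution filtration. -/

namespace FreeGens

variable {R : Type u} [CommRing R] {A B : GrAlg R} (V : FreeGens A)

/-- The isomorphism from the free algebra. -/
noncomputable def equiv : FreeAlgebra R V.X ≃ₐ[R] A :=
  AlgEquiv.ofBijective (FreeAlgebra.lift R V.gen) V.free

theorem equiv_ι (v : V.X) : V.equiv (FreeAlgebra.ι R v) = V.gen v := by
  simp [equiv]

/-- The algebra map with given values on generators. -/
noncomputable def lift {S : Type*} [Ring S] [Algebra R S] (g : V.X → S) : A →ₐ[R] S :=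
  (FreeAlgebra.lift R g).comp V.equiv.symm.toAlgHom

theorem lift_gen {S : Type*} [Ring S] [Algebra R S] (g : V.X → S) (v : V.X) :
    V.lift g (V.gen v) = g v := by
  have : V.equiv.symm (V.gen v) = FreeAlgebra.ι R v := by
    rw [← V.equiv_ι, AlgEquiv.symm_apply_apply]
  simp [lift, this]

/-- The monomial of a word in the generators. -/
def word (l : List V.X) : A := (l.map V.gen).prod

theorem word_nil : V.word [] = 1 := rfl

theorem word_cons (v : V.X) (l : List V.X) : V.word (v :: l) = V.gen v * V.word l := by
  simp [word]

theorem word_append (l l' : List V.X) : V.word (l ++ l') = V.word l * V.word l' := by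
  simp [word]

/-- The resolution degree of a word. -/
def wres (l : List V.X) : ℕ := (l.map V.res).sum

/-- The total degree of a generator. -/
def deg (v : V.X) : ℤ := V.res v + V.int v

/-- The total degree of a word. -/
def wdeg (l : List V.X) : ℤ := (l.map V.deg).sum

theorem wres_cons (v : V.X) (l : List V.X) : V.wres (v :: l) = V.res v + V.wres l := by
  simp [wres]

theorem wdeg_cons (v : V.X) (l : List V.X) : V.wdeg (v :: l) = V.deg v + V.wdeg l := by
  simp [wdeg]

theorem gen_mem_gr (v : V.X) : V.gen v ∈ A.gr (V.deg v) := V.gen_mem v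

theorem word_mem_gr (l : List V.X) : V.word l ∈ A.gr (V.wdeg l) := by
  induction l with
  | nil => exact GrAlg.one_mem_gr
  | cons v l ih =>
    rw [word_cons, wdeg_cons]
    exact GrAlg.mul_mem_gr (V.gen_mem_gr v) ih rfl

/-- The basis of words. -/
noncomputable def basis : Module.Basis (List V.X) R A :=
  ((FreeAlgebra.basisFreeMonoid R V.X).map V.equiv.toLinearEquiv).reindex FreeMonoid.toList

theorem basis_apply (l : List V.X) : V.basis l = V.word l := by
  have h : ∀ l : List V.X, V.equiv (FreeAlgebra.basisFreeMonoid R V.X (FreeMonoid.ofList l))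
      = V.word l := by
    intro l
    have h1 : FreeAlgebra.basisFreeMonoid R V.X (FreeMonoid.ofList l)
        = (l.map (FreeAlgebra.ι R)).prod := by
      simp [FreeAlgebra.basisFreeMonoid, FreeAlgebra.equivMonoidAlgebraFreeMonoid,
        MonoidAlgebra.lift_single, FreeMonoid.lift_apply]
    rw [h1, map_list_prod, List.map_map]
    congr 1
    exact List.map_congr_left fun v _ => V.equiv_ι v
  rw [basis, Module.Basis.reindex_apply, Module.Basis.map_apply]
  exact h l

theorem mem_of_words (S : Submodule R A) (h : ∀ l, V.word l ∈ S) (x : A) : x ∈ S := by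
  have : (⊤ : Submodule R A) ≤ S := by
    rw [← V.basis.span_eq, Submodule.span_le]
    rintro _ ⟨l, rfl⟩
    rw [basis_apply]; exact h l
  exact this trivial

theorem mem_of_gen_mul (S : Submodule R A) (h1 : (1 : A) ∈ S)
    (h : ∀ v, ∀ y ∈ S, V.gen v * y ∈ S) (x : A) : x ∈ S := by
  refine V.mem_of_words S (fun l => ?_) x
  induction l with
  | nil => exact h1
  | cons v l ih => rw [word_cons]; exact h v _ ih

/-- This identifies the resolution grading with the rank grading of the word basis, so that the
statements on ranked bases apply. -/
theorem resDeg_eq (q : ℕ) : V.resDeg q = rankDeg V.basis V.wres q := by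
  apply le_antisymm
  · refine iSup_le fun m => Submodule.span_le.2 ?_
    rintro _ ⟨l, rfl, rfl, rfl⟩
    have := basis_mem_rankDeg (b := V.basis) (r := V.wres) l
    rwa [basis_apply] at this
  · refine rankDeg_le_iff.2 fun l hl => ?_
    rw [basis_apply]
    exact Submodule.mem_iSup_of_mem (l.map V.int).sum (Submodule.subset_span ⟨l, hl, rfl, rfl⟩)

theorem resFilt_eq (n : ℤ) : V.resFilt n = rankFilt V.basis V.wres n := by
  rw [rankFilt_eq_iSup, resFilt]
  simp only [resDeg_eq]

theorem gen_mem_resDeg (v : V.X) : V.gen v ∈ V.resDeg (V.res v) := by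
  have := basis_mem_rankDeg (b := V.basis) (r := V.wres) [v]
  rw [basis_apply] at this
  rw [resDeg_eq]
  simpa [word, wres] using this

theorem word_mem_resDeg (l : List V.X) : V.word l ∈ V.resDeg (V.wres l) := by
  have := basis_mem_rankDeg (b := V.basis) (r := V.wres) l
  rwa [basis_apply, ← resDeg_eq] at this

theorem resFilt_mono : Monotone V.resFilt := fun m n h => by
  rw [resFilt_eq, resFilt_eq]; exact rankFilt_mono h

theorem resDeg_le_resFilt {q : ℕ} {n : ℤ} (h : (q : ℤ) ≤ n) : V.resDeg q ≤ V.resFilt n := by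
  rw [resFilt_eq, resDeg_eq]; exact rankDeg_le_rankFilt h

theorem resFilt_neg {n : ℤ} (h : n < 0) : V.resFilt n = ⊥ := by
  rw [resFilt_eq, rankFilt_neg h]

theorem resFilt_le_iff {n : ℤ} {S : Submodule R A} :
    V.resFilt n ≤ S ↔ ∀ l, (V.wres l : ℤ) ≤ n → V.word l ∈ S := by
  rw [resFilt_eq, rankFilt_le_iff]; simp only [basis_apply]

theorem resDeg_le_iff {q : ℕ} {S : Submodule R A} :
    V.resDeg q ≤ S ↔ ∀ l, V.wres l = q → V.word l ∈ S := by
  rw [resDeg_eq, rankDeg_le_iff]; simp only [basis_apply]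

/-- Induction on words in the generators of resolution degree less than `n`. -/
theorem resFilt_le_of_gen_mul {n : ℕ} (S : Submodule R A) (h1 : (1 : A) ∈ S)
    (h : ∀ v, V.res v < n → ∀ y ∈ V.resFilt ((n : ℤ) - 1), y ∈ S → V.gen v * y ∈ S) :
    V.resFilt ((n : ℤ) - 1) ≤ S := by
  refine V.resFilt_le_iff.2 fun l hl => ?_
  induction l with
  | nil => exact h1
  | cons v l ih =>
    rw [wres_cons] at hl
    rw [word_cons]
    exact h v (by omega) _ (V.resDeg_le_resFilt (by omega) (V.word_mem_resDeg l)) (ih (by omega))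

theorem resFilt_mul {m n k : ℤ} {x y : A} (hx : x ∈ V.resFilt m) (hy : y ∈ V.resFilt n)
    (h : m + n ≤ k) : x * y ∈ V.resFilt k := by
  have h1 : V.resFilt m ≤ (V.resFilt k).comap (LinearMap.mulRight R y) := by
    refine V.resFilt_le_iff.2 fun l hl => ?_
    have h2 : V.resFilt n ≤ (V.resFilt k).comap (LinearMap.mulLeft R (V.word l)) := by
      refine V.resFilt_le_iff.2 fun l' hl' => ?_
      rw [Submodule.mem_comap, LinearMap.mulLeft_apply, ← word_append]
      refine V.resDeg_le_resFilt ?_ (V.word_mem_resDeg _)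
      simp only [wres, List.map_append, List.sum_append, Nat.cast_add] at *
      omega
    exact h2 hy
  exact h1 hx

theorem one_mem_resFilt : (1 : A) ∈ V.resFilt 0 :=
  V.resDeg_le_resFilt (le_refl _) (V.word_mem_resDeg [])

theorem comp_mem_resDeg {q : ℕ} {x : A} (hx : x ∈ V.resDeg q) (n : ℤ) :
    A.comp n x ∈ V.resDeg q := by
  have : V.resDeg q ≤ (V.resDeg q).comap (A.comp n) := V.resDeg_le_iff.2 fun l hl => by
    rw [Submodule.mem_comap]
    by_cases h : V.wdeg l = n
    · subst h; rw [GrAlg.comp_of_mem (V.word_mem_gr l)]; exact hl ▸ V.word_mem_resDeg l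
    · rw [GrAlg.comp_of_mem_ne (V.word_mem_gr l) h]; exact zero_mem _
  exact this hx

theorem comp_mem_resFilt {m : ℤ} {x : A} (hx : x ∈ V.resFilt m) (n : ℤ) :
    A.comp n x ∈ V.resFilt m := by
  have : V.resFilt m ≤ (V.resFilt m).comap (A.comp n) := iSup₂_le fun q hq x hx =>
    V.resDeg_le_resFilt hq (V.comp_mem_resDeg hx n)
  exact this hx

theorem hasDegree_of_words {r : ℤ} {f : A →ₗ[R] B}
    (h : ∀ l, f (V.word l) ∈ B.gr (V.wdeg l + r)) : HasDegree r f := by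
  intro n x hx
  have key : ∀ y, f (A.comp n y) ∈ B.gr (n + r) := fun y =>
    V.mem_of_words ((B.gr (n + r)).comap (f ∘ₗ A.comp n)) (fun l => by
      rw [Submodule.mem_comap, LinearMap.comp_apply]
      by_cases h' : V.wdeg l = n
      · rw [← h', GrAlg.comp_of_mem (V.word_mem_gr l)]; exact h l
      · rw [GrAlg.comp_of_mem_ne (V.word_mem_gr l) h', map_zero]; exact zero_mem _) y
  rw [← GrAlg.comp_of_mem hx]
  exact key x

theorem hasDegree_algHom {f : A →ₐ[R] B} (h : ∀ v, f (V.gen v) ∈ B.gr (V.deg v)) :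
    HasDegree 0 f.toLinearMap := by
  refine V.hasDegree_of_words fun l => ?_
  rw [add_zero, AlgHom.toLinearMap_apply]
  induction l with
  | nil => rw [word_nil, map_one]; exact GrAlg.one_mem_gr
  | cons v l ih => rw [word_cons, map_mul, wdeg_cons]; exact GrAlg.mul_mem_gr (h v) ih rfl

/-- Maps with `t(xy) = a(x) t(y) + u(x) w(y) + t(x) c(y)` and given values on generators. -/
theorem exists_twisted {S : Type*} [Ring S] [Algebra R S] {a b c : A →ₐ[R] S} {u w : A →ₗ[R] S}
    (hu : ∀ x y, u (x * y) = a x * u y + u x * b y)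
    (hw : ∀ x y, w (x * y) = b x * w y + w x * c y) (tg : V.X → S) :
    ∃ t : A →ₗ[R] S, (∀ x y, t (x * y) = a x * t y + u x * w y + t x * c y) ∧
      ∀ v, t (V.gen v) = tg v := by
  have hu1 : u 1 = 0 := by simpa using hu 1 1
  have hw1 : w 1 = 0 := by simpa using hw 1 1
  -- The three rules say that upper triangular matrices with diagonal a, b, c, superdiagonal u, w
  -- and corner t multiply correctly. Freeness gives such an algebra map with any corner values on
  -- generators.
  let Φ : A →ₐ[R] Matrix (Fin 3) (Fin 3) S := V.lift fun v =>
    !![a (V.gen v), u (V.gen v), tg v; 0, b (V.gen v), w (V.gen v); 0, 0, c (V.gen v)]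
  have hΦ : ∀ x, Φ x = !![a x, u x, Φ x 0 2; 0, b x, w x; 0, 0, c x] := by
    intro x
    let e : Fin 3 → Fin 3 → Matrix (Fin 3) (Fin 3) S →ₗ[R] S := fun i j =>
      Matrix.entryLinearMap R S i j
    let E : Fin 3 → Fin 3 → A →ₗ[R] S := fun i j => e i j ∘ₗ Φ.toLinearMap
    have key : Φ x 0 0 = a x ∧ Φ x 0 1 = u x ∧ Φ x 1 0 = 0 ∧ Φ x 1 1 = b x ∧ Φ x 1 2 = w x ∧
        Φ x 2 0 = 0 ∧ Φ x 2 1 = 0 ∧ Φ x 2 2 = c x := by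
      have := V.mem_of_gen_mul (LinearMap.ker (E 0 0 - a.toLinearMap) ⊓ LinearMap.ker (E 0 1 - u) ⊓
        LinearMap.ker (E 1 0) ⊓ LinearMap.ker (E 1 1 - b.toLinearMap) ⊓ LinearMap.ker (E 1 2 - w) ⊓
        LinearMap.ker (E 2 0) ⊓ LinearMap.ker (E 2 1) ⊓ LinearMap.ker (E 2 2 - c.toLinearMap))
        (by simp [E, e, hu1, hw1]) (fun v y hy => by
          simp only [Submodule.mem_inf, LinearMap.mem_ker, LinearMap.sub_apply, sub_eq_zero, E, e,
            LinearMap.comp_apply, AlgHom.toLinearMap_apply, Matrix.entryLinearMap_apply] at hy ⊢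
          obtain ⟨⟨⟨⟨⟨⟨⟨h1, h2⟩, h3⟩, h4⟩, h5⟩, h6⟩, h7⟩, h8⟩ := hy
          simp [map_mul, Matrix.mul_apply, Fin.sum_univ_three, Φ, V.lift_gen, hu, hw] at h1 h2 h3 h4 h5 h6 h7 h8 ⊢
          simp [h1, h2, h3, h4, h5, h6, h7, h8]) x
      simpa [Submodule.mem_inf, LinearMap.mem_ker, LinearMap.sub_apply, sub_eq_zero, E, e,
            LinearMap.comp_apply, AlgHom.toLinearMap_apply, Matrix.entryLinearMap_apply, and_assoc] using this
    obtain ⟨h1, h2, h3, h4, h5, h6, h7, h8⟩ := key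
    ext i j
    fin_cases i <;> fin_cases j <;> simp [*]
  refine ⟨Matrix.entryLinearMap R S 0 2 ∘ₗ Φ.toLinearMap, fun x y => ?_, fun v => ?_⟩
  · have : Φ (x * y) 0 2 = (Φ x * Φ y) 0 2 := by rw [map_mul]
    change Φ (x * y) 0 2 = a x * Φ y 0 2 + u x * w y + Φ x 0 2 * c y
    rw [this, hΦ x, hΦ y]
    simp [Matrix.mul_apply, Fin.sum_univ_three]
  · change Φ (V.gen v) 0 2 = tg v
    simp [Φ, V.lift_gen]

end FreeGens

/-- A family can be chosen by recursion on the rank if the condition at `v` involves only the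
values at `v` and at elements of smaller rank. -/
theorem exists_of_rank_local {X : Type*} {Y : X → Type*} [∀ x, Nonempty (Y x)] (r : X → ℕ)
    (G : (∀ x, Y x) → X → Prop)
    (hloc : ∀ a b v, (∀ x, r x < r v → a x = b x) → a v = b v → G a v → G b v)
    (step : ∀ a v, (∀ x, r x < r v → G a x) →
      ∃ b : ∀ x, Y x, (∀ x, r x < r v → b x = a x) ∧ G b v) :
    ∃ a, ∀ v, G a v := by
  classical
  have hstep : ∀ n (a : ∀ x, Y x), (∀ x, r x < n → G a x) →
      ∃ b : ∀ x, Y x, (∀ x, r x < n → b x = a x) ∧ ∀ x, r x < n + 1 → G b x := by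
    intro n a ha
    choose! b hb1 hb2 using fun v (hv : r v = n) => step a v (fun x hx => ha x (hv ▸ hx))
    -- Elements of equal rank do not constrain each other, so the values chosen separately for each
    -- of them can be put together.
    refine ⟨fun x => if r x = n then b x x else a x, fun x hx => if_neg (by omega), fun v hv => ?_⟩
    by_cases hn : r v = n
    · refine hloc (b v) _ v (fun x hx => ?_) (by simp [hn]) (hb2 v hn)
      rw [hb1 v hn x hx, if_neg (by omega)]
    · refine hloc a _ v (fun x hx => ?_) (by simp [hn]) (ha v (by omega))
      rw [if_neg (by omega)]
  let F : ∀ n : ℕ, {a : ∀ x, Y x // ∀ x, r x < n → G a x} := fun n =>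
    Nat.rec ⟨fun x => Classical.arbitrary _, fun x hx => absurd hx (Nat.not_lt_zero _)⟩
      (fun n a => ⟨(hstep n a.1 a.2).choose, (hstep n a.1 a.2).choose_spec.2⟩) n
  have hF : ∀ n x, r x < n → (F (n + 1)).1 x = (F n).1 x := fun n x hx =>
    (hstep n (F n).1 (F n).2).choose_spec.1 x hx
  have hF' : ∀ n x, r x < n → (F n).1 x = (F (r x + 1)).1 x := by
    intro n x hx
    induction n, hx using Nat.le_induction with
    | base => rfl
    | succ n hn ih => rw [hF n x hn, ih]
  -- The value at x no longer changes after stage r x + 1, so the diagonal family agrees with each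
  -- stage on the ranks already treated.
  refine ⟨fun x => (F (r x + 1)).1 x, fun v => ?_⟩
  refine hloc (F (r v + 1)).1 _ v (fun x hx => ?_) rfl ((F (r v + 1)).2 v (Nat.lt_succ_self _))
  exact hF' _ x (by omega)

/-! ### Quasi-isomorphisms in terms of elements, and second-order homotopies. -/

/-- Exactness of the mapping cone of `φ`, expressed in elements. -/
def QIso {M N : Type*} [AddCommGroup M] [AddCommGroup N] (d : M → M) (d' : N → N)
    (φ : M → N) : Prop :=
  ∀ z z', d z = 0 → φ z = d' z' → ∃ y y', d y = z ∧ φ y - z' = d' y'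

namespace GrAlg

variable {R : Type u} [CommRing R] {A B T M N : GrAlg R}

theorem qIso_id {d : A →ₗ[R] A} : QIso d d (LinearMap.id : A →ₗ[R] A) :=
  fun z z' _ h => ⟨z', 0, h.symm, by simp⟩

theorem QIso.homog {d : M →ₗ[R] M} {d' : N →ₗ[R] N} {φ : M →ₗ[R] N} (h : QIso d d' φ)
    (hd : HasDegree (-1) d) (hd' : HasDegree (-1) d') (hφ : HasDegree 0 φ) {m n k : ℤ} {z : M}
    {z' : N} (hz : z ∈ M.gr m) (hz' : z' ∈ N.gr n) (hn : m + 1 = n) (hk : n + 1 = k)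
    (h1 : d z = 0) (h2 : φ z = d' z') :
    ∃ y ∈ M.gr n, ∃ y' ∈ N.gr k, d y = z ∧ φ y - z' = d' y' := by
  obtain ⟨y, y', h3, h4⟩ := h z z' h1 h2
  refine ⟨M.comp n y, comp_mem_gr _ _, N.comp k y', comp_mem_gr _ _, ?_, ?_⟩
  · rw [hd.comp_eq, h3, comp_of_mem]; convert hz using 2; omega
  · have e1 : k + -1 = n := by omega
    rw [hd'.comp_eq, hφ.comp_eq, add_zero, ← h4, e1, map_sub, comp_of_mem hz']

/-- A multiplicative linear map as an algebra map. -/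
noncomputable def IsDGAHom.toAlgHom {dA : A →ₗ[R] A} {dB : B →ₗ[R] B} {f : A →ₗ[R] B}
    (hf : IsDGAHom dA dB f) : A →ₐ[R] B := AlgHom.ofLinearMap f hf.map_one hf.map_mul

theorem IsDGAHom.toAlgHom_apply {dA : A →ₗ[R] A} {dB : B →ₗ[R] B} {f : A →ₗ[R] B}
    (hf : IsDGAHom dA dB f) (x : A) : hf.toAlgHom x = f x := rfl

/-- Besides the derivation terms, the boundary of t contains exactly the products of w with the
boundary of u, and of u with the boundary of w. These cancel the defect of a sum of two homotopies.
-/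
theorem boundary_of_twisted {δ : T →ₗ[R] T} {D : N →ₗ[R] N} (hδ : IsDerivation δ)
    (hD : IsDerivation D) {a c : T →ₗ[R] N} (ha : IsDGAHom δ D a) (hc : IsDGAHom δ D c)
    {u w t : T →ₗ[R] N} (hu : HasDegree 1 u) (ht : HasDegree 2 t)
    (h : ∀ x y, t (x * y) = a x * t y + u (T.sign x) * w y + t x * c y) (x y : T) :
    D (t (x * y)) - t (δ (x * y)) = a (T.sign x) * (D (t y) - t (δ y)) + (D (t x) - t (δ x)) * c y
      + (D (u (T.sign x)) + u (δ (T.sign x))) * w y - u x * (D (w y) + w (δ y)) := by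
  simp only [h, hδ.leibniz, hD.leibniz, map_add, ha.map_d, hc.map_d, ha.degree.sign₀, hu.sign₁,
    ht.sign₂, sign_sign, d_sign hδ.degree, map_neg]
  noncomm_ring

theorem eq_zero_of_rule_one {s : A →ₗ[R] B} {f g : A →ₗ[R] B} (hf : f 1 = 1) (hg : g 1 = 1)
    (h : ∀ x y, s (x * y) = f (A.sign x) * s y + s x * g y) : s 1 = 0 := by
  have := h 1 1
  rw [GrAlg.sign_one, hf, hg] at this
  simpa using this

end GrAlg

/-! ### Derivation homotopies between maps out of a tensor algebra. -/

namespace FreeGens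

variable {R : Type u} [CommRing R] {T M N : GrAlg R} (V : FreeGens T)

/-- Derivations over `f` and `g` can be prescribed on generators. -/
theorem exists_derivation {f g : T →ₗ[R] M} (hf1 : f 1 = 1) (hfm : ∀ x y, f (x * y) = f x * f y)
    (hg1 : g 1 = 1) (hgm : ∀ x y, g (x * y) = g x * g y) (sg : V.X → M) :
    ∃ s : T →ₗ[R] M, (∀ x y, s (x * y) = f (T.sign x) * s y + s x * g y) ∧
      ∀ v, s (V.gen v) = sg v := by
  obtain ⟨s, h1, h2⟩ := V.exists_twisted (a := (AlgHom.ofLinearMap f hf1 hfm).comp T.signHom)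
    (b := AlgHom.ofLinearMap g hg1 hgm) (c := AlgHom.ofLinearMap g hg1 hgm) (u := 0) (w := 0)
    (by simp) (by simp) sg
  refine ⟨s, fun x y => ?_, h2⟩
  rw [h1]
  simp [GrAlg.signHom_apply]

theorem derivation_degree {f g s : T →ₗ[R] M} {r : ℤ} (hf1 : f 1 = 1) (hg1 : g 1 = 1)
    (hf : HasDegree 0 f) (hg : HasDegree 0 g)
    (h : ∀ x y, s (x * y) = f (T.sign x) * s y + s x * g y)
    (hs : ∀ v, s (V.gen v) ∈ M.gr (V.deg v + r)) : HasDegree r s := by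
  refine V.hasDegree_of_words fun l => ?_
  induction l with
  | nil => rw [word_nil, eq_zero_of_rule_one hf1 hg1 h]; exact zero_mem _
  | cons v l ih =>
    rw [word_cons, wdeg_cons, h]
    have h1 := hf _ _ (sign_mem_gr (V.gen_mem_gr v))
    have h2 := hg _ _ (V.word_mem_gr l)
    exact add_mem (mul_mem_gr h1 ih (by ring)) (mul_mem_gr (hs v) h2 (by ring))

theorem twisted_degree {a c u w t : T →ₗ[R] M} (ha1 : a 1 = 1) (hc1 : c 1 = 1) (hu1 : u 1 = 0)
    (ha : HasDegree 0 a) (hc : HasDegree 0 c) (hu : HasDegree 1 u) (hw : HasDegree 1 w)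
    (h : ∀ x y, t (x * y) = a x * t y + u (T.sign x) * w y + t x * c y)
    (ht : ∀ v, t (V.gen v) ∈ M.gr (V.deg v + 2)) : HasDegree 2 t := by
  refine V.hasDegree_of_words fun l => ?_
  induction l with
  | nil =>
    have := h 1 1
    rw [GrAlg.sign_one, ha1, hc1, hu1] at this
    have h0 : t 1 = 0 := by simpa using this
    rw [word_nil, h0]; exact zero_mem _
  | cons v l ih =>
    rw [word_cons, wdeg_cons, h]
    have h1 := ha _ _ (V.gen_mem_gr v)
    have h2 := hc _ _ (V.word_mem_gr l)
    have h3 := hu _ _ (sign_mem_gr (V.gen_mem_gr v))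
    have h4 := hw _ _ (V.word_mem_gr l)
    exact add_mem (add_mem (mul_mem_gr h1 ih (by ring)) (mul_mem_gr h3 h4 (by ring)))
      (mul_mem_gr (ht v) h2 (by ring))

/-- Derivation homotopy is transitive for maps out of a tensor algebra. -/
theorem homotopic_trans (V : FreeGens T) {δ : T →ₗ[R] T} (hδ : IsDGA δ) {D : N →ₗ[R] N} (hD : IsDGA D)
    {f g k : T →ₗ[R] N} (hf : IsDGAHom δ D f) (hg : IsDGAHom δ D g) (hk : IsDGAHom δ D k)
    (h1 : DerivationHomotopic δ D f g) (h2 : DerivationHomotopic δ D g k) :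
    DerivationHomotopic δ D f k := by
  obtain ⟨u, u1, u2, u3⟩ := h1
  obtain ⟨w, w1, w2, w3⟩ := h2
  -- The sum u + w violates the derivation rule over f and k, and the boundary of t compensates for
  -- this. The value 0 on generators is a mere choice: any values of the right degree would do.
  obtain ⟨t, ht, ht0⟩ := V.exists_twisted (a := hf.toAlgHom) (b := hg.toAlgHom.comp T.signHom)
    (c := hk.toAlgHom) (u := u ∘ₗ T.sign) (w := w)
    (fun x y => by
      rw [LinearMap.comp_apply, GrAlg.sign_mul, u3, sign_sign]; rfl)
    (fun x y => w3 x y) (fun _ => 0)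
  have ht' : ∀ x y, t (x * y) = f x * t y + u (T.sign x) * w y + t x * k y := ht
  have hdeg : HasDegree 2 t := V.twisted_degree hf.map_one hk.map_one
    (eq_zero_of_rule_one hf.map_one hg.map_one u3) hf.degree hk.degree u1 w1 ht'
    (fun v => by rw [ht0]; exact zero_mem _)
  refine ⟨u + w + (D ∘ₗ t - t ∘ₗ δ), (u1.add w1).add ((hD.degree.comp hdeg (by norm_num)).sub
    (hdeg.comp hδ.degree (by norm_num))), fun x => ?_, fun x y => ?_⟩
  · simp only [LinearMap.add_apply, LinearMap.sub_apply, LinearMap.comp_apply, map_add, map_sub,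
      hδ.sq, hD.sq, map_zero]
    have e1 := u2 x
    have e2 := w2 x
    have : f x - k x = (u (δ x) + D (u x)) + (w (δ x) + D (w x)) := by rw [e1, e2]; abel
    rw [this]; abel
  · have e := boundary_of_twisted hδ.toIsDerivation hD.toIsDerivation hf hk u1 hdeg ht' x y
    have e1 := u2 (T.sign x)
    have e2 := w2 y
    rw [add_comm] at e1 e2
    simp only [LinearMap.add_apply, LinearMap.sub_apply, LinearMap.comp_apply, u3, w3, e]
    rw [e1, e2]
    noncomm_ring

/-- This is the locality needed for recursion: on low filtration only the values on generators of
low resolution degree matter. -/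
theorem derivation_agree {f g s s' : T →ₗ[R] M} (hf1 : f 1 = 1) (hg1 : g 1 = 1) {n : ℕ}
    (h : ∀ x y, s (x * y) = f (T.sign x) * s y + s x * g y)
    (h' : ∀ x y, s' (x * y) = f (T.sign x) * s' y + s' x * g y)
    (he : ∀ v, V.res v < n → s (V.gen v) = s' (V.gen v)) {x : T}
    (hx : x ∈ V.resFilt ((n : ℤ) - 1)) : s x = s' x := by
  have := V.resFilt_le_of_gen_mul (n := n) (LinearMap.eqLocus s s')
    (by rw [LinearMap.mem_eqLocus, eq_zero_of_rule_one hf1 hg1 h, eq_zero_of_rule_one hf1 hg1 h'])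
    (fun v hv y _ hy => by
      rw [LinearMap.mem_eqLocus] at hy ⊢
      rw [h, h', hy, he v hv])
  exact this hx

/-- The boundary of s obeys the same product rule as f - g, so the homotopy equation need only be
checked on generators. Compatibility of f and g with the differentials is assumed only at the given
elements, because during a recursion it is known only in low filtration. -/
theorem derivation_boundary {δ : T →ₗ[R] T} (hδ : IsDerivation δ) {D : M →ₗ[R] M}
    (hD : IsDerivation D) {f g s : T →ₗ[R] M} (hf : HasDegree 0 f) (hs : HasDegree 1 s)
    (h : ∀ x y, s (x * y) = f (T.sign x) * s y + s x * g y) {x y : T} (hfx : f (δ x) = D (f x))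
    (hgy : g (δ y) = D (g y)) :
    s (δ (x * y)) + D (s (x * y)) = f x * (s (δ y) + D (s y)) + (s (δ x) + D (s x)) * g y := by
  have : D (f (T.sign x)) = - f (T.sign (δ x)) := by
    rw [← hf.sign₀, d_sign hD.degree, ← hfx, hf.sign₀]
  simp only [h, hδ.leibniz, hD.leibniz, map_add, hf.sign₀, hgy, hs.sign₁, sign_sign, this]
  noncomm_ring

/-- A quasi-isomorphism reflects derivation homotopy of maps out of a tensor algebra whose
differential lowers the resolution degree. -/
theorem homotopic_reflect_symm {δ : T →ₗ[R] T} (hδ : IsDGA δ)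
    (hV : ∀ v, δ (V.gen v) ∈ V.resFilt ((V.res v : ℤ) - 1)) {D : M →ₗ[R] M} (hD : IsDGA D)
    {D' : N →ₗ[R] N} (hD' : IsDGA D') {φ : M →ₗ[R] N} (hφ : IsDGAHom D D' φ) (hq : QIso D D' φ)
    {f g : T →ₗ[R] M} (hf : IsDGAHom δ D f) (hg : IsDGAHom δ D g)
    (hs : DerivationHomotopic δ D' (φ ∘ₗ f) (φ ∘ₗ g)) : DerivationHomotopic δ D g f := by
  obtain ⟨s, s1, s2, s3⟩ := hs
  have hφf := hφ.comp hf
  have hφg := hφ.comp hg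
  have s0 : s 1 = 0 := eq_zero_of_rule_one hφf.map_one hφg.map_one s3
  let Y : V.X → Type u := fun v => M.gr (V.deg v + 1) × N.gr (V.deg v + 2)
  let RS : (T →ₗ[R] M) → Prop := fun S => ∀ x y, S (x * y) = g (T.sign x) * S y + S x * f y
  -- Followed by φS, the homotopy s is a loop from φf through φg back to φf, and t contracts this
  -- loop; hence φf on both sides. The minus sign arises because t stands on the opposite side of
  -- the equation from the correction term of a composite homotopy.
  let Rt : (T →ₗ[R] M) → (T →ₗ[R] N) → Prop := fun S t => ∀ x y,
    t (x * y) = (φ ∘ₗ f) x * t y + s (T.sign x) * (-(φ ∘ₗ S)) y + t x * (φ ∘ₗ f) y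
  let V' : (∀ v, Y v) → (T →ₗ[R] M) → (T →ₗ[R] N) → Prop := fun a S t =>
    RS S ∧ Rt S t ∧ ∀ v, S (V.gen v) = (a v).1 ∧ t (V.gen v) = (a v).2
  have hex : ∀ a, ∃ S t, V' a S t := by
    intro a
    obtain ⟨S, hS, hSg⟩ := V.exists_derivation hg.map_one hg.map_mul hf.map_one hf.map_mul
      (fun v => ((a v).1 : M))
    obtain ⟨t, ht, htg⟩ := V.exists_twisted (a := hφf.toAlgHom)
      (b := hφg.toAlgHom.comp T.signHom) (c := hφf.toAlgHom) (u := s ∘ₗ T.sign)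
      (w := -(φ ∘ₗ S))
      (fun x y => by
        rw [LinearMap.comp_apply, GrAlg.sign_mul, s3, sign_sign]; rfl)
      (fun x y => by
        simp only [LinearMap.neg_apply, LinearMap.comp_apply, hS, map_add, hφ.map_mul]
        simp only [neg_add, neg_mul, mul_neg]; rfl) (fun v => ((a v).2 : N))
    exact ⟨S, t, hS, ht, fun v => ⟨hSg v, htg v⟩⟩
  have hagree : ∀ a b (n : ℕ), (∀ x, V.res x < n → a x = b x) → ∀ S t S' t', V' a S t →
      V' b S' t' → ∀ x ∈ V.resFilt ((n : ℤ) - 1), S x = S' x ∧ t x = t' x := by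
    intro a b n hab S t S' t' h h' x hx
    have hS : ∀ x ∈ V.resFilt ((n : ℤ) - 1), S x = S' x := fun x hx =>
      V.derivation_agree hg.map_one hf.map_one h.1 h'.1
        (fun v hv => by rw [(h.2.2 v).1, (h'.2.2 v).1, hab v hv]) hx
    refine ⟨hS x hx, ?_⟩
    have one : ∀ {S t}, Rt S t → t 1 = 0 := by
      intro S t ht
      have := ht 1 1
      rw [GrAlg.sign_one, s0, hφf.map_one] at this
      simpa using this
    have := V.resFilt_le_of_gen_mul (n := n) (LinearMap.eqLocus t t')
      (by rw [LinearMap.mem_eqLocus, one h.2.1, one h'.2.1])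
      (fun v hv y hyF hy => by
        rw [LinearMap.mem_eqLocus] at hy ⊢
        rw [h.2.1, h'.2.1, hy, (h.2.2 v).2, (h'.2.2 v).2, hab v hv]
        simp only [LinearMap.neg_apply, LinearMap.comp_apply, hS y hyF])
    exact this hx
  have hdegS : ∀ {a S t}, V' a S t → HasDegree 1 S := fun {a S t} h =>
    V.derivation_degree hg.map_one hf.map_one hg.degree hf.degree h.1
      (fun v => by rw [(h.2.2 v).1]; exact (a v).1.2)
  have hdegt : ∀ {a S t}, V' a S t → HasDegree 2 t := fun {a S t} h =>
    V.twisted_degree (w := -(φ ∘ₗ S)) hφf.map_one hφf.map_one s0 hφf.degree hφf.degree s1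
      (fun n x hx => neg_mem ((hφ.degree.comp (hdegS h) (add_zero 1)) n x hx)) h.2.1
      (fun v => by rw [(h.2.2 v).2]; exact (a v).2.2)
  let E : (T →ₗ[R] M) → (T →ₗ[R] N) → T → Prop := fun S t x =>
    S (δ x) + D (S x) = g x - f x ∧ D' (t x) - t (δ x) = φ (S x) + s x
  have hE : ∀ {a S t}, V' a S t → ∀ n : ℕ, (∀ v, V.res v < n → E S t (V.gen v)) →
      ∀ x ∈ V.resFilt ((n : ℤ) - 1), E S t x := by
    intro a S t h n hn x hx
    have h1 : S 1 = 0 := eq_zero_of_rule_one hg.map_one hf.map_one h.1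
    have d1 : δ 1 = 0 := by simpa [GrAlg.sign_one] using hδ.leibniz 1 1
    have ht1 : t 1 = 0 := by
      have := h.2.1 1 1
      rw [GrAlg.sign_one, s0, hφf.map_one] at this
      simpa using this
    have hmem : ∀ x, x ∈ LinearMap.ker (S ∘ₗ δ + D ∘ₗ S - (g - f)) ⊓
        LinearMap.ker (D' ∘ₗ t - t ∘ₗ δ - (φ ∘ₗ S + s)) ↔ E S t x := by
      intro x
      simp only [Submodule.mem_inf, LinearMap.mem_ker, LinearMap.sub_apply, LinearMap.add_apply,
        LinearMap.comp_apply, sub_eq_zero, E]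
    have := V.resFilt_le_of_gen_mul (n := n) (LinearMap.ker (S ∘ₗ δ + D ∘ₗ S - (g - f)) ⊓
        LinearMap.ker (D' ∘ₗ t - t ∘ₗ δ - (φ ∘ₗ S + s)))
      (by rw [hmem]; simp [E, h1, d1, ht1, s0, hf.map_one, hg.map_one])
      (fun v hv y _ hy => by
        rw [hmem] at hy ⊢
        obtain ⟨v1, v2⟩ := hn v hv
        obtain ⟨y1, y2⟩ := hy
        constructor
        · rw [derivation_boundary hδ.toIsDerivation hD.toIsDerivation hg.degree (hdegS h) h.1
            (hg.map_d _) (hf.map_d _), v1, y1,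
            hf.map_mul, hg.map_mul]
          noncomm_ring
        · have e := boundary_of_twisted (w := -(φ ∘ₗ S)) hδ.toIsDerivation hD'.toIsDerivation
            hφf hφf s1 (hdegt h) h.2.1 (V.gen v) y
          have e1 := s2 (T.sign (V.gen v))
          have e2 : D' ((-(φ ∘ₗ S)) y) + (-(φ ∘ₗ S)) (δ y) = -(φ (g y) - φ (f y)) := by
            rw [← map_sub, ← y1]
            simp only [LinearMap.neg_apply, LinearMap.comp_apply, map_neg, map_add, hφ.map_d]
            abel
          rw [add_comm] at e1
          rw [e, e1, e2, v2, y2, h.1, s3]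
          simp only [LinearMap.neg_apply, LinearMap.comp_apply, map_add, hφ.map_mul]
          noncomm_ring)
    exact (hmem x).1 (this hx)
  -- S and t are chosen together, since the choice of S on a generator must leave the equation for t
  -- solvable.
  obtain ⟨a, ha⟩ := exists_of_rank_local (Y := Y) V.res
    (fun a v => ∀ S t, V' a S t → E S t (V.gen v))
    (by
      intro a b v hab habv ha S' t' h'
      obtain ⟨S, t, h⟩ := hex a
      obtain ⟨e1, e2⟩ := ha S t h
      obtain ⟨k1, k2⟩ := hagree a b (V.res v) hab S t S' t' h h' _ (hV v)
      have k3 : S (V.gen v) = S' (V.gen v) := by rw [(h.2.2 v).1, (h'.2.2 v).1, habv]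
      have k4 : t (V.gen v) = t' (V.gen v) := by rw [(h.2.2 v).2, (h'.2.2 v).2, habv]
      exact ⟨by rw [← k1, ← k3, e1], by rw [← k2, ← k3, ← k4, e2]⟩)
    (by
      classical
      intro a v ha
      obtain ⟨S, t, h⟩ := hex a
      have hlow := hE h (V.res v) (fun x hx => ha x hx S t h)
      obtain ⟨l1, l2⟩ := hlow _ (hV v)
      rw [hδ.sq, map_zero, zero_add] at l1
      rw [hδ.sq, map_zero, sub_zero] at l2
      have hd1 := hδ.degree _ _ (V.gen_mem_gr v)
      -- Here z is the prescribed boundary of S on the generator, and z' is the value that φS must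
      -- have there up to the boundary of t. The homotopy s and the equations in lower filtration
      -- make (z, z') a cycle of the cone.
      obtain ⟨y, hy, y', hy', q1, q2⟩ := QIso.homog hq hD.degree hD'.degree hφ.degree
        (z := g (V.gen v) - f (V.gen v) - S (δ (V.gen v)))
        (z' := -s (V.gen v) - t (δ (V.gen v))) (m := V.deg v) (n := V.deg v + 1)
        (k := V.deg v + 2)
        (sub_mem (sub_mem (by simpa using hg.degree _ _ (V.gen_mem_gr v))
          (by simpa using hf.degree _ _ (V.gen_mem_gr v)))
          (by simpa using hdegS h _ _ hd1))
        (sub_mem (neg_mem (s1 _ _ (V.gen_mem_gr v))) (by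
          have := hdegt h _ _ hd1
          convert this using 2; ring)) rfl (by ring)
        (by rw [map_sub, map_sub, l1, hg.map_d, hf.map_d, sub_self])
        (by
          have := s2 (V.gen v)
          simp only [LinearMap.comp_apply] at this
          have e : φ (g (V.gen v)) - φ (f (V.gen v)) = -(s (δ (V.gen v)) + D' (s (V.gen v))) := by
            rw [this]; abel
          rw [map_sub, map_sub, map_sub, map_neg, l2, e]
          abel)
      refine ⟨Function.update a v (⟨y, hy⟩, ⟨y', hy'⟩), fun x hx =>
        Function.update_of_ne (by rintro rfl; exact lt_irrefl _ hx) _ _, fun S' t' h' => ?_⟩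
      obtain ⟨k1, k2⟩ := hagree a _ (V.res v) (fun x hx =>
        (Function.update_of_ne (by rintro rfl; exact lt_irrefl _ hx) _ _).symm) S t S' t' h h' _ (hV v)
      have k3 : S' (V.gen v) = y := by rw [(h'.2.2 v).1, Function.update_self]
      have k4 : t' (V.gen v) = y' := by rw [(h'.2.2 v).2, Function.update_self]
      refine ⟨by rw [← k1, k3, q1]; abel, ?_⟩
      rw [← k2, k3, k4, ← q2]; abel)
  obtain ⟨S, t, h⟩ := hex a
  have hall := fun n => hE h n (fun v _ => ha v S t h)
  refine ⟨S, hdegS h, fun x => ?_, h.1⟩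
  obtain ⟨n, hn⟩ := exists_mem_rankFilt (b := V.basis) (r := V.wres) x
  rw [← resFilt_eq] at hn
  exact (hall (n + 1) x (by push_cast; simpa using hn)).1

/-- The reflection argument reverses the direction of the homotopy, so taking φ to be the identity
gives symmetry. -/
theorem homotopic_symm {δ : T →ₗ[R] T} (hδ : IsDGA δ)
    (hV : ∀ v, δ (V.gen v) ∈ V.resFilt ((V.res v : ℤ) - 1)) {D : M →ₗ[R] M} (hD : IsDGA D)
    {f g : T →ₗ[R] M} (hf : IsDGAHom δ D f) (hg : IsDGAHom δ D g)
    (hs : DerivationHomotopic δ D f g) : DerivationHomotopic δ D g f :=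
  V.homotopic_reflect_symm hδ hV hD hD (isDGAHom_id D) qIso_id hf hg hs

theorem homotopic_reflect {δ : T →ₗ[R] T} (hδ : IsDGA δ)
    (hV : ∀ v, δ (V.gen v) ∈ V.resFilt ((V.res v : ℤ) - 1)) {D : M →ₗ[R] M} (hD : IsDGA D)
    {D' : N →ₗ[R] N} (hD' : IsDGA D') {φ : M →ₗ[R] N} (hφ : IsDGAHom D D' φ) (hq : QIso D D' φ)
    {f g : T →ₗ[R] M} (hf : IsDGAHom δ D f) (hg : IsDGAHom δ D g)
    (hs : DerivationHomotopic δ D' (φ ∘ₗ f) (φ ∘ₗ g)) : DerivationHomotopic δ D f g :=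
  V.homotopic_symm hδ hV hD hg hf (V.homotopic_reflect_symm hδ hV hD hD' hφ hq hf hg hs)

end FreeGens

/-! ### Tensoring a quasi-isomorphism with a semifree complex. -/

section Semifree

variable {R : Type*} [CommRing R] {M N N' : Type*} [AddCommGroup M] [Module R M]
  [AddCommGroup N] [Module R N] [AddCommGroup N'] [Module R N']

/-- Tensoring with a complex with a ranked basis whose differential lowers the rank preserves
acyclicity. -/
theorem exists_of_semifree {ι : Type*} {b : Module.Basis ι R M} {r : ι → ℕ} {d : M →ₗ[R] M}
    (hd : ∀ i, d (b i) ∈ rankFilt b r ((r i : ℤ) - 1)) {δ σ : N →ₗ[R] N}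
    (hex : ∀ x, δ x = 0 → ∃ y, δ y = x) {D : N ⊗[R] M →ₗ[R] N ⊗[R] M}
    (hD : D = TensorProduct.map δ LinearMap.id + TensorProduct.map σ d)
    (hDD : ∀ x, D (D x) = 0) (z : N ⊗[R] M) (hz : D z = 0) : ∃ y, D y = z := by
  classical
  -- The N-valued coefficients of a tensor in the given basis of M.
  let c : ι → N ⊗[R] M →ₗ[R] N := fun i =>
    Finsupp.lapply i ∘ₗ (TensorProduct.equivFinsuppOfBasisRight (M := N) b).toLinearMap
  have hc : ∀ i n m, c i (n ⊗ₜ m) = b.repr m i • n := fun i n m =>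
    TensorProduct.equivFinsuppOfBasisRight_apply_tmul_apply b n m i
  have hsum : ∀ x : N ⊗[R] M, ∃ s : Finset ι, (∀ i, i ∉ s → c i x = 0) ∧
      x = ∑ i ∈ s, c i x ⊗ₜ b i := by
    intro x
    refine ⟨(TensorProduct.equivFinsuppOfBasisRight (M := N) b x).support,
      fun i hi => Finsupp.notMem_support_iff.1 hi, ?_⟩
    conv_lhs => rw [← (TensorProduct.equivFinsuppOfBasisRight (M := N) b).symm_apply_apply x,
      TensorProduct.equivFinsuppOfBasisRight_symm_apply]
    rfl
  have hlow : ∀ (k : ℕ) (x : N ⊗[R] M), (∀ i, k < r i → c i x = 0) →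
      ∀ i, k ≤ r i → c i (TensorProduct.map σ d x) = 0 := by
    intro k x hx i hi
    obtain ⟨s, -, hs⟩ := hsum x
    rw [hs, map_sum, map_sum]
    refine Finset.sum_eq_zero fun j _ => ?_
    by_cases hj : k < r j
    · rw [hx j hj, TensorProduct.zero_tmul, map_zero, map_zero]
    · rw [TensorProduct.map_tmul, hc]
      have : b.repr (d (b j)) i = 0 := by
        by_contra h
        have := mem_rankFilt.1 (hd j) i h
        omega
      rw [this, zero_smul]
  have hδ : ∀ i x, c i (TensorProduct.map δ LinearMap.id x) = δ (c i x) := by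
    intro i x
    induction x using TensorProduct.induction_on with
    | zero => simp
    | tmul n m => rw [TensorProduct.map_tmul, hc, hc, map_smul]; rfl
    | add x y hx hy => simp only [map_add, hx, hy]
  have key : ∀ (k : ℕ) (z : N ⊗[R] M), (∀ i, k ≤ r i → c i z = 0) → D z = 0 →
      ∃ y, D y = z := by
    intro k
    induction k with
    | zero =>
      intro z hz _
      obtain ⟨s, -, hs⟩ := hsum z
      refine ⟨0, ?_⟩
      rw [hs, map_zero, Finset.sum_eq_zero]
      intro i _
      rw [hz i (Nat.zero_le _), TensorProduct.zero_tmul]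
    | succ k ih =>
      intro z hz hDz
      obtain ⟨s, hs0, hs⟩ := hsum z
      -- The summand σ ⊗ d strictly lowers the rank, so the coefficients of top rank k see only δ.
      -- They are cycles, and y₀ collects primitives for them.
      have h1 : ∀ i, r i = k → δ (c i z) = 0 := by
        intro i hi
        have : c i (D z) = 0 := by rw [hDz, map_zero]
        rw [hD, LinearMap.add_apply, map_add, hδ, hlow k z (fun j hj => hz j hj) i hi.ge,
          add_zero] at this
        exact this
      choose! m hm using fun i (hi : r i = k) => hex _ (h1 i hi)
      let y₀ : N ⊗[R] M := ∑ i ∈ s with r i = k, m i ⊗ₜ b i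
      have hy₀ : ∀ i, c i y₀ = if i ∈ s ∧ r i = k then m i else 0 := by
        intro i
        simp only [y₀, map_sum, hc, Module.Basis.repr_self, Finsupp.single_apply, ite_smul,
          one_smul, zero_smul, Finset.sum_ite_eq', Finset.mem_filter]
      obtain ⟨y, hy⟩ := ih (z - D y₀) (fun i hi => by
        rw [map_sub, hD, LinearMap.add_apply, map_add, hδ, hlow k y₀ (fun j hj => by
          rw [hy₀, if_neg (by omega)]) i hi, hy₀, add_zero]
        by_cases hk : r i = k
        · by_cases his : i ∈ s
          · rw [if_pos ⟨his, hk⟩, hm i hk, sub_self]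
          · rw [if_neg (fun h => his h.1), hs0 i his, map_zero, sub_zero]
        · rw [if_neg (fun h => hk h.2), hz i (by omega), map_zero, sub_zero])
        (by rw [map_sub, hDz, hDD, sub_zero])
      exact ⟨y + y₀, by rw [map_add, hy]; abel⟩
  obtain ⟨s, hs0, -⟩ := hsum z
  refine key (s.sup r + 1) z (fun i hi => hs0 i fun his => ?_) hz
  have := Finset.le_sup (f := r) his
  omega

/-- The differential of the mapping cone. -/
def coneD (δ : N →ₗ[R] N) (δ' : N' →ₗ[R] N') (φ : N →ₗ[R] N') : N × N' →ₗ[R] N × N' :=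
  LinearMap.prod (δ ∘ₗ LinearMap.fst R N N')
    (φ ∘ₗ LinearMap.fst R N N' - δ' ∘ₗ LinearMap.snd R N N')

theorem coneD_apply (δ : N →ₗ[R] N) (δ' : N' →ₗ[R] N') (φ : N →ₗ[R] N') (x : N × N') :
    coneD δ δ' φ x = (δ x.1, φ x.1 - δ' x.2) := rfl

theorem exact_coneD {δ : N →ₗ[R] N} {δ' : N' →ₗ[R] N'} {φ : N →ₗ[R] N'} (hδ : ∀ x, δ (δ x) = 0)
    (hδ' : ∀ x, δ' (δ' x) = 0) (hφ : ∀ x, φ (δ x) = δ' (φ x)) (h : QIso δ δ' φ) :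
    Function.Exact (coneD δ δ' φ) (coneD δ δ' φ) := by
  rintro ⟨z, z'⟩
  constructor
  · intro hz
    obtain ⟨h1, h2⟩ := Prod.ext_iff.1 hz
    obtain ⟨y, y', hy, hy'⟩ := h z z' h1 (sub_eq_zero.1 h2)
    refine ⟨(y, y'), Prod.ext hy ?_⟩
    change φ y - δ' y' = z'
    rw [← hy']; abel
  · rintro ⟨⟨y, y'⟩, hy⟩
    obtain ⟨h1, h2⟩ := Prod.ext_iff.1 hy
    change δ y = z at h1
    change φ y - δ' y' = z' at h2
    rw [coneD_apply, ← h1, ← h2]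
    simp [hδ, hδ', hφ]

/-- The cone of φ ⊗ 1 is the cone of φ tensored with M, and the latter is acyclic by
`exists_of_semifree`. -/
theorem qIso_rTensor {ι : Type*} {b : Module.Basis ι R M} {r : ι → ℕ} {d : M →ₗ[R] M}
    (hd : ∀ i, d (b i) ∈ rankFilt b r ((r i : ℤ) - 1)) (hdd : ∀ x, d (d x) = 0)
    {δ σ : N →ₗ[R] N} {δ' σ' : N' →ₗ[R] N'} {φ : N →ₗ[R] N'} (hδ : ∀ x, δ (δ x) = 0)
    (hδ' : ∀ x, δ' (δ' x) = 0) (hφ : ∀ x, φ (δ x) = δ' (φ x)) (hσφ : ∀ x, φ (σ x) = σ' (φ x))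
    (hσ : ∀ x, δ (σ x) = -σ (δ x)) (hσ' : ∀ x, δ' (σ' x) = -σ' (δ' x)) (h : QIso δ δ' φ) :
    QIso (TensorProduct.map δ LinearMap.id + TensorProduct.map σ d : N ⊗[R] M →ₗ[R] N ⊗[R] M)
      (TensorProduct.map δ' LinearMap.id + TensorProduct.map σ' d : N' ⊗[R] M →ₗ[R] N' ⊗[R] M)
      (TensorProduct.map φ LinearMap.id : N ⊗[R] M →ₗ[R] N' ⊗[R] M) := by
  set D : N ⊗[R] M →ₗ[R] N ⊗[R] M := TensorProduct.map δ LinearMap.id + TensorProduct.map σ d with hD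
  set D' : N' ⊗[R] M →ₗ[R] N' ⊗[R] M :=
    TensorProduct.map δ' LinearMap.id + TensorProduct.map σ' d with hD'
  -- The two summands of the cone differ by a shift, so the sign operator on N' is negated. With
  -- this it anticommutes with the cone differential.
  let σC : N × N' →ₗ[R] N × N' := LinearMap.prod (σ ∘ₗ LinearMap.fst R N N')
    (-(σ' ∘ₗ LinearMap.snd R N N'))
  let DC : (N × N') ⊗[R] M →ₗ[R] (N × N') ⊗[R] M :=
    TensorProduct.map (coneD δ δ' φ) LinearMap.id + TensorProduct.map σC d
  let il : N ⊗[R] M →ₗ[R] (N × N') ⊗[R] M := TensorProduct.map (LinearMap.inl R N N') LinearMap.id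
  let ir : N' ⊗[R] M →ₗ[R] (N × N') ⊗[R] M := TensorProduct.map (LinearMap.inr R N N') LinearMap.id
  let pl : (N × N') ⊗[R] M →ₗ[R] N ⊗[R] M := TensorProduct.map (LinearMap.fst R N N') LinearMap.id
  let pr : (N × N') ⊗[R] M →ₗ[R] N' ⊗[R] M := TensorProduct.map (LinearMap.snd R N N') LinearMap.id
  have e1 : DC ∘ₗ il = il ∘ₗ D + ir ∘ₗ TensorProduct.map φ LinearMap.id := by
    ext n m
    have : ((δ n, φ n) : N × N') = (δ n, 0) + (0, φ n) := by simp
    simp [DC, il, ir, D, σC, coneD_apply]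
    rw [this, TensorProduct.add_tmul]; abel
  have e2 : DC ∘ₗ ir = -(ir ∘ₗ D') := by
    ext n m
    simp [DC, ir, D', σC, coneD_apply]
    simp only [← TensorProduct.neg_tmul, Prod.neg_mk, neg_zero]
    abel
  have e3 : pl ∘ₗ DC = D ∘ₗ pl := by
    ext n m <;> simp [DC, pl, D, σC, coneD_apply]
  have e4 : pr ∘ₗ DC = TensorProduct.map φ LinearMap.id ∘ₗ pl - D' ∘ₗ pr := by
    ext n m
    · simp [DC, pl, pr, D', σC, coneD_apply]
    · simp [DC, pl, pr, D', σC, coneD_apply, TensorProduct.neg_tmul, sub_eq_add_neg, add_comm]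
  have hC1 : ∀ x, coneD δ δ' φ (coneD δ δ' φ x) = 0 := fun x =>
    ((exact_coneD hδ hδ' hφ h) _).2 ⟨x, rfl⟩
  have hC2 : ∀ x, coneD δ δ' φ (σC x) = -σC (coneD δ δ' φ x) := by
    rintro ⟨n, n'⟩
    simp [coneD_apply, σC, hσ, hσ', hσφ, sub_eq_add_neg]
  have hDC : ∀ x, DC (DC x) = 0 := by
    intro x
    induction x using TensorProduct.induction_on with
    | zero => simp
    | add x y hx hy => simp only [map_add, hx, hy, add_zero]
    | tmul x m =>
      simp only [DC, LinearMap.add_apply, TensorProduct.map_tmul, map_add, LinearMap.id_apply, hdd,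
        TensorProduct.tmul_zero, hC1, hC2, TensorProduct.zero_tmul, TensorProduct.neg_tmul]
      abel
  intro z z' hz hz'
  obtain ⟨y, hy⟩ := exists_of_semifree hd (fun x hx =>
    ((exact_coneD hδ hδ' hφ h) x).1 hx) (D := DC) rfl hDC (il z + ir z') (by
      rw [map_add, ← LinearMap.comp_apply, ← LinearMap.comp_apply, e1, e2]
      simp [hz, hz'])
  have f1 : pl ∘ₗ il = LinearMap.id := by ext; simp [pl, il]
  have f2 : pl ∘ₗ ir = 0 := by ext; simp [pl, ir]
  have f3 : pr ∘ₗ il = 0 := by ext; simp [pr, il]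
  have f4 : pr ∘ₗ ir = LinearMap.id := by ext; simp [pr, ir]
  refine ⟨pl y, pr y, ?_, ?_⟩
  · rw [← LinearMap.comp_apply, ← e3, LinearMap.comp_apply, hy, map_add, ← LinearMap.comp_apply,
      ← LinearMap.comp_apply, f1, f2]
    simp
  · have := LinearMap.congr_fun e4 y
    rw [LinearMap.comp_apply, hy, map_add, ← LinearMap.comp_apply, ← LinearMap.comp_apply, f3, f4] at this
    simp only [LinearMap.zero_apply, LinearMap.id_apply, zero_add, LinearMap.sub_apply,
      LinearMap.comp_apply] at this
    rw [this]; abel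

end Semifree

/-! ### Graded mapping cones and K-flatness. -/

namespace GrAlg

variable {R : Type u} [CommRing R] {A B C X : GrAlg R}

/-- The grading of the mapping cone of a map `A → B`. -/
def coneGr (A B : GrAlg R) (n : ℤ) : Submodule R (A × B) := (A.gr (n - 1)).prod (B.gr n)

theorem inl_mem_coneGr {j n : ℤ} (h : j + 1 = n) {a : A} (ha : a ∈ A.gr j) :
    ((a, 0) : A × B) ∈ coneGr A B n := by
  subst h
  exact ⟨by simpa using ha, zero_mem _⟩

theorem inr_mem_coneGr {n : ℤ} {b : B} (hb : b ∈ B.gr n) : ((0, b) : A × B) ∈ coneGr A B n :=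
  ⟨zero_mem _, hb⟩

/-- The decomposition of the mapping cone into homogeneous components. -/
noncomputable def coneDecompose (A B : GrAlg R) : (A × B) →ₗ[R] ⨁ n, coneGr A B n :=
  LinearMap.coprod
    (DirectSum.toModule R ℤ _ (fun j => DirectSum.lof R ℤ (fun n => coneGr A B n) (j + 1) ∘ₗ
        (LinearMap.inl R A B).restrict (p := A.gr j) (q := coneGr A B (j + 1))
          (fun _ ha => inl_mem_coneGr rfl ha)) ∘ₗ (DirectSum.decomposeLinearEquiv A.gr).toLinearMap)
    (DirectSum.toModule R ℤ _ (fun j => DirectSum.lof R ℤ (fun n => coneGr A B n) j ∘ₗ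
        (LinearMap.inr R A B).restrict (p := B.gr j) (q := coneGr A B j)
          (fun _ hb => inr_mem_coneGr hb)) ∘ₗ (DirectSum.decomposeLinearEquiv B.gr).toLinearMap)

theorem coneDecompose_inl {j n : ℤ} (h : j + 1 = n) {a : A} (ha : a ∈ A.gr j) :
    coneDecompose A B (a, 0)
      = DirectSum.lof R ℤ (fun n => coneGr A B n) n ⟨(a, 0), inl_mem_coneGr h ha⟩ := by
  subst h
  simp only [coneDecompose, LinearMap.coprod_apply, LinearMap.comp_apply, LinearEquiv.coe_coe,
    DirectSum.decomposeLinearEquiv_apply, map_zero, add_zero]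
  rw [DirectSum.decompose_of_mem A.gr ha, ← DirectSum.lof_eq_of R, DirectSum.toModule_lof]
  rfl

theorem coneDecompose_inr {n : ℤ} {b : B} (hb : b ∈ B.gr n) :
    coneDecompose A B (0, b)
      = DirectSum.lof R ℤ (fun n => coneGr A B n) n ⟨(0, b), inr_mem_coneGr hb⟩ := by
  simp only [coneDecompose, LinearMap.coprod_apply, LinearMap.comp_apply, LinearEquiv.coe_coe,
    DirectSum.decomposeLinearEquiv_apply, map_zero, zero_add]
  rw [DirectSum.decompose_of_mem B.gr hb, ← DirectSum.lof_eq_of R, DirectSum.toModule_lof]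
  rfl

noncomputable instance coneDecomposition (A B : GrAlg R) :
    DirectSum.Decomposition (coneGr A B) :=
  DirectSum.Decomposition.ofLinearMap _ (coneDecompose A B)
    (by
      refine LinearMap.ext fun x => ?_
      obtain ⟨a, b⟩ := x
      have h1 : ∀ a : A, DirectSum.coeLinearMap (coneGr A B) (coneDecompose A B (a, 0)) = (a, 0) := by
        intro a
        induction a using homog_induction with
        | zero => exact (map_zero (DirectSum.coeLinearMap (coneGr A B) ∘ₗ coneDecompose A B))
        | add x y hx hy =>
          have : ((x + y, 0) : A × B) = (x, 0) + (y, 0) := by simp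
          rw [this, map_add, map_add, hx, hy]
        | homog n a ha =>
          rw [coneDecompose_inl rfl ha, DirectSum.lof_eq_of, DirectSum.coeLinearMap_of]
      have h2 : ∀ b : B, DirectSum.coeLinearMap (coneGr A B) (coneDecompose A B (0, b)) = (0, b) := by
        intro b
        induction b using homog_induction with
        | zero => exact (map_zero (DirectSum.coeLinearMap (coneGr A B) ∘ₗ coneDecompose A B))
        | add x y hx hy =>
          have : ((0, x + y) : A × B) = (0, x) + (0, y) := by simp
          rw [this, map_add, map_add, hx, hy]
        | homog n b hb =>
          rw [coneDecompose_inr hb, DirectSum.lof_eq_of, DirectSum.coeLinearMap_of]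
      have : ((a, b) : A × B) = (a, 0) + (0, b) := by simp
      rw [LinearMap.id_apply, LinearMap.comp_apply, this, map_add, map_add, h1, h2])
    (by
      ext n ⟨⟨a, b⟩, ha, hb⟩ : 2
      simp only [LinearMap.comp_apply, DirectSum.lof_eq_of, DirectSum.coeLinearMap_of,
        LinearMap.id_apply]
      have : ((a, b) : A × B) = (a, 0) + (0, b) := by simp
      trans coneDecompose A B ((a, 0) + (0, b))
      · exact congrArg _ this
      rw [map_add, coneDecompose_inl (sub_add_cancel n 1) ha, coneDecompose_inr hb, ← map_add,
        DirectSum.lof_eq_of]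
      congr 1
      exact Subtype.ext this.symm)

/-- K-flatness makes X tensored with the cone of φ acyclic, and this complex is identified with the
cone of 1 ⊗ φ. -/
theorem IsKFlat.qIso {dX : X →ₗ[R] X} (hX : IsKFlat dX) (hdX : IsDGA dX) {dA : A →ₗ[R] A}
    {dB : B →ₗ[R] B} (hA : IsDGA dA) (hB : IsDGA dB) {φ : A →ₗ[R] B} (hφ : IsDGAHom dA dB φ)
    (h : QIso dA dB φ) :
    QIso (tensorD dX dA) (tensorD dX dB) (tensorMap (LinearMap.id : X →ₗ[R] X) φ) := by
  have hex := hX (A × B) (coneGr A B) (coneD dA dB φ) (by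
    rintro n ⟨a, b⟩ ⟨ha, hb⟩
    refine ⟨hA.degree _ _ ha, sub_mem ?_ (hB.degree _ _ hb)⟩
    have := hφ.degree _ _ ha
    rwa [add_zero] at this) (exact_coneD hA.sq hB.sq hφ.map_d h)
  set D : X ⊗[R] A →ₗ[R] X ⊗[R] A :=
    TensorProduct.map dX LinearMap.id + TensorProduct.map X.sign dA with hD
  set D' : X ⊗[R] B →ₗ[R] X ⊗[R] B :=
    TensorProduct.map dX LinearMap.id + TensorProduct.map X.sign dB with hD'
  set DC : X ⊗[R] (A × B) →ₗ[R] X ⊗[R] (A × B) :=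
    TensorProduct.map dX LinearMap.id + TensorProduct.map X.sign (coneD dA dB φ) with hDC
  change QIso D D' (TensorProduct.map (LinearMap.id : X →ₗ[R] X) φ)
  let il : X ⊗[R] A →ₗ[R] X ⊗[R] (A × B) := TensorProduct.map LinearMap.id (LinearMap.inl R A B)
  -- The shifted cone differential passes over X, and the sign operator on X absorbs the resulting
  -- sign. The projection `pr` carries the same twist, so that it splits this inclusion.
  let ir : X ⊗[R] B →ₗ[R] X ⊗[R] (A × B) := TensorProduct.map X.sign (LinearMap.inr R A B)
  let pl : X ⊗[R] (A × B) →ₗ[R] X ⊗[R] A := TensorProduct.map LinearMap.id (LinearMap.fst R A B)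
  let pr : X ⊗[R] (A × B) →ₗ[R] X ⊗[R] B := TensorProduct.map X.sign (LinearMap.snd R A B)
  have hds : ∀ x, dX (X.sign x) = -X.sign (dX x) := d_sign hdX.degree
  have e1 : DC ∘ₗ il = il ∘ₗ D + ir ∘ₗ TensorProduct.map LinearMap.id φ := by
    ext x a
    simp [DC, il, ir, D, coneD_apply, add_assoc, ← TensorProduct.tmul_add]
  have e2 : DC ∘ₗ ir = -(ir ∘ₗ D') := by
    ext x b
    simp [DC, ir, D', coneD_apply, sign_sign, hds, TensorProduct.neg_tmul]
    simp only [← TensorProduct.tmul_neg, Prod.neg_mk, neg_zero]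
    abel
  have e3 : pl ∘ₗ DC = D ∘ₗ pl := by
    ext x a <;> simp [DC, pl, D, coneD_apply]
  have e4 : pr ∘ₗ DC = TensorProduct.map LinearMap.id φ ∘ₗ pl - D' ∘ₗ pr := by
    ext x a <;> simp [DC, pl, pr, D', coneD_apply, sign_sign, hds, TensorProduct.neg_tmul,
      TensorProduct.tmul_neg, add_comm]
  intro z z' hz hz'
  obtain ⟨y, hy⟩ := (hex (il z + ir z')).1 (by
      change DC _ = 0
      rw [map_add, ← LinearMap.comp_apply, ← LinearMap.comp_apply, e1, e2]
      simp [hz, hz'])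
  change DC y = _ at hy
  have f1 : pl ∘ₗ il = LinearMap.id := by ext; simp [pl, il]
  have f2 : pl ∘ₗ ir = 0 := by ext; simp [pl, ir]
  have f3 : pr ∘ₗ il = 0 := by ext; simp [pr, il]
  have f4 : pr ∘ₗ ir = LinearMap.id := by ext; simp [pr, ir, sign_sign]
  refine ⟨pl y, pr y, ?_, ?_⟩
  · rw [← LinearMap.comp_apply, ← e3, LinearMap.comp_apply, hy, map_add, ← LinearMap.comp_apply,
      ← LinearMap.comp_apply, f1, f2]
    simp
  · have := LinearMap.congr_fun e4 y
    rw [LinearMap.comp_apply, hy, map_add, ← LinearMap.comp_apply, ← LinearMap.comp_apply, f3, f4] at this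
    simp only [LinearMap.zero_apply, LinearMap.id_apply, zero_add, LinearMap.sub_apply,
      LinearMap.comp_apply] at this
    rw [this]; abel

/-- With zero differential on X, the total differential is 1 ⊗ δ up to the invertible sign operator,
and flatness preserves its exactness. -/
theorem isKFlat_of_flat [Module.Flat R X] : IsKFlat (0 : X →ₗ[R] X) := by
  intro N _ _ 𝒩 _ δ _ hex
  have h1 : (TensorProduct.map 0 LinearMap.id + TensorProduct.map X.sign δ :
      X ⊗[R] N →ₗ[R] X ⊗[R] N) = X.sign.rTensor N ∘ₗ δ.lTensor X := by
    ext x n; simp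
  have h2 : (TensorProduct.map 0 LinearMap.id + TensorProduct.map X.sign δ :
      X ⊗[R] N →ₗ[R] X ⊗[R] N) = δ.lTensor X ∘ₗ X.sign.rTensor N := by
    ext x n; simp
  have h3 : ∀ z : X ⊗[R] N, X.sign.rTensor N (X.sign.rTensor N z) = z := by
    intro z
    rw [← LinearMap.comp_apply, ← LinearMap.rTensor_comp]
    have : X.sign ∘ₗ X.sign = LinearMap.id := LinearMap.ext (sign_sign X)
    rw [this, LinearMap.rTensor_id, LinearMap.id_apply]
  have hfl := Module.Flat.lTensor_exact X hex
  intro z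
  constructor
  · intro hz
    rw [h1, LinearMap.comp_apply] at hz
    have := h3 (δ.lTensor X z)
    rw [hz, map_zero] at this
    obtain ⟨y, hy⟩ := (hfl z).1 this.symm
    exact ⟨X.sign.rTensor N y, by rw [h2, LinearMap.comp_apply, h3, hy]⟩
  · rintro ⟨y, rfl⟩
    rw [LinearMap.congr_fun h2 y, LinearMap.congr_fun h1 _, LinearMap.comp_apply, LinearMap.comp_apply, (hfl _).2 ⟨_, rfl⟩, map_zero]

theorem qIso_tensor_right {ι : Type*} {b : Module.Basis ι R X} {r : ι → ℕ} {dX : X →ₗ[R] X}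
    (hb : ∀ i, dX (b i) ∈ rankFilt b r ((r i : ℤ) - 1)) (hX : IsDGA dX) {dA : A →ₗ[R] A}
    {dB : B →ₗ[R] B} (hA : IsDGA dA) (hB : IsDGA dB) {φ : A →ₗ[R] B} (hφ : IsDGAHom dA dB φ)
    (h : QIso dA dB φ) :
    QIso (tensorD dA dX) (tensorD dB dX) (tensorMap φ (LinearMap.id : X →ₗ[R] X)) :=
  qIso_rTensor hb hX.sq hA.sq hB.sq hφ.map_d (fun x => (hφ.degree.sign₀ x).symm) (d_sign hA.degree)
    (d_sign hB.degree) h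

theorem QIso.comp {dA : A →ₗ[R] A} {dB : B →ₗ[R] B} {dC : C →ₗ[R] C} {f : A →ₗ[R] B}
    {g : B →ₗ[R] C} (hg : QIso dB dC g) (hf : QIso dA dB f) (hfd : ∀ x, f (dA x) = dB (f x))
    (hgd : ∀ x, g (dB x) = dC (g x)) :
    QIso dA dC (g ∘ₗ f) := by
  intro z z' hz hz'
  obtain ⟨y, y', h1, h2⟩ := hg (f z) z' (by rw [← hfd, hz, map_zero]) hz'
  obtain ⟨x, x', h3, h4⟩ := hf z y hz h1.symm
  refine ⟨x, y' + g x', h3, ?_⟩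
  rw [map_add, ← h2, ← hgd, ← h4, map_sub, LinearMap.comp_apply]; abel

/-- Injectivity in homology gives a chain bounding z. Surjectivity then corrects it by a cycle, so
that its image differs from z' only by a boundary. -/
theorem IsHomologyIso.qIso {dA : A →ₗ[R] A} {dB : B →ₗ[R] B} {f : A →ₗ[R] B}
    (h : IsHomologyIso dA dB f) : QIso dA dB f := by
  obtain ⟨hf, hinj, hsurj⟩ := h
  intro z z' hz hz'
  have h1 : (Submodule.Quotient.mk ⟨z, hz⟩ : Homology dA) = 0 := by
    apply hinj
    rw [map_zero]
    exact (Submodule.Quotient.mk_eq_zero _).2 ⟨z', hz'.symm⟩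
  obtain ⟨y, hy⟩ := (Submodule.Quotient.mk_eq_zero _).1 h1
  change dA y = z at hy
  have hc : f y - z' ∈ LinearMap.ker dB := by
    rw [LinearMap.mem_ker, map_sub, ← hf, hy, hz', sub_self]
  obtain ⟨c, hc'⟩ := hsurj (Submodule.Quotient.mk ⟨f y - z', hc⟩)
  obtain ⟨⟨x, hx⟩, rfl⟩ := Submodule.Quotient.mk_surjective _ c
  obtain ⟨w, hw⟩ := (Submodule.Quotient.eq _).1 hc'
  change dB w = f x - (f y - z') at hw
  refine ⟨y - x, -w, by rw [map_sub, hy, LinearMap.mem_ker.1 hx, sub_zero], ?_⟩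
  rw [map_sub, map_neg, hw]; abel

theorem QIso.isHomologyIso {dA : A →ₗ[R] A} {dB : B →ₗ[R] B} {f : A →ₗ[R] B}
    (hf : ∀ x, f (dA x) = dB (f x)) (h : QIso dA dB f) : IsHomologyIso dA dB f := by
  refine ⟨hf, (injective_iff_map_eq_zero _).2 fun c hc => ?_, fun c => ?_⟩
  · obtain ⟨⟨x, hx⟩, rfl⟩ := Submodule.Quotient.mk_surjective _ c
    obtain ⟨w, hw⟩ := (Submodule.Quotient.mk_eq_zero _).1 hc
    obtain ⟨y, -, hy, -⟩ := h x w hx hw.symm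
    exact (Submodule.Quotient.mk_eq_zero _).2 ⟨y, hy⟩
  · obtain ⟨⟨x, hx⟩, rfl⟩ := Submodule.Quotient.mk_surjective _ c
    obtain ⟨y, y', hy, hy'⟩ := h 0 x (map_zero _) (by rw [map_zero, LinearMap.mem_ker.1 hx])
    exact ⟨Submodule.Quotient.mk ⟨y, hy⟩, (Submodule.Quotient.eq _).2 ⟨y', hy'.symm⟩⟩

end GrAlg

/-! ### Moving chains into low filtration. -/

/-- If `d` is exact in positive rank and `D` differs from `d` by terms lowering the rank by two,
a chain with boundary in filtration `n` is homologous to a chain in filtration `n + 1`. -/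
theorem exists_sub_boundary_mem {R ι M : Type*} [CommRing R] [AddCommGroup M] [Module R M]
    {b : Module.Basis ι R M} {r : ι → ℕ} {d D : M →ₗ[R] M}
    (h0 : ∀ x ∈ rankDeg b r 0, d x = 0) (h1 : ∀ q, ∀ x ∈ rankDeg b r (q + 1), d x ∈ rankDeg b r q)
    (hex : ∀ q, ∀ x ∈ rankDeg b r (q + 1), d x = 0 → ∃ y, d y = x)
    (hpert : ∀ q : ℕ, ∀ x ∈ rankDeg b r q, D x - d x ∈ rankFilt b r ((q : ℤ) - 2))
    (hDD : ∀ x, D (D x) = 0) {n : ℤ} (hn : -1 ≤ n) {y : M} (hy : D y ∈ rankFilt b r n) :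
    ∃ u, y - D u ∈ rankFilt b r (n + 1) := by
  have hDd : ∀ (m : ℤ) x, x ∈ rankFilt b r m → D x - d x ∈ rankFilt b r (m - 2) := by
    intro m x hx
    rw [sub_eq_add_neg m 2]
    refine rankFilt_map_le (D - d) (S := rankFilt b r) (fun _ _ => rankFilt_mono)
      (fun q x hx => ?_) hx
    rw [← sub_eq_add_neg (q : ℤ) 2]
    exact hpert q x hx
  have hd : ∀ (m : ℤ) x, x ∈ rankFilt b r m → d x ∈ rankFilt b r (m - 1) := by
    intro m x hx
    rw [sub_eq_add_neg m 1]
    refine rankFilt_map_le d (S := rankFilt b r) (fun _ _ => rankFilt_mono) (fun q x hx => ?_) hx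
    rcases q with _ | q
    · rw [h0 x hx]; exact zero_mem _
    · exact rankDeg_le_rankFilt (by push_cast; omega) (h1 q x hx)
  have hD : ∀ (m : ℤ) x, x ∈ rankFilt b r m → D x ∈ rankFilt b r (m - 1) := fun m x hx => by
    have := add_mem (rankFilt_mono (by omega) (hDd m x hx)) (hd m x hx)
    rwa [sub_add_cancel] at this
  obtain ⟨N, hN⟩ := exists_mem_rankFilt (b := b) (r := r) y
  induction N generalizing y with
  | zero => exact ⟨0, by rw [map_zero, sub_zero]; exact rankFilt_mono (by push_cast; omega) hN⟩
  | succ N ih =>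
    by_cases hle : ((N + 1 : ℕ) : ℤ) ≤ n + 1
    · exact ⟨0, by rw [map_zero, sub_zero]; exact rankFilt_mono hle hN⟩
    · push_cast at hle
      -- The top component of y. Since n < N and D - d lowers the rank by two, dt is the only
      -- contribution of rank N to Dy, so dt = 0.
      set t := rankProj b r (N + 1) y with ht
      have htm : t ∈ rankDeg b r (N + 1) := rankProj_mem _ _
      have hlow := sub_rankProj_mem hN
      rw [← ht] at hlow
      push_cast at hlow
      have hdt : d t ∈ rankFilt b r ((N : ℤ) - 1) := by
        have e : d t = D y - D (y - t) - (D t - d t) := by rw [map_sub]; abel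
        rw [e]
        refine sub_mem (sub_mem (rankFilt_mono (by omega) hy) ?_) ?_
        · exact rankFilt_mono (by omega) (hD _ _ hlow)
        · exact rankFilt_mono (by push_cast; omega) (hpert _ _ htm)
      have hdt0 : d t = 0 := by
        rw [← rankProj_of_mem (h1 N t htm)]
        exact rankProj_of_mem_filt hdt (by omega)
      obtain ⟨w, hw⟩ := hex N t htm hdt0
      -- Only the component of the primitive in rank N + 2 is kept. Then Du differs from t by terms
      -- of filtration N, and y - Du has lost its top component.
      let u := rankProj b r (N + 1 + 1) w
      have hu : d u = t := by
        rw [← rankProj_comm h0 h1, hw, ht, rankProj_of_mem (rankProj_mem _ _)]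
      obtain ⟨u', hu'⟩ := ih (y := y - D u) (by rw [map_sub, hDD, sub_zero]; exact hy) (by
        have e : y - D u = (y - t) - (D u - d u) := by rw [hu]; abel
        rw [e]
        refine sub_mem (rankFilt_mono (by omega) hlow) ?_
        exact rankFilt_mono (by push_cast; omega) (hpert _ u (rankProj_mem _ _)))
      exact ⟨u + u', by rw [map_add, ← sub_sub]; exact hu'⟩

/-! ### Lifting along quasi-isomorphisms with control of filtration and augmentation. -/

namespace GrAlg

variable {R : Type u} [CommRing R]

/-- A multiplicative filtration of a dga for which chains can be moved to low filtration. -/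
structure IsResFilt {M : GrAlg R} (D : M →ₗ[R] M) (F : ℤ → Submodule R M) : Prop where
  mono : Monotone F
  neg : ∀ n < 0, F n = ⊥
  one : 1 ∈ F 0
  mul : ∀ {m n : ℤ} {x y : M}, x ∈ F m → y ∈ F n → x * y ∈ F (m + n)
  comp : ∀ {m : ℤ} {x : M}, x ∈ F m → ∀ n, M.comp n x ∈ F m
  reduce : ∀ {n : ℤ}, -1 ≤ n → ∀ {y : M}, D y ∈ F n → ∃ u, y - D u ∈ F (n + 1)

/-- A chain projection of degree `0` onto a two-sided ideal. -/
structure IsIdealProj {M : GrAlg R} (D : M →ₗ[R] M) (π : M →ₗ[R] M) : Prop where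
  degree : HasDegree 0 π
  map_d : ∀ x, π (D x) = D (π x)
  idem : ∀ x, π (π x) = π x
  mul_left : ∀ x y, π y = y → π (x * y) = x * y
  mul_right : ∀ x y, π x = x → π (x * y) = x * y

theorem map_one_d {M : GrAlg R} {D : M →ₗ[R] M} (hD : IsDerivation D) : D 1 = 0 := by
  simpa [GrAlg.sign_one] using hD.leibniz 1 1

end GrAlg

namespace FreeGens

variable {R : Type u} [CommRing R] {T M N : GrAlg R} (V : FreeGens T)

/-- A difference of products is a sum of two terms, each containing one difference of factors.
Multiplicativity of the filtration and the ideal property of π therefore pass from generators to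
words. -/
theorem filtered_lift_properties {F : ℤ → Submodule R M} {D : M →ₗ[R] M} (hF : IsResFilt D F)
    {π : M →ₗ[R] M} (hπ : IsIdealProj D π) {f₀ f : T →ₐ[R] M}
    (hf₀ : ∀ v, f₀ (V.gen v) ∈ F (V.res v))
    (hf : ∀ v, f (V.gen v) - f₀ (V.gen v) ∈ F (V.res v - 1))
    (hfπ : ∀ v, π (f (V.gen v) - f₀ (V.gen v)) = f (V.gen v) - f₀ (V.gen v)) :
    (∀ n, ∀ x ∈ V.resFilt n, f x - f₀ x ∈ F (n - 1)) ∧ ∀ x, π (f x - f₀ x) = f x - f₀ x := by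
  have key : ∀ l, f₀ (V.word l) ∈ F (V.wres l) ∧ f (V.word l) - f₀ (V.word l) ∈ F (V.wres l - 1) ∧
      π (f (V.word l) - f₀ (V.word l)) = f (V.word l) - f₀ (V.word l) := by
    intro l
    induction l with
    | nil =>
      rw [word_nil, map_one, map_one, sub_self]
      exact ⟨hF.one, zero_mem _, map_zero _⟩
    | cons v l ih =>
      obtain ⟨i1, i2, i3⟩ := ih
      have i4 : f (V.word l) ∈ F (V.wres l) := by
        have := add_mem (hF.mono (by omega) i2) i1
        rwa [sub_add_cancel] at this
      rw [word_cons, map_mul, map_mul, wres_cons]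
      have e : f (V.gen v) * f (V.word l) - f₀ (V.gen v) * f₀ (V.word l) =
          (f (V.gen v) - f₀ (V.gen v)) * f (V.word l) +
            f₀ (V.gen v) * (f (V.word l) - f₀ (V.word l)) := by noncomm_ring
      rw [e]
      refine ⟨?_, add_mem ?_ ?_, ?_⟩
      · convert hF.mul (hf₀ v) i1 using 2; push_cast; ring
      · convert hF.mul (hf v) i4 using 2; push_cast; ring
      · convert hF.mul (hf₀ v) i2 using 2; push_cast; ring
      · rw [map_add, hπ.mul_right _ _ (hfπ v), hπ.mul_left _ _ i3]
  constructor
  · intro n x hx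
    have : V.resFilt n ≤ (F (n - 1)).comap (f.toLinearMap - f₀.toLinearMap) :=
      V.resFilt_le_iff.2 fun l hl => hF.mono (by omega) (key l).2.1
    exact this hx
  · intro x
    have := V.mem_of_words (LinearMap.ker
      (π ∘ₗ (f.toLinearMap - f₀.toLinearMap) - (f.toLinearMap - f₀.toLinearMap)))
      (fun l => by
        rw [LinearMap.mem_ker, LinearMap.sub_apply, LinearMap.comp_apply, sub_eq_zero]
        exact (key l).2.2) x
    rw [LinearMap.mem_ker, LinearMap.sub_apply, LinearMap.comp_apply, sub_eq_zero] at this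
    exact this

theorem algHom_agree {S : Type*} [Ring S] [Algebra R S] {f f' : T →ₐ[R] S} {n : ℕ}
    (he : ∀ v, V.res v < n → f (V.gen v) = f' (V.gen v)) {x : T}
    (hx : x ∈ V.resFilt ((n : ℤ) - 1)) : f x = f' x := by
  have := V.resFilt_le_of_gen_mul (n := n) (LinearMap.eqLocus f.toLinearMap f'.toLinearMap)
    (by simp [LinearMap.mem_eqLocus])
    (fun v hv y _ hy => by
      rw [LinearMap.mem_eqLocus, AlgHom.toLinearMap_apply, AlgHom.toLinearMap_apply] at hy ⊢
      rw [map_mul, map_mul, hy, he v hv])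
  exact this hx

/-- Lifting a map of dga's along a quasi-isomorphism `φ` up to homotopy, keeping control of the
leading term `f₀` and of the augmentation ideals. -/
theorem exists_filtered_lift {δ : T →ₗ[R] T} (hδ : IsDGA δ)
    (hV : ∀ v, δ (V.gen v) ∈ V.resFilt ((V.res v : ℤ) - 1)) {D : M →ₗ[R] M} (hD : IsDGA D)
    {F : ℤ → Submodule R M} (hF : IsResFilt D F) {D' : N →ₗ[R] N} (hD' : IsDGA D')
    {φ : M →ₗ[R] N} (hφ : IsDGAHom D D' φ) (hq : QIso D D' φ) {f₀ : T →ₐ[R] M}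
    (hf₀deg : ∀ v, f₀ (V.gen v) ∈ M.gr (V.deg v)) (hf₀ : ∀ v, f₀ (V.gen v) ∈ F (V.res v))
    (hf₀D : ∀ v, D (f₀ (V.gen v)) - f₀ (δ (V.gen v)) ∈ F (V.res v - 2))
    {g : T →ₗ[R] N} (hg : IsDGAHom δ D' g)
    (hinit : ∀ v, V.res v = 0 → ∃ y, φ (f₀ (V.gen v)) - g (V.gen v) = D' y)
    {π : M →ₗ[R] M} (hπ : IsIdealProj D π) {π' : N →ₗ[R] N} (hπ' : IsIdealProj D' π')
    (hπF : ∀ n, ∀ x ∈ F n, π x ∈ F n) (hφπ : ∀ x, φ (π x) = π' (φ x))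
    (hπ₀ : ∀ v, π (D (f₀ (V.gen v)) - f₀ (δ (V.gen v))) = D (f₀ (V.gen v)) - f₀ (δ (V.gen v)))
    (hπ₁ : ∀ v, π' (φ (f₀ (V.gen v)) - g (V.gen v)) = φ (f₀ (V.gen v)) - g (V.gen v)) :
    ∃ f : T →ₗ[R] M, IsDGAHom δ D f ∧ (∀ n, ∀ x ∈ V.resFilt n, f x - f₀ x ∈ F (n - 1)) ∧
      (∀ x, π (f x - f₀ x) = f x - f₀ x) ∧ DerivationHomotopic δ D' (φ ∘ₗ f) g := by
  -- The admissible corrections of f₀ on a generator: of the right degree, one filtration step below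
  -- the leading term, and in the ideal cut out by π.
  let CM : V.X → Submodule R M := fun v =>
    M.gr (V.deg v) ⊓ F (V.res v - 1) ⊓ LinearMap.eqLocus π LinearMap.id
  let CN : V.X → Submodule R N := fun v =>
    N.gr (V.deg v + 1) ⊓ LinearMap.eqLocus π' LinearMap.id
  let Y : V.X → Type u := fun v => CM v × CN v
  let Val : (∀ v, Y v) → (T →ₐ[R] M) → (T →ₗ[R] N) → Prop := fun a f s =>
    (∀ v, f (V.gen v) = f₀ (V.gen v) + (a v).1) ∧
    (∀ x y, s (x * y) = (φ ∘ₗ f.toLinearMap) (T.sign x) * s y + s x * g y) ∧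
    ∀ v, s (V.gen v) = (a v).2
  have hφf1 : ∀ f : T →ₐ[R] M, (φ ∘ₗ f.toLinearMap) 1 = 1 := fun f => by
    simp [hφ.map_one]
  have hφfm : ∀ (f : T →ₐ[R] M) x y, (φ ∘ₗ f.toLinearMap) (x * y) =
      (φ ∘ₗ f.toLinearMap) x * (φ ∘ₗ f.toLinearMap) y := fun f x y => by
    simp [hφ.map_mul]
  have hex : ∀ a, ∃ f s, Val a f s := by
    intro a
    obtain ⟨s, h1, h2⟩ := V.exists_derivation (f := φ ∘ₗ (V.lift fun v =>
      f₀ (V.gen v) + (a v).1).toLinearMap) (hφf1 _) (hφfm _) hg.map_one hg.map_mul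
      (fun v => ((a v).2 : N))
    exact ⟨_, s, fun v => V.lift_gen _ v, h1, h2⟩
  have hagree : ∀ a b (n : ℕ), (∀ x, V.res x < n → a x = b x) → ∀ f s f' s', Val a f s →
      Val b f' s' → ∀ x ∈ V.resFilt ((n : ℤ) - 1), f x = f' x ∧ s x = s' x := by
    intro a b n hab f s f' s' h h' x hx
    have hf : ∀ x ∈ V.resFilt ((n : ℤ) - 1), f x = f' x := fun x hx =>
      V.algHom_agree (fun v hv => by rw [h.1, h'.1, hab v hv]) hx
    refine ⟨hf x hx, ?_⟩
    have hfl : ∀ v, V.res v < n → f (V.gen v) = f' (V.gen v) := fun v hv => by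
      rw [h.1, h'.1, hab v hv]
    have := V.resFilt_le_of_gen_mul (n := n) (LinearMap.eqLocus s s')
      (by rw [LinearMap.mem_eqLocus, eq_zero_of_rule_one (hφf1 f) hg.map_one h.2.1,
            eq_zero_of_rule_one (hφf1 f') hg.map_one h'.2.1])
      (fun v hv y _ hy => by
        rw [LinearMap.mem_eqLocus] at hy ⊢
        rw [h.2.1, h'.2.1, hy, h.2.2, h'.2.2, hab v hv, sign_mem (V.gen_mem_gr v), map_zsmul,
          map_zsmul, LinearMap.comp_apply, LinearMap.comp_apply, AlgHom.toLinearMap_apply,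
          AlgHom.toLinearMap_apply, hfl v hv])
    exact this hx
  have hfdeg : ∀ {a f s}, Val a f s → HasDegree 0 f.toLinearMap := fun {a f s} h =>
    V.hasDegree_algHom fun v => by
      rw [h.1]; exact add_mem (hf₀deg v) (a v).1.2.1.1
  have hφfdeg : ∀ {a f s}, Val a f s → HasDegree 0 (φ ∘ₗ f.toLinearMap) := fun {a f s} h =>
    hφ.degree.comp (hfdeg h) (add_zero 0)
  have hsdeg : ∀ {a f s}, Val a f s → HasDegree 1 s := fun {a f s} h =>
    V.derivation_degree (hφf1 f) hg.map_one (hφfdeg h) hg.degree h.2.1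
      (fun v => by rw [h.2.2]; exact (a v).2.2.1)
  have hsπ : ∀ {a f s}, Val a f s → ∀ x, π' (s x) = s x := by
    intro a f s h x
    have := V.mem_of_gen_mul (LinearMap.eqLocus (π' ∘ₗ s) s)
      (by rw [LinearMap.mem_eqLocus, LinearMap.comp_apply,
            eq_zero_of_rule_one (hφf1 f) hg.map_one h.2.1, map_zero])
      (fun v y hy => by
        rw [LinearMap.mem_eqLocus, LinearMap.comp_apply] at hy ⊢
        rw [h.2.1, map_add, hπ'.mul_left _ _ hy, hπ'.mul_right]
        rw [h.2.2]; exact (a v).2.2.2) x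
    exact this
  have hfprop : ∀ {a f s}, Val a f s → (∀ n, ∀ x ∈ V.resFilt n, f x - f₀ x ∈ F (n - 1)) ∧
      ∀ x, π (f x - f₀ x) = f x - f₀ x := fun {a f s} h =>
    V.filtered_lift_properties hF hπ hf₀
      (fun v => by rw [h.1, add_sub_cancel_left]; exact (a v).1.2.1.2)
      (fun v => by rw [h.1, add_sub_cancel_left]; exact (a v).1.2.2)
  let E : (T →ₐ[R] M) → (T →ₗ[R] N) → T → Prop := fun f s x =>
    f (δ x) = D (f x) ∧ s (δ x) + D' (s x) = φ (f x) - g x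
  have hE : ∀ {a f s}, Val a f s → ∀ n : ℕ, (∀ v, V.res v < n → E f s (V.gen v)) →
      ∀ x ∈ V.resFilt ((n : ℤ) - 1), E f s x := by
    intro a f s h n hn x hx
    have hmem : ∀ x, x ∈ LinearMap.eqLocus (f.toLinearMap ∘ₗ δ) (D ∘ₗ f.toLinearMap) ⊓
        LinearMap.eqLocus (s ∘ₗ δ + D' ∘ₗ s) (φ ∘ₗ f.toLinearMap - g) ↔ E f s x := fun x => Iff.rfl
    have := V.resFilt_le_of_gen_mul (n := n)
      (LinearMap.eqLocus (f.toLinearMap ∘ₗ δ) (D ∘ₗ f.toLinearMap) ⊓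
        LinearMap.eqLocus (s ∘ₗ δ + D' ∘ₗ s) (φ ∘ₗ f.toLinearMap - g))
      (by
        rw [hmem]
        simp [E, map_one_d hδ.toIsDerivation, map_one_d hD.toIsDerivation, hφ.map_one, hg.map_one,
          eq_zero_of_rule_one (hφf1 f) hg.map_one h.2.1])
      (fun v hv y _ hy => by
        rw [hmem] at hy ⊢
        obtain ⟨v1, v2⟩ := hn v hv
        obtain ⟨y1, y2⟩ := hy
        constructor
        · have := (hfdeg h).sign₀ (V.gen v)
          simp only [AlgHom.toLinearMap_apply] at this
          rw [hδ.leibniz, map_add, map_mul, map_mul, map_mul, hD.leibniz, v1, y1, this]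
        · rw [derivation_boundary hδ.toIsDerivation hD'.toIsDerivation (hφfdeg h) (hsdeg h) h.2.1
            (by simp only [LinearMap.comp_apply, AlgHom.toLinearMap_apply, v1, hφ.map_d])
            (hg.map_d _), v2, y2, map_mul, hφ.map_mul, hg.map_mul]
          simp only [LinearMap.comp_apply, AlgHom.toLinearMap_apply]
          noncomm_ring)
    exact (hmem x).1 (this hx)
  obtain ⟨a, ha⟩ := exists_of_rank_local (Y := Y) V.res
    (fun a v => ∀ f s, Val a f s → E f s (V.gen v))
    (by
      intro a b v hab habv ha f' s' h'
      obtain ⟨f, s, h⟩ := hex a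
      obtain ⟨e1, e2⟩ := ha f s h
      obtain ⟨k1, k2⟩ := hagree a b (V.res v) hab f s f' s' h h' _ (hV v)
      have k3 : f (V.gen v) = f' (V.gen v) := by rw [h.1, h'.1, habv]
      have k4 : s (V.gen v) = s' (V.gen v) := by rw [h.2.2, h'.2.2, habv]
      exact ⟨by rw [← k1, ← k3, e1], by rw [← k2, ← k3, ← k4, e2]⟩)
    (by
      classical
      intro a v ha
      obtain ⟨f, s, h⟩ := hex a
      obtain ⟨l1, l2⟩ := hE h (V.res v) (fun x hx => ha x hx f s h) _ (hV v)
      rw [hδ.sq, map_zero] at l1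
      rw [hδ.sq, map_zero, zero_add] at l2
      -- The failure of f₀ to extend f as a chain map at v. Together with c, the failure of the
      -- homotopy equation, it is a cycle of the cone of φ.
      set z := D (f₀ (V.gen v)) - f (δ (V.gen v)) with hz
      set c := φ (f₀ (V.gen v)) - g (V.gen v) - s (δ (V.gen v)) with hc
      have hDz : D z = 0 := by rw [hz, map_sub, hD.sq, ← l1, sub_zero]
      have hφz : φ z = D' c := by
        rw [hz, hc, map_sub, map_sub, map_sub, l2, hφ.map_d, hg.map_d]; abel
      have hz' : z = (D (f₀ (V.gen v)) - f₀ (δ (V.gen v))) -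
          (f (δ (V.gen v)) - f₀ (δ (V.gen v))) := by rw [hz]; abel
      have hzF : z ∈ F (V.res v - 2) := by
        rw [hz']
        refine sub_mem (hf₀D v) ?_
        convert (hfprop h).1 _ _ (hV v) using 2; ring
      have hzπ : π z = z := by rw [hz', map_sub, hπ₀, (hfprop h).2]
      have hcπ : π' c = c := by rw [hc, map_sub, hπ₁, hsπ h]
      have hdv := hδ.degree _ _ (V.gen_mem_gr v)
      have hzdeg : z ∈ M.gr (V.deg v + -1) :=
        sub_mem (hD.degree _ _ (hf₀deg v)) (by simpa using hfdeg h _ _ hdv)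
      have hcdeg : c ∈ N.gr (V.deg v) := by
        have h1 := hφ.degree _ _ (hf₀deg v)
        have h2 := hg.degree _ _ (V.gen_mem_gr v)
        have h3 := hsdeg h _ _ hdv
        rw [add_zero] at h1 h2
        rw [neg_add_cancel_right] at h3
        exact sub_mem (sub_mem h1 h2) h3
      -- In resolution degree 0 the cycle z has negative filtration and vanishes, so f₀ needs no
      -- correction and `hinit` suffices. In higher degree `reduce` brings the correction down by a
      -- boundary, whose image under φ is absorbed in y'.
      have hraw : ∃ y ∈ F (V.res v - 1), ∃ y', D y = z ∧ φ y - c = D' y' := by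
        by_cases h0 : V.res v = 0
        · obtain ⟨y', hy'⟩ := hinit v h0
          have hδ0 : δ (V.gen v) = 0 := by
            have := hV v
            rw [V.resFilt_neg (by omega)] at this
            exact (Submodule.mem_bot R).1 this
          have hz0 : z = 0 := by
            rw [hF.neg _ (by omega)] at hzF
            exact (Submodule.mem_bot R).1 hzF
          refine ⟨0, zero_mem _, -y', by rw [map_zero, hz0], ?_⟩
          rw [hc, hδ0, map_zero, map_zero, map_neg, ← hy']; abel
        · obtain ⟨y, y', hy, hy'⟩ := hq z c hDz hφz
          obtain ⟨w, hw⟩ := hF.reduce (n := V.res v - 2) (by omega) (y := y) (by rw [hy]; exact hzF)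
          refine ⟨y - D w, hF.mono (by omega) hw, y' - φ w, by rw [map_sub, hD.sq, sub_zero, hy], ?_⟩
          rw [map_sub, map_sub, ← hy', hφ.map_d]; abel
      obtain ⟨y, hyF, y', hy, hy'⟩ := hraw
      -- The component projections and π, π' are compatible with the differentials and φ, and they
      -- fix z and c. Projecting y and y' thus preserves both equations.
      set Z := M.comp (V.deg v) (π y) with hZ
      set Z' := N.comp (V.deg v + 1) (π' y') with hZ'
      have hZm : -Z ∈ CM v := by
        refine neg_mem ⟨⟨comp_mem_gr _ _, hF.comp (hπF _ _ hyF) _⟩, ?_⟩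
        change π (M.comp _ (π y)) = M.comp _ (π y)
        rw [hπ.degree.comp_eq, add_zero, hπ.idem]
      have hZm' : -Z' ∈ CN v := by
        refine neg_mem ⟨comp_mem_gr _ _, ?_⟩
        change π' (N.comp _ (π' y')) = N.comp _ (π' y')
        rw [hπ'.degree.comp_eq, add_zero, hπ'.idem]
      have hDZ : D Z = z := by
        rw [hZ, hD.degree.comp_eq, ← hπ.map_d, hy, hzπ, comp_of_mem hzdeg]
      have hφZ : φ Z - c = D' Z' := by
        rw [hZ, hZ', hφ.degree.comp_eq, hD'.degree.comp_eq, ← hπ'.map_d, ← hy', map_sub, hcπ, hφπ,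
          add_zero, add_neg_cancel_right, map_sub, comp_of_mem hcdeg]
      refine ⟨Function.update a v (⟨-Z, hZm⟩, ⟨-Z', hZm'⟩), fun x hx =>
        Function.update_of_ne (by rintro rfl; exact lt_irrefl _ hx) _ _, fun f' s' h' => ?_⟩
      obtain ⟨k1, k2⟩ := hagree a _ (V.res v) (fun x hx =>
        (Function.update_of_ne (by rintro rfl; exact lt_irrefl _ hx) _ _).symm) f s f' s' h h' _ (hV v)
      have k3 : f' (V.gen v) = f₀ (V.gen v) - Z := by
        rw [h'.1, Function.update_self, sub_eq_add_neg]
      have k4 : s' (V.gen v) = -Z' := by rw [h'.2.2, Function.update_self]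
      refine ⟨by rw [← k1, k3, map_sub, hDZ, hz]; abel, ?_⟩
      rw [← k2, k3, k4, map_neg, ← hφZ, map_sub, hc]; abel)
  obtain ⟨f, s, h⟩ := hex a
  have hall : ∀ x, E f s x := by
    intro x
    obtain ⟨n, hn⟩ := exists_mem_rankFilt (b := V.basis) (r := V.wres) x
    rw [← resFilt_eq] at hn
    exact hE h (n + 1) (fun v _ => ha v f s h) x (by push_cast; simpa using hn)
  exact ⟨f.toLinearMap, ⟨hfdeg h, map_one f, map_mul f, fun x => (hall x).1⟩, (hfprop h).1,
    (hfprop h).2, s, hsdeg h, fun x => (hall x).2, h.2.1⟩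

end FreeGens

/-! ### The resolution filtration of the tensor square. -/

/-- The identification of the underlying module of the graded tensor product. -/
noncomputable def GrAlg.ofTensor {R : Type u} [CommRing R] (A B : GrAlg R) :
    A ⊗[R] B ≃ₗ[R] A.tensor B := GradedTensorProduct.of R A.gr B.gr

namespace FreeGens

variable {R : Type u} [CommRing R] {A : GrAlg R} (V : FreeGens A)

/-- The basis of `A ⊗ A` consisting of tensor products of words. -/
noncomputable def tensorBasis : Module.Basis (List V.X × List V.X) R (A.tensor A) :=
  (V.basis.tensorProduct V.basis).map (ofTensor A A)

/-- The resolution degree of a tensor product of words. -/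
def twres (p : List V.X × List V.X) : ℕ := V.wres p.1 + V.wres p.2

theorem tensorBasis_apply (p : List V.X × List V.X) :
    V.tensorBasis p = tmul (V.word p.1) (V.word p.2) := by
  rw [tensorBasis, Module.Basis.map_apply, Module.Basis.tensorProduct_apply, basis_apply,
    basis_apply]
  rfl

theorem tensorResDeg_eq (q : ℕ) : V.tensorResDeg q = rankDeg V.tensorBasis V.twres q := by
  apply le_antisymm
  · refine Submodule.span_le.2 ?_
    rintro _ ⟨i, j, a, b, rfl, ha, hb, rfl⟩
    have h1 : V.resDeg i ≤
        (rankDeg V.tensorBasis V.twres (i + j)).comap ((tmulₗ A A).flip b) := by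
      refine V.resDeg_le_iff.2 fun l hl => ?_
      have h2 : V.resDeg j ≤
          (rankDeg V.tensorBasis V.twres (i + j)).comap (tmulₗ A A (V.word l)) := by
        refine V.resDeg_le_iff.2 fun l' hl' => ?_
        have := basis_mem_rankDeg (b := V.tensorBasis) (r := V.twres) (l, l')
        rw [tensorBasis_apply, twres, hl, hl'] at this
        exact this
      exact h2 hb
    exact h1 ha
  · refine rankDeg_le_iff.2 fun p hp => ?_
    rw [tensorBasis_apply]
    exact Submodule.subset_span ⟨_, _, _, _, hp, V.word_mem_resDeg _, V.word_mem_resDeg _, rfl⟩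

theorem tensorResFilt_eq (n : ℤ) : V.tensorResFilt n = rankFilt V.tensorBasis V.twres n := by
  rw [rankFilt_eq_iSup, tensorResFilt]
  simp only [tensorResDeg_eq]

theorem tensorResFilt_mono : Monotone V.tensorResFilt := fun m n h => by
  rw [tensorResFilt_eq, tensorResFilt_eq]; exact rankFilt_mono h

theorem tensorResDeg_le_tensorResFilt {q : ℕ} {n : ℤ} (h : (q : ℤ) ≤ n) :
    V.tensorResDeg q ≤ V.tensorResFilt n := by
  rw [tensorResFilt_eq, tensorResDeg_eq]; exact rankDeg_le_rankFilt h

theorem tensorResFilt_le_iff {n : ℤ} {S : Submodule R (A.tensor A)} :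
    V.tensorResFilt n ≤ S ↔
      ∀ l l', (V.wres l : ℤ) + V.wres l' ≤ n → tmul (V.word l) (V.word l') ∈ S := by
  rw [tensorResFilt_eq, rankFilt_le_iff]
  simp only [tensorBasis_apply, twres, Prod.forall, Nat.cast_add]

theorem tensorResDeg_le_iff {q : ℕ} {S : Submodule R (A.tensor A)} :
    V.tensorResDeg q ≤ S ↔
      ∀ l l', V.wres l + V.wres l' = q → tmul (V.word l) (V.word l') ∈ S := by
  rw [tensorResDeg_eq, rankDeg_le_iff]
  simp only [tensorBasis_apply, twres, Prod.forall]

theorem tmul_mem_tensorResFilt {m n k : ℤ} {a b : A} (ha : a ∈ V.resFilt m) (hb : b ∈ V.resFilt n)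
    (h : m + n ≤ k) : tmul a b ∈ V.tensorResFilt k := by
  have h1 : V.resFilt m ≤ (V.tensorResFilt k).comap ((tmulₗ A A).flip b) := by
    refine V.resFilt_le_iff.2 fun l hl => ?_
    have h2 : V.resFilt n ≤ (V.tensorResFilt k).comap (tmulₗ A A (V.word l)) := by
      refine V.resFilt_le_iff.2 fun l' hl' => ?_
      exact V.tensorResFilt_le_iff.1 le_rfl l l' (by omega)
    exact h2 hb
  exact h1 ha

theorem word_mem_resFilt (l : List V.X) : V.word l ∈ V.resFilt (V.wres l) :=
  V.resDeg_le_resFilt le_rfl (V.word_mem_resDeg l)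

theorem tensorResFilt_mul {m n : ℤ} {x y : A.tensor A} (hx : x ∈ V.tensorResFilt m)
    (hy : y ∈ V.tensorResFilt n) : x * y ∈ V.tensorResFilt (m + n) := by
  have h1 : V.tensorResFilt m ≤ (V.tensorResFilt (m + n)).comap (LinearMap.mulRight R y) := by
    refine V.tensorResFilt_le_iff.2 fun l l' hl => ?_
    have h2 : V.tensorResFilt n ≤
        (V.tensorResFilt (m + n)).comap (LinearMap.mulLeft R (tmul (V.word l) (V.word l'))) := by
      refine V.tensorResFilt_le_iff.2 fun k k' hk => ?_
      rw [Submodule.mem_comap, LinearMap.mulLeft_apply,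
        tmul_mul _ (V.word_mem_gr l') (V.word_mem_gr k)]
      refine zsmul_mem (V.tmul_mem_tensorResFilt
        (V.resFilt_mul (V.word_mem_resFilt l) (V.word_mem_resFilt k) le_rfl)
        (V.resFilt_mul (V.word_mem_resFilt l') (V.word_mem_resFilt k') le_rfl) (by omega)) _
    exact h2 hy
  exact h1 hx

theorem comp_mem_tensorResFilt {m : ℤ} {x : A.tensor A} (hx : x ∈ V.tensorResFilt m) (n : ℤ) :
    (A.tensor A).comp n x ∈ V.tensorResFilt m := by
  have : V.tensorResFilt m ≤ (V.tensorResFilt m).comap ((A.tensor A).comp n) := by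
    refine V.tensorResFilt_le_iff.2 fun l l' hl => ?_
    rw [Submodule.mem_comap]
    have hm := tmul_mem_gr (V.word_mem_gr l) (V.word_mem_gr l') rfl
    by_cases h : V.wdeg l + V.wdeg l' = n
    · subst h; rw [comp_of_mem hm]; exact V.tensorResFilt_le_iff.1 le_rfl l l' hl
    · rw [comp_of_mem_ne hm h]; exact zero_mem _
  exact this hx

theorem tensorResFilt_neg {n : ℤ} (h : n < 0) : V.tensorResFilt n = ⊥ := by
  rw [tensorResFilt_eq, rankFilt_neg h]

/-- A linear map `θ` shifting the resolution filtration by `c` shifts the filtration of the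
tensor square through `tensorD θ θ`. -/
theorem tensorD_mem_tensorResFilt {θ : A →ₗ[R] A} {c : ℤ}
    (h : ∀ q : ℕ, ∀ x ∈ V.resDeg q, θ x ∈ V.resFilt (q + c)) {n : ℤ} {x : A.tensor A}
    (hx : x ∈ V.tensorResFilt n) : tensorD θ θ x ∈ V.tensorResFilt (n + c) := by
  have : V.tensorResFilt n ≤ (V.tensorResFilt (n + c)).comap (tensorD θ θ) := by
    refine V.tensorResFilt_le_iff.2 fun l l' hl => ?_
    rw [Submodule.mem_comap, tensorD_tmul, sign_mem (V.word_mem_gr l), zsmul_tmul]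
    exact add_mem
      (V.tmul_mem_tensorResFilt (h _ _ (V.word_mem_resDeg l)) (V.word_mem_resFilt l') (by omega))
      (zsmul_mem (V.tmul_mem_tensorResFilt (V.word_mem_resFilt l) (h _ _ (V.word_mem_resDeg l'))
        (by omega)) _)
  exact this hx

theorem map_mem_resFilt {M : Type*} [AddCommGroup M] [Module R M] {f : A →ₗ[R] M}
    {S : ℤ → Submodule R M} (hS : Monotone S) {c : ℤ}
    (h : ∀ q : ℕ, ∀ x ∈ V.resDeg q, f x ∈ S (q + c)) {n : ℤ} {x : A}
    (hx : x ∈ V.resFilt n) : f x ∈ S (n + c) := by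
  rw [resFilt_eq] at hx
  exact rankFilt_map_le f hS (fun q x hx => h q x (by rwa [resDeg_eq])) hx

theorem exists_mem_resFilt (x : A) : ∃ n : ℕ, x ∈ V.resFilt n := by
  simp only [resFilt_eq]; exact exists_mem_rankFilt x

theorem tensorD_sub (d d' : A →ₗ[R] A) (x : A.tensor A) :
    tensorD d d x - tensorD d' d' x = tensorD (d - d') (d - d') x := by
  induction x using tensor_induction' with
  | zero => simp
  | add x y hx hy => simp only [map_add, ← hx, ← hy]; abel
  | tmul a b =>
    simp only [tensorD_tmul, LinearMap.sub_apply, sub_tmul, tmul_sub]; abel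

end FreeGens

/-! ### Augmentation ideals -/

namespace CoDGA

variable {R : Type u} [CommRing R] {X : CoDGA R}

/-- The projection `x ↦ x - ε(x)` onto the augmentation ideal. -/
noncomputable def augProj (X : CoDGA R) : X.alg →ₗ[R] X.alg :=
  LinearMap.id - LinearMap.smulRight X.counit (1 : X.alg)

theorem augProj_apply (x : X.alg) : X.augProj x = x - X.counit x • 1 := rfl

theorem counit_augProj (h1 : X.counit 1 = 1) (x : X.alg) : X.counit (X.augProj x) = 0 := by
  rw [augProj_apply, map_sub, map_smul, h1, smul_eq_mul, mul_one, sub_self]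

theorem augProj_eq_self_iff (h1 : X.counit 1 = 1) {x : X.alg} :
    X.augProj x = x ↔ X.counit x = 0 := by
  constructor
  · intro h; rw [← h, counit_augProj h1]
  · intro h; rw [augProj_apply, h, zero_smul, sub_zero]

theorem hasDegree_augProj (hdeg : ∀ n, n ≠ 0 → ∀ x ∈ X.alg.gr n, X.counit x = 0) :
    HasDegree 0 X.augProj := by
  intro n x hx
  rw [add_zero, augProj_apply]
  refine sub_mem hx ?_
  by_cases h : n = 0
  · subst h; exact Submodule.smul_mem _ _ one_mem_gr
  · rw [hdeg n h x hx, zero_smul]; exact zero_mem _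

theorem augProj_d (hX : IsDerivation X.d) (hd : ∀ x, X.counit (X.d x) = 0) (x : X.alg) :
    X.augProj (X.d x) = X.d (X.augProj x) := by
  rw [augProj_apply, augProj_apply, hd, zero_smul, sub_zero, map_sub, map_smul, map_one_d hX,
    smul_zero, sub_zero]

/-- The properties of the counit alone. -/
structure IsAugmented (X : CoDGA R) : Prop where
  isDGA : IsDGA X.d
  counit_one : X.counit 1 = 1
  counit_mul : ∀ x y, X.counit (x * y) = X.counit x * X.counit y
  counit_degree : ∀ n, n ≠ 0 → ∀ x ∈ X.alg.gr n, X.counit x = 0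
  counit_d : ∀ x, X.counit (X.d x) = 0

theorem IsCounital.isAugmented (h : X.IsCounital) : X.IsAugmented :=
  ⟨h.isDGA, h.counit_one, h.counit_mul, h.counit_degree, h.counit_d⟩

theorem IsAugmented.isIdealProj (h : X.IsAugmented) : IsIdealProj X.d X.augProj where
  degree := hasDegree_augProj h.counit_degree
  map_d := augProj_d h.isDGA.toIsDerivation h.counit_d
  idem x := (augProj_eq_self_iff h.counit_one).2 (counit_augProj h.counit_one x)
  mul_left x y hy := by
    rw [augProj_eq_self_iff h.counit_one] at hy ⊢
    rw [h.counit_mul, hy, mul_zero]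
  mul_right x y hy := by
    rw [augProj_eq_self_iff h.counit_one] at hy ⊢
    rw [h.counit_mul, hy, zero_mul]

/-- The projection of `X ⊗ X` onto the tensor square of the augmentation ideal. -/
noncomputable def augProj₂ (X : CoDGA R) : X.alg.tensor X.alg →ₗ[R] X.alg.tensor X.alg :=
  tensorMap X.augProj X.augProj

/-- This expands the tensor square of 1 - ε. It expresses the projection through the two
contractions, which detect the counit laws. -/
theorem augProj₂_eq (x : X.alg.tensor X.alg) :
    X.augProj₂ x = x - tmul 1 (contractLeft X.counit x) - tmul (contractRight X.counit x) 1
      + X.counit (contractLeft X.counit x) • 1 := by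
  induction x using tensor_induction' with
  | zero => simp [zero_tmul, tmul_zero]
  | add x y hx hy =>
    rw [map_add, hx, hy]
    simp only [map_add, tmul_add, add_tmul, add_smul]
    abel
  | tmul a b =>
    rw [augProj₂, tensorMap_tmul, augProj_apply, augProj_apply, contractLeft_tmul,
      contractRight_tmul, sub_tmul, tmul_sub, tmul_sub, smul_tmul, smul_tmul, tmul_smul, tmul_smul,
      tmul_smul, smul_tmul, map_smul, smul_eq_mul, mul_smul, one_eq_tmul]
    abel

theorem contractLeft_augProj₂ (h1 : X.counit 1 = 1) (x : X.alg.tensor X.alg) :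
    contractLeft X.counit (X.augProj₂ x) = 0 := by
  rw [augProj₂, contractLeft_tensorMap (e := 0) _ (fun x => by rw [counit_augProj h1]; rfl)]
  induction x using tensor_induction' with
  | zero => simp
  | add x y hx hy => rw [map_add, map_add, hx, hy, add_zero]
  | tmul a b => rw [contractLeft_tmul, LinearMap.zero_apply, zero_smul, map_zero]

theorem contractRight_augProj₂ (h1 : X.counit 1 = 1) (x : X.alg.tensor X.alg) :
    contractRight X.counit (X.augProj₂ x) = 0 := by
  rw [augProj₂, contractRight_tensorMap (e := 0) _ (fun x => by rw [counit_augProj h1]; rfl)]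
  induction x using tensor_induction' with
  | zero => simp
  | add x y hx hy => rw [map_add, map_add, hx, hy, add_zero]
  | tmul a b => rw [contractRight_tmul, LinearMap.zero_apply, zero_smul, map_zero]

/-- Adding such an element to a counital coproduct leaves both counit laws intact. Perturbations of
Δ are therefore sought in the image of this projection. -/
theorem augProj₂_eq_self_iff (h1 : X.counit 1 = 1) {x : X.alg.tensor X.alg} :
    X.augProj₂ x = x ↔ contractLeft X.counit x = 0 ∧ contractRight X.counit x = 0 := by
  constructor
  · intro h
    rw [← h]
    exact ⟨contractLeft_augProj₂ h1 x, contractRight_augProj₂ h1 x⟩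
  · rintro ⟨hl, hr⟩
    rw [augProj₂_eq, hl, hr, tmul_zero, zero_tmul, map_zero, zero_smul, sub_zero, sub_zero, add_zero]

theorem tensorD_tensorMap {A B : GrAlg R} {dA : A →ₗ[R] A} {dB : B →ₗ[R] B} {f : A →ₗ[R] A}
    {g : B →ₗ[R] B} (hf : HasDegree 0 f) (hfd : ∀ x, f (dA x) = dA (f x))
    (hgd : ∀ x, g (dB x) = dB (g x)) (x : A.tensor B) :
    tensorMap f g (tensorD dA dB x) = tensorD dA dB (tensorMap f g x) := by
  induction x using tensor_induction' with
  | zero => simp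
  | add x y hx hy => simp only [map_add, hx, hy]
  | tmul a b => simp only [tensorD_tmul, map_add, tensorMap_tmul, hfd, hgd, hf.sign₀]

theorem IsAugmented.isIdealProj₂ (h : X.IsAugmented) : IsIdealProj X.d₂ X.augProj₂ where
  degree := hasDegree_tensorMap (hasDegree_augProj h.counit_degree)
    (hasDegree_augProj h.counit_degree) (add_zero 0)
  map_d := tensorD_tensorMap h.isIdealProj.degree h.isIdealProj.map_d h.isIdealProj.map_d
  idem x := (augProj₂_eq_self_iff h.counit_one).2
    ⟨contractLeft_augProj₂ h.counit_one x, contractRight_augProj₂ h.counit_one x⟩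
  mul_left x y hy := by
    rw [augProj₂_eq_self_iff h.counit_one] at hy ⊢
    rw [contractLeft_mul h.counit_degree h.counit_mul,
      contractRight_mul h.counit_degree h.counit_mul, hy.1, hy.2, mul_zero, mul_zero]
    exact ⟨rfl, rfl⟩
  mul_right x y hy := by
    rw [augProj₂_eq_self_iff h.counit_one] at hy ⊢
    rw [contractLeft_mul h.counit_degree h.counit_mul,
      contractRight_mul h.counit_degree h.counit_mul, hy.1, hy.2, zero_mul, zero_mul]
    exact ⟨rfl, rfl⟩

theorem augProj_map {Y : CoDGA R} {f : X.alg →ₗ[R] Y.alg} (h1 : f 1 = 1)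
    (hf : ∀ x, Y.counit (f x) = X.counit x) (x : X.alg) : f (X.augProj x) = Y.augProj (f x) := by
  rw [augProj_apply, augProj_apply, map_sub, map_smul, h1, hf]

theorem augProj₂_map {Y : CoDGA R} {f : X.alg →ₗ[R] Y.alg} (h1 : f 1 = 1)
    (hf : ∀ x, Y.counit (f x) = X.counit x) (x : X.alg.tensor X.alg) :
    tensorMap f f (X.augProj₂ x) = Y.augProj₂ (tensorMap f f x) := by
  induction x using tensor_induction' with
  | zero => simp
  | add x y hx hy => simp only [map_add, hx, hy]
  | tmul a b => simp only [augProj₂, tensorMap_tmul, augProj_map h1 hf]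

end CoDGA

/-! ### Exactness properties of a Hopf resolution -/

namespace HopfResolution

variable {R : Type u} [CommRing R] {H : CoDGA R} (K : HopfResolution H)

theorem d_resDeg (q : ℕ) {x : K.RH.alg} (hx : x ∈ K.V.resDeg (q + 1)) :
    K.RH.d x ∈ K.V.resDeg q := by
  have : K.V.resDeg (q + 1) ≤ (K.V.resDeg q).comap K.RH.d :=
    iSup_le fun m x hx => Submodule.mem_iSup_of_mem m (K.d_succ q m x hx)
  exact this hx

theorem d_resFilt (q : ℕ) {x : K.RH.alg} (hx : x ∈ K.V.resDeg q) :
    K.RH.d x ∈ K.V.resFilt ((q : ℤ) - 1) := by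
  rcases q with _ | q
  · rw [K.d_zero x hx]; exact zero_mem _
  · exact K.V.resDeg_le_resFilt (by push_cast; omega) (K.d_resDeg q hx)

theorem qIso_ρ : QIso K.RH.d H.d K.ρ := K.ρ_homologyIso.qIso

/-- Since ρ kills positive resolution degree, such a cycle has trivial image in H, and ρ is
injective in homology. -/
theorem exact_resDeg (q : ℕ) {x : K.RH.alg} (hx : x ∈ K.V.resDeg (q + 1)) (hd : K.RH.d x = 0) :
    ∃ y, K.RH.d y = x := by
  obtain ⟨y, -, hy, -⟩ := K.qIso_ρ x 0 hd (by rw [map_zero, K.ρ_res _ (Nat.succ_pos q) x hx])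
  exact ⟨y, hy⟩

theorem rankDeg_d_zero {x : K.RH.alg} (hx : x ∈ rankDeg K.V.basis K.V.wres 0) : K.RH.d x = 0 :=
  K.d_zero x (by rwa [K.V.resDeg_eq])

theorem rankDeg_d_succ (q : ℕ) {x : K.RH.alg} (hx : x ∈ rankDeg K.V.basis K.V.wres (q + 1)) :
    K.RH.d x ∈ rankDeg K.V.basis K.V.wres q := by
  rw [← K.V.resDeg_eq] at hx ⊢
  exact K.d_resDeg q hx

/-- As d is homogeneous, a primitive may be replaced by its component of the expected resolution
degree. -/
theorem exact_resDeg' (q : ℕ) {x : K.RH.alg} (hx : x ∈ K.V.resDeg (q + 1)) (hd : K.RH.d x = 0) :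
    ∃ y ∈ K.V.resDeg (q + 2), K.RH.d y = x := by
  obtain ⟨y, hy⟩ := K.exact_resDeg q hx hd
  refine ⟨rankProj K.V.basis K.V.wres (q + 2) y, ?_, ?_⟩
  · rw [K.V.resDeg_eq]; exact rankProj_mem _ _
  · rw [← rankProj_comm (fun x hx => K.rankDeg_d_zero hx) (fun q x hx => K.rankDeg_d_succ q hx), hy]
    rw [K.V.resDeg_eq] at hx
    exact rankProj_of_mem hx

theorem exact_resDeg_zero {x : K.RH.alg} (hx : x ∈ K.V.resDeg 0) (hρ : K.ρ x = 0) :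
    ∃ y ∈ K.V.resDeg 1, K.RH.d y = x := by
  obtain ⟨y, -, hy, -⟩ := K.qIso_ρ x 0 (K.d_zero x hx) (by rw [map_zero, hρ])
  refine ⟨rankProj K.V.basis K.V.wres 1 y, ?_, ?_⟩
  · rw [K.V.resDeg_eq]; exact rankProj_mem _ _
  · rw [← rankProj_comm (fun x hx => K.rankDeg_d_zero hx) (fun q x hx => K.rankDeg_d_succ q hx), hy]
    rw [K.V.resDeg_eq] at hx
    exact rankProj_of_mem hx

theorem ρ_rankProj (x : K.RH.alg) : K.ρ (rankProj K.V.basis K.V.wres 0 x) = K.ρ x := by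
  have := K.V.mem_of_words
    (LinearMap.eqLocus (K.ρ ∘ₗ rankProj K.V.basis K.V.wres 0) K.ρ) (fun l => by
      rw [LinearMap.mem_eqLocus, LinearMap.comp_apply, ← K.V.basis_apply, rankProj_basis]
      split_ifs with h
      · rfl
      · rw [map_zero, K.V.basis_apply, K.ρ_res _ (Nat.pos_of_ne_zero h) _ (K.V.word_mem_resDeg l)]) x
  exact this

theorem exists_ρ_eq (hH : H.d = 0) (c : H.alg) : ∃ w ∈ K.V.resDeg 0, K.ρ w = c := by
  obtain ⟨y, y', -, hy⟩ := K.qIso_ρ 0 c (map_zero _) (by rw [map_zero, hH, LinearMap.zero_apply])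
  refine ⟨rankProj K.V.basis K.V.wres 0 y, ?_, ?_⟩
  · rw [K.V.resDeg_eq]; exact rankProj_mem _ _
  · rw [hH, LinearMap.zero_apply, sub_eq_zero] at hy
    rw [ρ_rankProj, hy]

theorem counit_of_resDeg {q : ℕ} (hq : 0 < q) {x : K.RH.alg} (hx : x ∈ K.V.resDeg q) :
    K.RH.counit x = 0 := by
  rw [← K.ρ_counit, K.ρ_res q hq x hx, map_zero]

theorem d_basis (l : List K.V.X) :
    K.RH.d (K.V.basis l) ∈ rankFilt K.V.basis K.V.wres ((K.V.wres l : ℤ) - 1) := by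
  rw [K.V.basis_apply, ← K.V.resFilt_eq]
  exact K.d_resFilt _ (K.V.word_mem_resDeg l)

/-- One factor is changed at a time: ρ ⊗ 1 is handled by semifreeness of RH, and 1 ⊗ ρ by flatness
of H, which with zero differential is K-flat. -/
theorem qIso_ρ_tensor (hH : H.IsGradedHopf) (hflat : Module.Flat R H.alg) :
    QIso K.RH.d₂ H.d₂ (tensorMap K.ρ K.ρ) := by
  have h1 : QIso (tensorD K.RH.d K.RH.d) (tensorD H.d K.RH.d) (tensorMap K.ρ LinearMap.id) :=
    qIso_tensor_right K.d_basis K.isHah.isDGA K.isHah.isDGA hH.isDGA K.ρ_hom K.qIso_ρ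
  have hk : IsKFlat H.d := by rw [hH.d_eq_zero]; exact isKFlat_of_flat
  have h2 : QIso (tensorD H.d K.RH.d) (tensorD H.d H.d) (tensorMap LinearMap.id K.ρ) :=
    hk.qIso hH.isDGA K.isHah.isDGA hH.isDGA K.ρ_hom K.qIso_ρ
  have h3 : tensorMap K.ρ K.ρ = tensorMap LinearMap.id K.ρ ∘ₗ tensorMap K.ρ LinearMap.id :=
    tensor_ext fun a b => rfl
  rw [h3]
  exact QIso.comp h2 h1 (K.ρ_hom.tensor (isDGAHom_id _)).map_d
    ((isDGAHom_id _).tensor K.ρ_hom).map_d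

theorem ρ_tensorResDeg {q : ℕ} {x : K.RH.alg.tensor K.RH.alg}
    (hx : x ∈ K.V.tensorResDeg (q + 1)) : tensorMap K.ρ K.ρ x = 0 := by
  have : K.V.tensorResDeg (q + 1) ≤ LinearMap.ker (tensorMap K.ρ K.ρ) := by
    refine K.V.tensorResDeg_le_iff.2 fun l l' h => ?_
    rw [LinearMap.mem_ker, tensorMap_tmul]
    rcases Nat.eq_zero_or_pos (K.V.wres l) with h0 | h0
    · rw [K.ρ_res (K.V.wres l') (by omega) _ (K.V.word_mem_resDeg l'), tmul_zero]
    · rw [K.ρ_res _ h0 _ (K.V.word_mem_resDeg l), zero_tmul]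
  exact this hx

theorem d₂_tensorResDeg_zero {x : K.RH.alg.tensor K.RH.alg} (hx : x ∈ K.V.tensorResDeg 0) :
    K.RH.d₂ x = 0 := by
  have : K.V.tensorResDeg 0 ≤ LinearMap.ker K.RH.d₂ := by
    refine K.V.tensorResDeg_le_iff.2 fun l l' h => ?_
    have h1 := K.d_zero _ (show K.V.wres l = 0 by omega ▸ K.V.word_mem_resDeg l)
    have h2 := K.d_zero _ (show K.V.wres l' = 0 by omega ▸ K.V.word_mem_resDeg l')
    rw [LinearMap.mem_ker, tensorD_tmul, h1, h2, zero_tmul, tmul_zero, add_zero]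
  exact this hx

theorem d₂_tensorResDeg_succ (q : ℕ) {x : K.RH.alg.tensor K.RH.alg}
    (hx : x ∈ K.V.tensorResDeg (q + 1)) : K.RH.d₂ x ∈ K.V.tensorResDeg q := by
  have : K.V.tensorResDeg (q + 1) ≤ (K.V.tensorResDeg q).comap K.RH.d₂ := by
    refine K.V.tensorResDeg_le_iff.2 fun l l' h => ?_
    have key : ∀ i j, i + j = q + 1 → ∀ a ∈ K.V.resDeg i, ∀ b ∈ K.V.resDeg j,
        tmul (K.RH.d a) b ∈ K.V.tensorResDeg q := by
      intro i j hij a ha b hb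
      rcases i with _ | i
      · rw [K.d_zero a ha, zero_tmul]; exact zero_mem _
      · exact Submodule.subset_span ⟨i, j, _, _, by omega, K.d_resDeg i ha, hb, rfl⟩
    have key' : ∀ i j, i + j = q + 1 → ∀ a ∈ K.V.resDeg i, ∀ b ∈ K.V.resDeg j,
        tmul a (K.RH.d b) ∈ K.V.tensorResDeg q := by
      intro i j hij a ha b hb
      rcases j with _ | j
      · rw [K.d_zero b hb, tmul_zero]; exact zero_mem _
      · exact Submodule.subset_span ⟨i, j, _, _, by omega, ha, K.d_resDeg j hb, rfl⟩
    rw [Submodule.mem_comap, tensorD_tmul, sign_mem (K.V.word_mem_gr l), zsmul_tmul]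
    exact add_mem (key _ _ h _ (K.V.word_mem_resDeg l) _ (K.V.word_mem_resDeg l'))
      (zsmul_mem (key' _ _ h _ (K.V.word_mem_resDeg l) _ (K.V.word_mem_resDeg l')) _)
  exact this hx

/-! ### Perturbed differentials -/

variable {h : K.RH.alg →ₗ[R] K.RH.alg} 

theorem perturbed_resDeg (hres : ∀ q : ℕ, ∀ x ∈ K.V.resDeg q, h x ∈ K.V.resFilt (q - 2)) {q : ℕ}
    {x : K.RH.alg} (hx : x ∈ K.V.resDeg q) : (K.RH.d + h) x ∈ K.V.resFilt ((q : ℤ) - 1) :=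
  add_mem (K.d_resFilt q hx) (K.V.resFilt_mono (by omega) (hres q x hx))

theorem isResFilt (hdga : IsDGA (K.RH.d + h))
    (hres : ∀ q : ℕ, ∀ x ∈ K.V.resDeg q, h x ∈ K.V.resFilt (q - 2)) :
    IsResFilt (K.RH.d + h) K.V.resFilt where
  mono := K.V.resFilt_mono
  neg n hn := K.V.resFilt_neg hn
  one := K.V.one_mem_resFilt
  mul hx hy := K.V.resFilt_mul hx hy le_rfl
  comp hx n := K.V.comp_mem_resFilt hx n
  reduce {n} hn {y} hy := by
    rw [K.V.resFilt_eq] at hy ⊢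
    refine exists_sub_boundary_mem (fun x hx => K.rankDeg_d_zero hx)
      (fun q x hx => K.rankDeg_d_succ q hx) (fun q x hx => K.exact_resDeg q (by rwa [K.V.resDeg_eq]))
      (fun q x hx => ?_) hdga.sq hn hy
    rw [← K.V.resDeg_eq] at hx
    rw [LinearMap.add_apply, add_sub_cancel_left, ← K.V.resFilt_eq]
    exact hres q x hx

/-- The tensor square of ρ is a quasi-isomorphism vanishing in positive total resolution degree, so
RH ⊗ RH is exact there. The terms coming from h lower the filtration by two. -/
theorem isResFilt_tensor (hH : H.IsGradedHopf) (hflat : Module.Flat R H.alg)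
    (hdga : IsDGA (K.RH.d + h))
    (hres : ∀ q : ℕ, ∀ x ∈ K.V.resDeg q, h x ∈ K.V.resFilt (q - 2)) :
    IsResFilt (tensorD (K.RH.d + h) (K.RH.d + h)) K.V.tensorResFilt where
  mono := K.V.tensorResFilt_mono
  neg n hn := K.V.tensorResFilt_neg hn
  one := K.V.tmul_mem_tensorResFilt K.V.one_mem_resFilt K.V.one_mem_resFilt (by omega)
  mul hx hy := K.V.tensorResFilt_mul hx hy
  comp hx n := K.V.comp_mem_tensorResFilt hx n
  reduce {n} hn {y} hy := by
    rw [K.V.tensorResFilt_eq] at hy ⊢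
    refine exists_sub_boundary_mem (d := K.RH.d₂)
      (fun x hx => K.d₂_tensorResDeg_zero (by rwa [K.V.tensorResDeg_eq]))
      (fun q x hx => ?_) (fun q x hx hd => ?_)
      (fun q x hx => ?_) (isDGA_tensorD hdga hdga).sq hn hy
    · rw [← K.V.tensorResDeg_eq] at hx ⊢
      exact K.d₂_tensorResDeg_succ q hx
    · rw [← K.V.tensorResDeg_eq] at hx
      obtain ⟨y, -, hy, -⟩ := K.qIso_ρ_tensor hH hflat x 0 hd
        (by rw [map_zero, K.ρ_tensorResDeg hx])
      exact ⟨y, hy⟩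
    · rw [← K.V.tensorResDeg_eq] at hx
      rw [FreeGens.tensorD_sub, add_sub_cancel_left, ← K.V.tensorResFilt_eq, sub_eq_add_neg]
      refine K.V.tensorD_mem_tensorResFilt (fun q x hx => ?_)
        (K.V.tensorResDeg_le_tensorResFilt le_rfl hx)
      rw [← sub_eq_add_neg]
      exact hres q x hx

end HopfResolution

/-! ### Cycles and their homology classes. -/

namespace GrAlg

variable {R : Type u} [CommRing R] {A : GrAlg R} {d : A →ₗ[R] A}

theorem Represents.d_eq_zero {x : A} {c : Homology d} (h : Represents d x c) : d x = 0 :=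
  LinearMap.mem_ker.1 h.1

theorem Represents.exists_sub_eq {x y : A} {c : Homology d} (hx : Represents d x c)
    (hy : Represents d y c) : ∃ b, x - y = d b := by
  obtain ⟨hx, rfl⟩ := hx
  obtain ⟨hy, h⟩ := hy
  obtain ⟨b, hb⟩ := (Submodule.Quotient.eq _).1 h.symm
  exact ⟨b, hb.symm⟩

theorem represents_zero : Represents d (0 : A) 0 := ⟨zero_mem _, rfl⟩

theorem Represents.exists_eq {x : A} (hx : Represents d x 0) : ∃ b, x = d b := by
  obtain ⟨b, hb⟩ := hx.exists_sub_eq represents_zero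
  exact ⟨b, by rw [← hb, sub_zero]⟩

theorem exists_represents {x : A} (hx : d x = 0) : ∃ c, Represents d x c := ⟨_, hx, rfl⟩

theorem Represents.eq_zero_of_boundary {b : A} {c : Homology d} (h : Represents d (d b) c) :
    c = 0 := by
  obtain ⟨hx, rfl⟩ := h
  exact (Submodule.Quotient.mk_eq_zero _).2 ⟨b, rfl⟩

theorem Represents.add {x y : A} {a b : Homology d} (hx : Represents d x a)
    (hy : Represents d y b) : Represents d (x + y) (a + b) := by
  obtain ⟨hx, rfl⟩ := hx
  obtain ⟨hy, rfl⟩ := hy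
  exact ⟨add_mem hx hy, rfl⟩

theorem Represents.smul {x : A} {a : Homology d} (hx : Represents d x a) (r : R) :
    Represents d (r • x) (r • a) := by
  obtain ⟨hx, rfl⟩ := hx
  exact ⟨Submodule.smul_mem _ r hx, rfl⟩

end GrAlg

/-! ### The perturbed differential and the comparison map to A. -/

namespace HopfResolution

variable {R : Type u} [CommRing R] {H : CoDGA R} (K : HopfResolution H)

/-- Both ρ and the identification with homology are multiplicative, so the condition passes from
generators to words. -/
theorem represents_resDeg_zero {A : CoDGA R} {hA : A.IsHah} (i : H.HomologyIso A hA)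
    {k : K.RH.alg →ₐ[R] A.alg}
    (hk : ∀ v, K.V.res v = 0 → Represents A.d (k (K.V.gen v)) (i.toEquiv (K.ρ (K.V.gen v))))
    {x : K.RH.alg} (hx : x ∈ K.V.resDeg 0) : Represents A.d (k x) (i.toEquiv (K.ρ x)) := by
  let S : Submodule R K.RH.alg :=
    { carrier := {x | Represents A.d (k x) (i.toEquiv (K.ρ x))}
      zero_mem' := by
        change Represents A.d (k 0) (i.toEquiv (K.ρ 0))
        rw [map_zero, map_zero, map_zero]; exact represents_zero
      add_mem' := fun {x y} hx hy => by
        change Represents A.d (k (x + y)) (i.toEquiv (K.ρ (x + y)))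
        rw [map_add, map_add, map_add]; exact hx.add hy
      smul_mem' := fun r x hx => by
        change Represents A.d (k (r • x)) (i.toEquiv (K.ρ (r • x)))
        rw [map_smul, map_smul, map_smul]; exact hx.smul r }
  have : K.V.resDeg 0 ≤ S := by
    refine K.V.resDeg_le_iff.2 fun l hl => ?_
    change Represents A.d (k (K.V.word l)) (i.toEquiv (K.ρ (K.V.word l)))
    induction l with
    | nil => rw [FreeGens.word_nil, map_one, K.ρ_hom.map_one]; exact i.map_one
    | cons v l ih =>
      rw [FreeGens.wres_cons] at hl
      rw [FreeGens.word_cons, map_mul, K.ρ_hom.map_mul]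
      exact i.map_mul _ _ _ _ (hk v (by omega)) (ih (by omega))
  exact this hx

theorem exists_represents_resDeg_zero (hH : H.d = 0) {A : CoDGA R} {hA : A.IsHah}
    (i : H.HomologyIso A hA) {k : K.RH.alg →ₗ[R] A.alg}
    (hk : ∀ x ∈ K.V.resDeg 0, Represents A.d (k x) (i.toEquiv (K.ρ x))) {x : A.alg}
    (hx : A.d x = 0) : ∃ w ∈ K.V.resDeg 0, ∃ b, x - k w = A.d b := by
  obtain ⟨c, hc⟩ := exists_represents hx
  obtain ⟨w, hw, hwc⟩ := K.exists_ρ_eq hH (i.toEquiv.symm c)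
  have := hk w hw
  rw [hwc, LinearEquiv.apply_symm_apply] at this
  exact ⟨w, hw, hc.exists_sub_eq this⟩

variable {h : K.RH.alg →ₗ[R] K.RH.alg}

theorem perturbed_resFilt (hres : ∀ q : ℕ, ∀ x ∈ K.V.resDeg q, h x ∈ K.V.resFilt (q - 2)) {n : ℤ}
    {x : K.RH.alg} (hx : x ∈ K.V.resFilt n) : (K.RH.d + h) x ∈ K.V.resFilt (n - 1) := by
  rw [sub_eq_add_neg]
  refine K.V.map_mem_resFilt K.V.resFilt_mono (fun q x hx => ?_) hx
  rw [← sub_eq_add_neg]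
  exact K.perturbed_resDeg hres hx

theorem h_resDeg_zero (hres : ∀ q : ℕ, ∀ x ∈ K.V.resDeg q, h x ∈ K.V.resFilt (q - 2))
    {x : K.RH.alg} (hx : x ∈ K.V.resDeg 0) : (K.RH.d + h) x = 0 := by
  have := K.perturbed_resDeg hres hx
  rw [K.V.resFilt_neg (by norm_num)] at this
  exact (Submodule.mem_bot R).1 this

/-- Cycles of low filtration whose image in `A` is a boundary are boundaries. -/
theorem exists_primitive
    (hres : ∀ q : ℕ, ∀ x ∈ K.V.resDeg q, h x ∈ K.V.resFilt (q - 2)) {A : CoDGA R} {hA : A.IsHah}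
    (i : H.HomologyIso A hA) {k : K.RH.alg →ₗ[R] A.alg} {n : ℕ}
    (hsq : ∀ x ∈ K.V.resFilt ((n : ℤ) - 1), (K.RH.d + h) ((K.RH.d + h) x) = 0)
    (hkd : ∀ x ∈ K.V.resFilt ((n : ℤ) - 1), k ((K.RH.d + h) x) = A.d (k x))
    (hk : ∀ x ∈ K.V.resDeg 0, Represents A.d (k x) (i.toEquiv (K.ρ x))) :
    ∀ j : ℕ, j < n → ∀ z ∈ K.V.resFilt ((j : ℤ) - 1), (K.RH.d + h) z = 0 →
      (∃ c, k z = A.d c) → ∃ y ∈ K.V.resFilt j, (K.RH.d + h) y = z := by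
  intro j
  induction j with
  | zero =>
    intro _ z hz _ _
    rw [K.V.resFilt_neg (by norm_num), Submodule.mem_bot] at hz
    exact ⟨0, zero_mem _, by rw [hz, map_zero]⟩
  | succ j ih =>
    rintro hj z hz hδz ⟨c, hc⟩
    have hz1 : z ∈ rankFilt K.V.basis K.V.wres j := by
      rw [← K.V.resFilt_eq]; simpa using hz
    set t := rankProj K.V.basis K.V.wres j z with ht
    have htm : t ∈ K.V.resDeg j := by rw [K.V.resDeg_eq]; exact rankProj_mem _ _
    have hlow : z - t ∈ K.V.resFilt ((j : ℤ) - 1) := by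
      rw [K.V.resFilt_eq]; exact sub_rankProj_mem hz1
    -- In rank 0, k t is a boundary, so injectivity of the identification with homology gives ρ t =
    -- 0. In positive rank t is a d-cycle, because everything else in the equation for z lies in
    -- lower filtration. The resolution is exact in both cases.
    have hu : ∃ u ∈ K.V.resDeg (j + 1), K.RH.d u = t := by
      rcases j with _ | j
      · refine K.exact_resDeg_zero htm ?_
        have hzt : z = t := by
          rw [K.V.resFilt_neg (by norm_num), Submodule.mem_bot, sub_eq_zero] at hlow
          exact hlow
        have h1 := hk t htm
        rw [← hzt, hc] at h1
        have h2 := h1.eq_zero_of_boundary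
        rw [← hzt]
        exact (LinearEquiv.map_eq_zero_iff _).1 h2
      · refine K.exact_resDeg' j htm ?_
        have h1 : K.RH.d t ∈ rankFilt K.V.basis K.V.wres ((j : ℤ) - 1) := by
          have e : K.RH.d t = (K.RH.d + h) z - (K.RH.d + h) (z - t) - h t := by
            rw [map_sub]; simp
          rw [e, hδz, ← K.V.resFilt_eq]
          refine sub_mem (sub_mem (zero_mem _) ?_) ?_
          · exact K.V.resFilt_mono (by push_cast; omega) (K.perturbed_resFilt hres hlow)
          · exact K.V.resFilt_mono (by push_cast; omega) (hres _ t htm)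
        have h2 := K.d_resDeg j htm
        rw [K.V.resDeg_eq] at h2
        rw [← rankProj_of_mem h2]
        exact rankProj_of_mem_filt h1 (by omega)
    -- Subtracting the perturbed boundary of u removes the top component of z. The image in A
    -- remains a boundary, now of c - k u.
    obtain ⟨u, hum, hdu⟩ := hu
    have huF : u ∈ K.V.resFilt ((n : ℤ) - 1) := K.V.resDeg_le_resFilt (by push_cast; omega) hum
    obtain ⟨y, hy, hδy⟩ := ih (by omega) (z - (K.RH.d + h) u)
      (by
        have e : z - (K.RH.d + h) u = (z - t) - h u := by rw [LinearMap.add_apply, hdu]; abel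
        rw [e]
        exact sub_mem hlow (K.V.resFilt_mono (by push_cast; omega) (hres _ u hum)))
      (by rw [map_sub, hδz, hsq u huF, sub_zero])
      ⟨c - k u, by rw [map_sub, hc, hkd u huF, map_sub]⟩
    refine ⟨u + y, add_mem (K.V.resDeg_le_resFilt le_rfl hum)
      (K.V.resFilt_mono (by push_cast; omega) hy), by rw [map_add, hδy]; abel⟩

/-- Injectivity in homology is `exists_primitive`. Surjectivity holds because every class of A is
realized on resolution degree 0, where the perturbed differential vanishes. -/
theorem qIso_of_represents (hH : H.d = 0)
    (hres : ∀ q : ℕ, ∀ x ∈ K.V.resDeg q, h x ∈ K.V.resFilt (q - 2)) {A : CoDGA R} {hA : A.IsHah}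
    (i : H.HomologyIso A hA) {k : K.RH.alg →ₗ[R] A.alg}
    (hsq : ∀ x, (K.RH.d + h) ((K.RH.d + h) x) = 0)
    (hkd : ∀ x, k ((K.RH.d + h) x) = A.d (k x))
    (hk : ∀ x ∈ K.V.resDeg 0, Represents A.d (k x) (i.toEquiv (K.ρ x))) :
    QIso (K.RH.d + h) A.d k := by
  intro z z' hz hz'
  obtain ⟨N, hN⟩ := K.V.exists_mem_resFilt z
  obtain ⟨y, -, hy⟩ := K.exists_primitive hres i (n := N + 2) (fun x _ => hsq x)
    (fun x _ => hkd x) hk (N + 1) (by omega) z (by simpa using hN) hz ⟨z', hz'⟩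
  obtain ⟨w, hw, b, hb⟩ := K.exists_represents_resDeg_zero hH i hk (x := k y - z')
    (by rw [map_sub, ← hkd, hy, hz', sub_self])
  refine ⟨y - w, b, by rw [map_sub, hy, K.h_resDeg_zero hres hw, sub_zero], ?_⟩
  rw [map_sub, ← hb]; abel

/-- The multiplicative part of the construction of a model: a perturbed differential on `RH` and a
quasi-isomorphism of augmented dga's to `A`. -/
theorem exists_perturbed_differential (hH : H.d = 0) {A : CoDGA R} {hA : A.IsHah}
    (i : H.HomologyIso A hA) :
    ∃ (h : K.RH.alg →ₗ[R] K.RH.alg) (k : K.RH.alg →ₗ[R] A.alg), IsDerivation h ∧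
      (∀ q : ℕ, ∀ x ∈ K.V.resDeg q, h x ∈ K.V.resFilt (q - 2)) ∧ IsDGA (K.RH.d + h) ∧
      (∀ x, K.RH.counit (h x) = 0) ∧ IsDGAHom (K.RH.d + h) A.d k ∧
      (∀ x, A.counit (k x) = K.RH.counit x) ∧
      ∀ x ∈ K.V.resDeg 0, Represents A.d (k x) (i.toEquiv (K.ρ x)) := by
  have haug := K.isHah.toIsCounital.isAugmented
  have hAaug := hA.toIsCounital.isAugmented
  let V := K.V
  let CH : V.X → Submodule R K.RH.alg := fun v =>
    K.RH.alg.gr (V.deg v + -1) ⊓ V.resFilt (V.res v - 2) ⊓ LinearMap.ker K.RH.counit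
  let CK : V.X → Type u := fun v =>
    {a : A.alg // a ∈ A.alg.gr (V.deg v) ∧ A.counit a = K.RH.counit (V.gen v)}
  have hCK : ∀ v, Nonempty (CK v) := fun v => by
    -- A default value with the right augmentation. It has the right degree because ε vanishes
    -- outside degree 0.
    refine ⟨⟨K.RH.counit (V.gen v) • 1, ?_, by rw [map_smul, hAaug.counit_one]; simp⟩⟩
    by_cases hv : V.deg v = 0
    · rw [hv]; exact Submodule.smul_mem _ _ one_mem_gr
    · rw [haug.counit_degree _ hv _ (V.gen_mem_gr v), zero_smul]; exact zero_mem _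
  let Y : V.X → Type u := fun v => CH v × CK v
  have : ∀ v, Nonempty (Y v) := fun v => ⟨(0, (hCK v).some)⟩
  let Val : (∀ v, Y v) → (K.RH.alg →ₗ[R] K.RH.alg) → (K.RH.alg →ₐ[R] A.alg) → Prop := fun a h k =>
    (∀ x y, h (x * y) = (LinearMap.id : K.RH.alg →ₗ[R] K.RH.alg) (K.RH.alg.sign x) * h y
      + h x * (LinearMap.id : K.RH.alg →ₗ[R] K.RH.alg) y) ∧
    (∀ v, h (V.gen v) = (a v).1) ∧ ∀ v, k (V.gen v) = (a v).2.1
  have hex : ∀ a, ∃ h k, Val a h k := by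
    intro a
    obtain ⟨h, h1, h2⟩ := V.exists_derivation (f := LinearMap.id) (g := LinearMap.id) rfl
      (fun _ _ => rfl) rfl (fun _ _ => rfl) (fun v => ((a v).1 : K.RH.alg))
    exact ⟨h, V.lift fun v => (a v).2.1, h1, h2, V.lift_gen _⟩
  have hagree : ∀ a b (n : ℕ), (∀ x, V.res x < n → a x = b x) → ∀ h k h' k', Val a h k →
      Val b h' k' → ∀ x ∈ V.resFilt ((n : ℤ) - 1), h x = h' x ∧ k x = k' x := by
    intro a b n hab h k h' k' H1 H2 x hx
    exact ⟨V.derivation_agree rfl rfl H1.1 H2.1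
        (fun v hv => by rw [H1.2.1, H2.2.1, hab v hv]) hx,
      V.algHom_agree (fun v hv => by rw [H1.2.2, H2.2.2, hab v hv]) hx⟩
  have hder : ∀ {a h k}, Val a h k → IsDerivation h := fun {a h k} H1 =>
    ⟨V.derivation_degree rfl rfl hasDegree_id hasDegree_id H1.1
      (fun v => by rw [H1.2.1]; exact (a v).1.2.1.1), fun x y => by
        rw [H1.1, add_comm]; rfl⟩
  have hh1 : ∀ {a h k}, Val a h k → h 1 = 0 := fun {a h k} H1 =>
    eq_zero_of_rule_one rfl rfl H1.1
  have hres : ∀ {a h k}, Val a h k → ∀ q : ℕ, ∀ x ∈ V.resDeg q, h x ∈ V.resFilt (q - 2) := by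
    intro a h k H1 q x hx
    have : V.resDeg q ≤ (V.resFilt ((q : ℤ) - 2)).comap h := by
      refine V.resDeg_le_iff.2 fun l hl => ?_
      subst hl
      rw [Submodule.mem_comap]
      clear hx
      induction l with
      | nil => rw [FreeGens.word_nil, hh1 H1]; exact zero_mem _
      | cons v l ih =>
        rw [FreeGens.word_cons, FreeGens.wres_cons, H1.1, LinearMap.id_apply, LinearMap.id_apply,
          sign_mem (V.gen_mem_gr v), H1.2.1]
        exact add_mem (V.resFilt_mul (zsmul_mem (V.resDeg_le_resFilt le_rfl (V.gen_mem_resDeg v)) _)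
          ih (by push_cast; omega)) (V.resFilt_mul (a v).1.2.1.2 (V.word_mem_resFilt l)
          (by push_cast; omega))
    exact this hx
  have hε : ∀ {a h k}, Val a h k → ∀ x, K.RH.counit (h x) = 0 := by
    intro a h k H1 x
    refine V.mem_of_gen_mul (LinearMap.ker (K.RH.counit ∘ₗ h)) ?_ (fun v y hy => ?_) x
    · rw [LinearMap.mem_ker, LinearMap.comp_apply, hh1 H1, map_zero]
    · rw [LinearMap.mem_ker, LinearMap.comp_apply] at hy ⊢
      have : K.RH.counit (a v).1 = 0 := (a v).1.2.2
      rw [H1.1, map_add, haug.counit_mul, haug.counit_mul, hy, H1.2.1, this, mul_zero, zero_mul,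
        add_zero]
  have hkdeg : ∀ {a h k}, Val a h k → HasDegree 0 k.toLinearMap := fun {a h k} H1 =>
    V.hasDegree_algHom fun v => by rw [H1.2.2]; exact (a v).2.2.1
  have hkε : ∀ {a h k}, Val a h k → ∀ x, A.counit (k x) = K.RH.counit x := by
    intro a h k H1 x
    refine V.mem_of_gen_mul (LinearMap.eqLocus (A.counit ∘ₗ k.toLinearMap) K.RH.counit)
      ?_ (fun v y hy => ?_) x
    · rw [LinearMap.mem_eqLocus, LinearMap.comp_apply, AlgHom.toLinearMap_apply, map_one,
        hAaug.counit_one, haug.counit_one]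
    · rw [LinearMap.mem_eqLocus, LinearMap.comp_apply, AlgHom.toLinearMap_apply] at hy ⊢
      rw [map_mul, hAaug.counit_mul, haug.counit_mul, hy, H1.2.2, (a v).2.2.2]
  let E : (K.RH.alg →ₗ[R] K.RH.alg) → (K.RH.alg →ₐ[R] A.alg) → K.RH.alg → Prop := fun h k x =>
    (K.RH.d + h) ((K.RH.d + h) x) = 0 ∧ k ((K.RH.d + h) x) = A.d (k x)
  have hδder : ∀ {a h k}, Val a h k → IsDerivation (K.RH.d + h) := fun {a h k} H1 =>
    ⟨K.isHah.isDGA.degree.add (hder H1).degree, fun x y => by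
      simp only [LinearMap.add_apply, K.isHah.isDGA.leibniz, (hder H1).leibniz]
      noncomm_ring⟩
  have hE : ∀ {a h k}, Val a h k → ∀ n : ℕ, (∀ v, V.res v < n → E h k (V.gen v)) →
      ∀ x ∈ V.resFilt ((n : ℤ) - 1), E h k x := by
    intro a h k H1 n hn x hx
    have hδ := hδder H1
    have hmem : ∀ x, x ∈ LinearMap.ker ((K.RH.d + h) ∘ₗ (K.RH.d + h)) ⊓
        LinearMap.eqLocus (k.toLinearMap ∘ₗ (K.RH.d + h)) (A.d ∘ₗ k.toLinearMap) ↔ E h k x :=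
      fun x => Iff.rfl
    have := V.resFilt_le_of_gen_mul (n := n) (LinearMap.ker ((K.RH.d + h) ∘ₗ (K.RH.d + h)) ⊓
        LinearMap.eqLocus (k.toLinearMap ∘ₗ (K.RH.d + h)) (A.d ∘ₗ k.toLinearMap))
      (by
        rw [hmem]
        change _ = _ ∧ _ = _
        rw [map_one_d hδ, map_zero, map_zero, map_one, map_one_d hA.isDGA.toIsDerivation]
        exact ⟨rfl, rfl⟩)
      (fun v hv y _ hy => by
        rw [hmem] at hy ⊢
        obtain ⟨v1, v2⟩ := hn v hv
        obtain ⟨y1, y2⟩ := hy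
        constructor
        · rw [hδ.leibniz, map_add, hδ.leibniz, hδ.leibniz, v1, y1, d_sign hδ.degree]
          noncomm_ring
        · have := (hkdeg H1).sign₀ (V.gen v)
          simp only [AlgHom.toLinearMap_apply] at this
          rw [hδ.leibniz, map_add, map_mul, map_mul, map_mul, hA.isDGA.leibniz, v2, y2, this])
    exact (hmem x).1 (this hx)
  obtain ⟨a, ha⟩ := exists_of_rank_local (Y := Y) V.res
    -- The class condition in resolution degree 0 is carried along, since it is what allows the
    -- obstructions in higher degree to be removed.
    (fun a v => ∀ h k, Val a h k → E h k (V.gen v) ∧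
      (V.res v = 0 → Represents A.d (k (V.gen v)) (i.toEquiv (K.ρ (V.gen v)))))
    (by
      intro a b v hab habv ha h' k' H2
      obtain ⟨h, k, H1⟩ := hex a
      obtain ⟨⟨e1, e2⟩, e3⟩ := ha h k H1
      have agree := hagree a b (V.res v) hab h k h' k' H1 H2
      have k3 : h (V.gen v) = h' (V.gen v) := by rw [H1.2.1, H2.2.1, habv]
      have k4 : k (V.gen v) = k' (V.gen v) := by rw [H1.2.2, H2.2.2, habv]
      have k5 : (K.RH.d + h') (V.gen v) = (K.RH.d + h) (V.gen v) := by
        rw [LinearMap.add_apply, LinearMap.add_apply, k3]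
      have hm : (K.RH.d + h) (V.gen v) ∈ V.resFilt ((V.res v : ℤ) - 1) :=
        K.perturbed_resDeg (hres H1) (V.gen_mem_resDeg v)
      obtain ⟨k1, k2⟩ := agree _ hm
      refine ⟨⟨?_, ?_⟩, fun h0 => ?_⟩
      · rw [k5, LinearMap.add_apply, ← k1]; exact e1
      · rw [k5, ← k2, ← k4]; exact e2
      · rw [← k4]; exact e3 h0)
    (by
      classical
      intro a v ha
      obtain ⟨h, k, H1⟩ := hex a
      have hrec : ∀ (y : Y v), ∃ b : ∀ x, Y x, (∀ x, V.res x < V.res v → b x = a x) ∧ b v = y :=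
        fun y => ⟨Function.update a v y, fun x hx =>
          Function.update_of_ne (by rintro rfl; exact lt_irrefl _ hx) _ _, Function.update_self ..⟩
      rcases Nat.eq_zero_or_pos (V.res v) with h0 | hpos
      · have hρ := K.ρ_hom.degree _ _ (V.gen_mem_gr v)
        rw [add_zero] at hρ
        obtain ⟨x, hx, hxr⟩ := i.degree _ _ hρ
        obtain ⟨b, hb1, hb2⟩ := hrec (0, ⟨x, hx, by rw [i.map_counit _ _ hxr, K.ρ_counit]⟩)
        refine ⟨b, hb1, fun h' k' H2 => ?_⟩
        have hkv : k' (V.gen v) = x := by rw [H2.2.2, hb2]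
        have hδ0 : (K.RH.d + h') (V.gen v) = 0 :=
          K.h_resDeg_zero (hres H2) (h0 ▸ V.gen_mem_resDeg v)
        refine ⟨⟨by rw [hδ0, map_zero], ?_⟩, fun _ => by rw [hkv]; exact hxr⟩
        rw [hδ0, map_zero, hkv, hxr.d_eq_zero]
      · have hlow := hE H1 (V.res v) (fun x hx => (ha x hx h k H1).1)
        have hrep : ∀ x ∈ V.resDeg 0, Represents A.d (k x) (i.toEquiv (K.ρ x)) := fun x hx =>
          K.represents_resDeg_zero i (fun w hw => (ha w (by
              have : V.res w = 0 := hw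
              omega) h k H1).2 hw) hx
        have hδ := hδder H1
        obtain ⟨n, hn⟩ : ∃ n, V.res v = n + 1 := ⟨V.res v - 1, by omega⟩
        have hdv : K.RH.d (V.gen v) ∈ V.resDeg n := K.d_resDeg n (hn ▸ V.gen_mem_resDeg v)
        have hdvF : K.RH.d (V.gen v) ∈ V.resFilt ((V.res v : ℤ) - 1) :=
          V.resDeg_le_resFilt (by omega) hdv
        -- The element e is what must be subtracted from dv to obtain a perturbed cycle with
        -- bounding image in A. On v, h will be -e, and k a chain bounding that image.
        have hcorr : ∃ e ∈ V.resFilt ((V.res v : ℤ) - 2),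
            (K.RH.d + h) e = (K.RH.d + h) (K.RH.d (V.gen v)) ∧
            ∃ b, k (K.RH.d (V.gen v) - e) = A.d b := by
          rcases n with _ | n
          -- In resolution degree 1 there is no room for a correction, and none is needed: ρ(dv) =
          -- 0, so k(dv) bounds.
          · refine ⟨0, zero_mem _, by rw [map_zero, K.h_resDeg_zero (hres H1) hdv], ?_⟩
            have := hrep _ hdv
            rw [K.ρ_hom.map_d, hH, LinearMap.zero_apply, map_zero] at this
            rw [sub_zero]
            exact this.exists_eq
          · have hz : (K.RH.d + h) (K.RH.d (V.gen v)) ∈ V.resFilt ((n : ℤ) - 1) := by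
              rw [LinearMap.add_apply, K.isHah.isDGA.sq, zero_add]
              exact V.resFilt_mono (by push_cast; omega) (hres H1 _ _ hdv)
            obtain ⟨y, hy, hδy⟩ := K.exists_primitive (hres H1) i (k := k.toLinearMap)
              (n := V.res v) (fun x hx => (hlow x hx).1) (fun x hx => (hlow x hx).2) hrep n
              (by omega) _ hz (hlow _ hdvF).1 ⟨_, (hlow _ hdvF).2⟩
            have hyF : y ∈ V.resFilt ((V.res v : ℤ) - 1) := V.resFilt_mono (by omega) hy
            -- After correction by y the image in A is a cycle, possibly not a boundary. Its class
            -- is realized by w in resolution degree 0, which has zero perturbed differential and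
            -- hence may be subtracted too.
            obtain ⟨w, hw, b, hb⟩ := K.exists_represents_resDeg_zero hH i (k := k.toLinearMap) hrep
              (x := k (K.RH.d (V.gen v) - y))
              (by rw [← (hlow _ (sub_mem hdvF hyF)).2, map_sub, hδy, sub_self, map_zero])
            refine ⟨y + w, add_mem (V.resFilt_mono (by omega) hy)
              (V.resDeg_le_resFilt (by push_cast; omega) hw), ?_, b, ?_⟩
            · rw [map_add, hδy, K.h_resDeg_zero (hres H1) hw, add_zero]
            · rw [← hb, AlgHom.toLinearMap_apply, ← map_sub, sub_sub]
        obtain ⟨e, he, hδe, b, hb⟩ := hcorr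
        have hdvdeg := K.isHah.isDGA.degree _ _ (V.gen_mem_gr v)
        set e' := K.RH.alg.comp (V.deg v + -1) e with he'
        -- Since ε vanishes on boundaries, projecting to the augmentation ideal does not change the
        -- boundary of b. It gives k(v) augmentation 0, as required in positive resolution degree.
        set b' := A.augProj (A.alg.comp (V.deg v) b) with hb'
        have heF : e' ∈ V.resFilt ((V.res v : ℤ) - 2) := V.comp_mem_resFilt he _
        have hδe' : (K.RH.d + h) (K.RH.d (V.gen v) - e') = 0 := by
          rw [map_sub, he', hδ.degree.comp_eq, hδe, comp_of_mem (hδ.degree _ _ hdvdeg), sub_self]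
        have hAb : A.d (A.alg.comp (V.deg v) b) = k (K.RH.d (V.gen v) - e') := by
          have h1 := (hkdeg H1).comp_eq (V.deg v + -1) (K.RH.d (V.gen v) - e)
          rw [AlgHom.toLinearMap_apply, AlgHom.toLinearMap_apply, map_sub, comp_of_mem hdvdeg,
            add_zero, hb] at h1
          rw [hA.isDGA.degree.comp_eq, ← h1]
        have hAb' : A.d b' = k (K.RH.d (V.gen v) - e') := by
          rw [hb', ← hAaug.isIdealProj.map_d, (CoDGA.augProj_eq_self_iff hAaug.counit_one).2
            (hAaug.counit_d _), hAb]
        have heε : K.RH.counit e' = 0 := by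
          have := hkε H1 (K.RH.d (V.gen v) - e')
          rw [← hAb', hAaug.counit_d, map_sub, haug.counit_d, zero_sub] at this
          exact neg_eq_zero.1 this.symm
        obtain ⟨c, hc1, hc2⟩ := hrec (⟨-e', neg_mem ⟨⟨comp_mem_gr _ _, heF⟩, heε⟩⟩, ⟨b', by
            have := hAaug.isIdealProj.degree _ _ (comp_mem_gr (V.deg v) b)
            rwa [add_zero] at this, by
            rw [hb', CoDGA.counit_augProj hAaug.counit_one,
              K.counit_of_resDeg hpos (V.gen_mem_resDeg v)]⟩)
        refine ⟨c, hc1, fun h' k' H2 => ⟨?_, fun h0 => absurd h0 hpos.ne'⟩⟩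
        have hv1 : (K.RH.d + h') (V.gen v) = K.RH.d (V.gen v) - e' := by
          rw [LinearMap.add_apply, H2.2.1, hc2]; exact (sub_eq_add_neg _ _).symm
        have hv2 : k' (V.gen v) = b' := by rw [H2.2.2, hc2]
        obtain ⟨k1, k2⟩ := hagree a c (V.res v) (fun x hx => (hc1 x hx).symm) h k h' k' H1 H2
          (K.RH.d (V.gen v) - e') (sub_mem hdvF (V.resFilt_mono (by omega) heF))
        constructor
        · rw [hv1, LinearMap.add_apply, ← k1, ← LinearMap.add_apply, hδe']
        · rw [hv1, ← k2, hv2, hAb'])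
  obtain ⟨h, k, H1⟩ := hex a
  have hall : ∀ x, E h k x := by
    intro x
    obtain ⟨n, hn⟩ := V.exists_mem_resFilt x
    exact hE H1 (n + 1) (fun v _ => (ha v h k H1).1) x (by push_cast; simpa using hn)
  exact ⟨h, k.toLinearMap, hder H1, hres H1, { hδder H1 with sq := fun x => (hall x).1 }, hε H1,
    ⟨hkdeg H1, map_one k, map_mul k, fun x => (hall x).2⟩, hkε H1, fun x hx =>
      K.represents_resDeg_zero i (fun v hv => (ha v h k H1).2 hv) hx⟩

end HopfResolution

/-! ### Naturality of the tensor constructions, and inverses of dga maps. -/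

namespace GrAlg

variable {R : Type u} [CommRing R] {A B C D E F : GrAlg R}

theorem tensorMap_comp (f : A →ₗ[R] C) (g : B →ₗ[R] D) (f' : C →ₗ[R] E) (g' : D →ₗ[R] F) :
    tensorMap (f' ∘ₗ f) (g' ∘ₗ g) = tensorMap f' g' ∘ₗ tensorMap f g :=
  tensor_ext fun _ _ => rfl

theorem tensorMap_id : tensorMap (LinearMap.id : A →ₗ[R] A) (LinearMap.id : B →ₗ[R] B) =
    LinearMap.id :=
  tensor_ext fun _ _ => rfl

theorem swap_tensorMap {f : A →ₗ[R] C} {g : B →ₗ[R] D} (hf : HasDegree 0 f) (hg : HasDegree 0 g) :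
    swap C D ∘ₗ tensorMap f g = tensorMap g f ∘ₗ swap A B := by
  ext t
  simp only [LinearMap.comp_apply]
  induction t using tensor_induction with
  | zero => simp
  | add x y hx hy => simp only [map_add, hx, hy]
  | tmul i j a b ha hb =>
    have hfa := hf _ _ ha
    have hgb := hg _ _ hb
    rw [add_zero] at hfa hgb
    rw [tensorMap_tmul, swap_tmul hfa hgb, swap_tmul ha hb, map_zsmul, tensorMap_tmul]

theorem assoc_tensorMap {A' B' C' : GrAlg R} (f : A →ₗ[R] A') (g : B →ₗ[R] B') (h : C →ₗ[R] C') :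
    assoc A' B' C' ∘ₗ tensorMap (tensorMap f g) h
      = tensorMap f (tensorMap g h) ∘ₗ assoc A B C := by
  ext t
  simp only [LinearMap.comp_apply]
  induction t using tensor_assoc_induction with
  | zero => simp
  | add x y hx hy => simp only [map_add, hx, hy]
  | tmul i j k a b c => simp only [tensorMap_tmul, assoc_tmul]

theorem IsDGAHom.inverse {dA : A →ₗ[R] A} {dB : B →ₗ[R] B} {f : A →ₗ[R] B} {g : B →ₗ[R] A}
    (hf : IsDGAHom dA dB f) (hgf : ∀ x, g (f x) = x) (hfg : ∀ x, f (g x) = x) :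
    IsDGAHom dB dA g where
  degree n x hx := by
    have : g x = A.comp n (g x) := by
      rw [← hgf (A.comp n (g x)), hf.degree.comp_eq, hfg, add_zero, comp_of_mem hx]
    rw [this, add_zero]
    exact comp_mem_gr _ _
  map_one := by rw [← hgf 1, hf.map_one]
  map_mul x y := by rw [← hgf (g x * g y), hf.map_mul, hfg, hfg]
  map_d x := by rw [← hgf (dA (g x)), hf.map_d, hfg]

end GrAlg

/-! ### Unipotent maps, and tensor powers of a quasi-isomorphism. -/

namespace FreeGens

variable {R : Type u} [CommRing R] {T A : GrAlg R} (V : FreeGens T) {δ : T →ₗ[R] T}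
  {dA : A →ₗ[R] A}

/-- The filtration is exhaustive and vanishes in negative degrees, so p is the identity plus a
locally nilpotent map. -/
theorem bijective_of_lowering {p : T →ₗ[R] T}
    (hp : ∀ n : ℤ, ∀ x ∈ V.resFilt n, p x - x ∈ V.resFilt (n - 1)) : Function.Bijective p := by
  have hbot : ∀ x ∈ V.resFilt (-1), x = 0 := fun x hx => by
    rwa [V.resFilt_neg (by norm_num), Submodule.mem_bot] at hx
  constructor
  · rw [injective_iff_map_eq_zero]
    intro x hx
    have key : ∀ n : ℕ, x ∈ V.resFilt ((n : ℤ) - 1) → x = 0 := by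
      intro n
      induction n with
      | zero => intro h; exact hbot x (by simpa using h)
      | succ n ih =>
        intro h
        refine ih ?_
        have := hp _ x h
        rw [hx, zero_sub, neg_mem_iff] at this
        exact V.resFilt_mono (by push_cast; omega) this
    obtain ⟨n, hn⟩ := V.exists_mem_resFilt x
    exact key (n + 1) (by simpa using hn)
  · intro y
    have key : ∀ n : ℕ, ∀ y ∈ V.resFilt ((n : ℤ) - 1), ∃ x, p x = y := by
      intro n
      induction n with
      | zero => intro y h; exact ⟨0, by rw [map_zero, hbot y (by simpa using h)]⟩
      | succ n ih =>
        intro y h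
        obtain ⟨x, hx⟩ := ih (p y - y) (V.resFilt_mono (by push_cast; omega) (hp _ y h))
        exact ⟨y - x, by rw [map_sub, hx]; abel⟩
    obtain ⟨n, hn⟩ := V.exists_mem_resFilt y
    exact key (n + 1) y (by simpa using hn)

/-- The square factors as φ ⊗ 1 followed by 1 ⊗ φ. The first is a quasi-isomorphism because T is
semifree, the second because A is K-flat. -/
theorem qIso_tensor_square (hδ : IsDGA δ)
    (hδV : ∀ q : ℕ, ∀ x ∈ V.resDeg q, δ x ∈ V.resFilt (q - 1)) (hA : IsDGA dA)
    (hflat : IsKFlat dA) {φ : T →ₗ[R] A} (hφ : IsDGAHom δ dA φ) (hq : QIso δ dA φ) :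
    QIso (tensorD δ δ) (tensorD dA dA) (tensorMap φ φ) := by
  have h1 : QIso (tensorD δ δ) (tensorD dA δ) (tensorMap φ LinearMap.id) := by
    refine qIso_tensor_right (b := V.basis) (r := V.wres) (fun l => ?_) hδ hδ hA hφ hq
    rw [basis_apply, ← V.resFilt_eq]
    exact hδV _ _ (V.word_mem_resDeg l)
  have h2 : QIso (tensorD dA δ) (tensorD dA dA) (tensorMap LinearMap.id φ) :=
    hflat.qIso hA hδ hA hφ hq
  have := QIso.comp h2 h1 (hφ.tensor (isDGAHom_id δ)).map_d ((isDGAHom_id dA).tensor hφ).map_d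
  rwa [← tensorMap_comp, LinearMap.id_comp, LinearMap.comp_id] at this

theorem qIso_tensor_cube (hδ : IsDGA δ)
    (hδV : ∀ q : ℕ, ∀ x ∈ V.resDeg q, δ x ∈ V.resFilt (q - 1)) (hA : IsDGA dA)
    (hflat : IsKFlat dA) {φ : T →ₗ[R] A} (hφ : IsDGAHom δ dA φ) (hq : QIso δ dA φ) :
    QIso (tensorD δ (tensorD δ δ)) (tensorD dA (tensorD dA dA))
      (tensorMap φ (tensorMap φ φ)) := by
  have h1 : QIso (tensorD δ (tensorD δ δ)) (tensorD dA (tensorD δ δ))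
      (tensorMap φ LinearMap.id) := by
    refine qIso_tensor_right (b := V.tensorBasis) (r := V.twres) (fun l => ?_)
      (isDGA_tensorD hδ hδ) hδ hA hφ hq
    rw [V.tensorBasis_apply, ← V.tensorResFilt_eq, sub_eq_add_neg]
    refine V.tensorD_mem_tensorResFilt (fun q x hx => ?_) ?_
    · rw [← sub_eq_add_neg]; exact hδV q x hx
    · exact V.tmul_mem_tensorResFilt (V.word_mem_resFilt _) (V.word_mem_resFilt _)
        (by rw [twres]; push_cast; omega)
  have h2 : QIso (tensorD dA (tensorD δ δ)) (tensorD dA (tensorD dA dA))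
      (tensorMap LinearMap.id (tensorMap φ φ)) :=
    hflat.qIso hA (isDGA_tensorD hδ hδ) (isDGA_tensorD hA hA) (hφ.tensor hφ)
      (V.qIso_tensor_square hδ hδV hA hflat hφ hq)
  have := QIso.comp h2 h1 (hφ.tensor (isDGAHom_id _)).map_d
    ((isDGAHom_id dA).tensor (hφ.tensor hφ)).map_d
  rwa [← tensorMap_comp, LinearMap.id_comp, LinearMap.comp_id] at this

end FreeGens

/-! ### Transfer of coassociativity and cocommutativity up to homotopy. -/

namespace CoDGA

variable {R : Type u} [CommRing R] {X A : CoDGA R} (V : FreeGens X.alg) {k : X.alg →ₗ[R] A.alg}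

theorem augProj_mem_resFilt {n : ℤ} {x : X.alg} (hx : x ∈ V.resFilt n) :
    X.augProj x ∈ V.resFilt n := by
  rcases lt_or_ge n 0 with hn | hn
  · rw [V.resFilt_neg hn, Submodule.mem_bot] at hx
    rw [hx, map_zero]; exact zero_mem _
  · exact sub_mem hx (Submodule.smul_mem _ _ (V.resFilt_mono hn V.one_mem_resFilt))

theorem augProj₂_mem_tensorResFilt {n : ℤ} {x : X.alg.tensor X.alg} (hx : x ∈ V.tensorResFilt n) :
    X.augProj₂ x ∈ V.tensorResFilt n := by
  have : V.tensorResFilt n ≤ (V.tensorResFilt n).comap X.augProj₂ := by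
    refine V.tensorResFilt_le_iff.2 fun l l' h => ?_
    exact V.tmul_mem_tensorResFilt (augProj_mem_resFilt V (V.word_mem_resFilt l))
      (augProj_mem_resFilt V (V.word_mem_resFilt l')) h
  exact this hx

/-- Coassociativity and cocommutativity up to homotopy pass back along a quasi-isomorphism that is
comultiplicative up to homotopy. -/
theorem IsCounital.isHah (hX : X.IsCounital)
    (hδV : ∀ q : ℕ, ∀ x ∈ V.resDeg q, X.d x ∈ V.resFilt (q - 1)) (hA : A.IsHah)
    (hflat : IsKFlat A.d) (hk : IsDGAHom X.d A.d k) (hq : QIso X.d A.d k)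
    (hcomul : DerivationHomotopic X.d A.d₂ (tensorMap k k ∘ₗ X.comul) (A.comul ∘ₗ k)) :
    X.IsHah := by
  have hδ := hX.isDGA
  have hδg : ∀ v, X.d (V.gen v) ∈ V.resFilt ((V.res v : ℤ) - 1) := fun v =>
    hδV _ _ (V.gen_mem_resDeg v)
  have hX2 := isDGA_tensorD hδ hδ
  have hX3 := isDGA_tensorD hδ hX2
  have hA1 := hA.isDGA
  have hA2 := isDGA_tensorD hA1 hA1
  have hA3 := isDGA_tensorD hA1 hA2
  have hk2 := hk.tensor hk
  have hk3 := hk.tensor hk2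
  have hΔ := hX.comul_hom
  have hψ := hA.comul_hom
  have iX := isDGAHom_id X.d
  have iA := isDGAHom_id A.d
  have hXl : IsDGAHom X.d X.d₃ X.comulLeft := (isDGAHom_assoc _ _ _).comp ((hΔ.tensor iX).comp hΔ)
  have hXr : IsDGAHom X.d X.d₃ X.comulRight := (iX.tensor hΔ).comp hΔ
  have hAl : IsDGAHom A.d A.d₃ A.comulLeft := (isDGAHom_assoc _ _ _).comp ((hψ.tensor iA).comp hψ)
  have hAr : IsDGAHom A.d A.d₃ A.comulRight := (iA.tensor hψ).comp hψ
  have trans3 := @FreeGens.homotopic_trans R _ X.alg _ V X.d hδ A.d₃ hA3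
  -- Pushing k through the iterated coproduct uses `hcomul` twice: once inside the first tensor
  -- factor and once after applying ψ ⊗ 1.
  have hleft : DerivationHomotopic X.d A.d₃ (tensorMap k (tensorMap k k) ∘ₗ X.comulLeft)
      (A.comulLeft ∘ₗ k) := by
    have h1 := ((hcomul.tensor_left (hψ.comp hk).degree hk).precomp hΔ).postcomp
      (isDGAHom_assoc A.d A.d A.d)
    have h2 := (hcomul.postcomp (hψ.tensor iA)).postcomp (isDGAHom_assoc A.d A.d A.d)
    have e1 : assoc A.alg A.alg A.alg ∘ₗ tensorMap (tensorMap k k ∘ₗ X.comul) k ∘ₗ X.comul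
        = tensorMap k (tensorMap k k) ∘ₗ X.comulLeft := by
      have : tensorMap (tensorMap k k ∘ₗ X.comul) k
          = tensorMap (tensorMap k k) k ∘ₗ tensorMap X.comul LinearMap.id :=
        tensor_ext fun _ _ => rfl
      rw [this, comulLeft, ← LinearMap.comp_assoc, ← LinearMap.comp_assoc, assoc_tensorMap]
      rfl
    have e2 : tensorMap (A.comul ∘ₗ k) k
        = tensorMap A.comul LinearMap.id ∘ₗ tensorMap k k := tensor_ext fun _ _ => rfl
    rw [e1, e2] at h1
    exact trans3 (hk3.comp hXl)
      ((isDGAHom_assoc _ _ _).comp ((hψ.tensor iA).comp (hk2.comp hΔ))) (hAl.comp hk) h1 h2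
  have hright : DerivationHomotopic X.d A.d₃ (tensorMap k (tensorMap k k) ∘ₗ X.comulRight)
      (A.comulRight ∘ₗ k) := by
    have h1 := (hcomul.tensor_right (hk2.comp hΔ).degree hk hδ.degree).precomp hΔ
    have h2 := hcomul.postcomp (iA.tensor hψ)
    have e1 : tensorMap k (tensorMap k k ∘ₗ X.comul)
        = tensorMap k (tensorMap k k) ∘ₗ tensorMap LinearMap.id X.comul :=
      tensor_ext fun _ _ => rfl
    have e2 : tensorMap k (A.comul ∘ₗ k)
        = tensorMap LinearMap.id A.comul ∘ₗ tensorMap k k := tensor_ext fun _ _ => rfl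
    rw [e1, e2] at h1
    exact trans3 (hk3.comp hXr) ((iA.tensor hψ).comp (hk2.comp hΔ)) (hAr.comp hk) h1 h2
  have hTX := isDGAHom_swap hδ.degree hδ.degree
  have hTA := isDGAHom_swap hA1.degree hA1.degree
  have trans2 := @FreeGens.homotopic_trans R _ X.alg _ V X.d hδ A.d₂ hA2
  refine { hX with
    coassoc := V.homotopic_reflect hδ hδg hX3 hA3 hk3
      (V.qIso_tensor_cube hδ hδV hA1 hflat hk hq) hXl hXr ?_
    cocomm := V.homotopic_reflect hδ hδg hX2 hA2 hk2
      (V.qIso_tensor_square hδ hδV hA1 hflat hk hq) hΔ (hTX.comp hΔ) ?_ }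
  -- Pass to the left iterated coproduct of A by `hleft`, cross to the right one by coassociativity
  -- in A, and return by `hright` reversed.
  · exact trans3 (hk3.comp hXl) (hAr.comp hk) (hk3.comp hXr)
      (trans3 (hk3.comp hXl) (hAl.comp hk) (hAr.comp hk) hleft (hA.coassoc.precomp hk))
      (V.homotopic_symm hδ hδg hA3 (hk3.comp hXr) (hAr.comp hk) hright)
  · have h3 := V.homotopic_symm hδ hδg hA2 (hTA.comp (hk2.comp hΔ)) (hTA.comp (hψ.comp hk))
      (hcomul.postcomp hTA)
    have e : swap A.alg A.alg ∘ₗ tensorMap k k ∘ₗ X.comul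
        = tensorMap k k ∘ₗ swap X.alg X.alg ∘ₗ X.comul := by
      rw [← LinearMap.comp_assoc, swap_tensorMap hk.degree hk.degree]; rfl
    rw [e] at h3
    exact trans2 (hk2.comp hΔ) ((hTA.comp hψ).comp hk) (hk2.comp (hTX.comp hΔ))
      (trans2 (hk2.comp hΔ) (hψ.comp hk) ((hTA.comp hψ).comp hk) hcomul (hA.cocomm.precomp hk)) h3

end CoDGA

/-! ### Existence and uniqueness of the model. -/

namespace HopfResolution

variable {R : Type u} [CommRing R] {H : CoDGA R} (K : HopfResolution H)

theorem represents_tensorResDeg_zero {A : CoDGA R} {hA : A.IsHah} (i : H.HomologyIso A hA)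
    {k : K.RH.alg →ₗ[R] A.alg}
    (hk : ∀ x ∈ K.V.resDeg 0, Represents A.d (k x) (i.toEquiv (K.ρ x)))
    {t : K.RH.alg.tensor K.RH.alg} (ht : t ∈ K.V.tensorResDeg 0) :
    Represents A.d₂ (tensorMap k k t) (kunneth hA.isDGA
      (TensorProduct.map i.toEquiv.toLinearMap i.toEquiv.toLinearMap
        ((GradedTensorProduct.of R H.alg.gr H.alg.gr).symm (tensorMap K.ρ K.ρ t)))) := by
  let Φ : K.RH.alg.tensor K.RH.alg →ₗ[R] Homology A.d₂ := kunneth hA.isDGA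
    ∘ₗ TensorProduct.map i.toEquiv.toLinearMap i.toEquiv.toLinearMap
    ∘ₗ (GradedTensorProduct.of R H.alg.gr H.alg.gr).symm.toLinearMap ∘ₗ tensorMap K.ρ K.ρ
  change Represents A.d₂ (tensorMap k k t) (Φ t)
  induction ht using Submodule.span_induction with
  | zero => rw [map_zero, map_zero]; exact represents_zero
  | add x y _ _ hx hy => rw [map_add, map_add]; exact hx.add hy
  | smul r x _ hx => rw [map_smul, map_smul]; exact hx.smul r
  | mem x hx =>
    obtain ⟨p, q, a, b, hpq, ha, hb, rfl⟩ := hx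
    obtain ⟨rfl, rfl⟩ : p = 0 ∧ q = 0 := by omega
    exact kunneth_mk hA.isDGA (hk a ha) (hk b hb)

/-- Compatibility of the isomorphism with coproducts says that both terms represent the same class.
This starts the lifting of the coproduct in resolution degree 0. -/
theorem exists_comul_sub_eq {A : CoDGA R} {hA : A.IsHah} (i : H.HomologyIso A hA)
    {k : K.RH.alg →ₗ[R] A.alg}
    (hk : ∀ x ∈ K.V.resDeg 0, Represents A.d (k x) (i.toEquiv (K.ρ x))) {x : K.RH.alg}
    (hx : x ∈ K.V.resDeg 0) :
    ∃ y, tensorMap k k (K.RH.comul x) - A.comul (k x) = A.d₂ y := by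
  have h1 := K.represents_tensorResDeg_zero i hk (K.comul_res 0 x hx)
  rw [K.ρ_comul, ← i.map_comul] at h1
  refine h1.exists_sub_eq ?_
  obtain ⟨hc, h2⟩ := hk x hx
  rw [← h2]
  exact ⟨by rw [LinearMap.mem_ker, ← hA.comul_hom.map_d, LinearMap.mem_ker.1 hc, map_zero], rfl⟩

theorem exists_isModel (hH : H.IsGradedHopf) (hflat : Module.Flat R H.alg) {A : CoDGA R}
    {hA : A.IsHah} (hAflat : IsKFlat A.d) (i : H.HomologyIso A hA) :
    ∃ (h : K.RH.alg →ₗ[R] K.RH.alg) (ν : K.RH.alg →ₗ[R] K.RH.alg.tensor K.RH.alg)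
      (k : K.RH.alg →ₗ[R] A.alg), K.IsModel i h ν k := by
  obtain ⟨h, k, hder, hres, hdga, hεh, hk, hkε, hrep⟩ := K.exists_perturbed_differential hH.d_eq_zero i
  have hRH := K.isHah.toIsCounital
  have hεδ : ∀ x, K.RH.counit ((K.RH.d + h) x) = 0 := fun x => by
    rw [LinearMap.add_apply, map_add, hRH.counit_d, hεh, add_zero]
  have hX : (K.perturb h 0).IsAugmented :=
    ⟨hdga, hRH.counit_one, hRH.counit_mul, hRH.counit_degree, hεδ⟩
  have hδV : ∀ q : ℕ, ∀ x ∈ K.V.resDeg q, (K.RH.d + h) x ∈ K.V.resFilt (q - 1) :=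
    fun q x hx => K.perturbed_resDeg hres hx
  have hq : QIso (K.RH.d + h) A.d k :=
    K.qIso_of_represents hH.d_eq_zero hres i hdga.sq hk.map_d hrep
  -- Δ need not be a chain map for d + h, but the counit laws place its failure in the tensor square
  -- of the augmentation ideal.
  have hc : ∀ x : K.RH.alg,
      contractLeft K.RH.counit (tensorD (K.RH.d + h) (K.RH.d + h) (K.RH.comul x)
        - K.RH.comul ((K.RH.d + h) x)) = 0 ∧
      contractRight K.RH.counit (tensorD (K.RH.d + h) (K.RH.d + h) (K.RH.comul x)
        - K.RH.comul ((K.RH.d + h) x)) = 0 := fun x => by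
    rw [map_sub, map_sub, contractLeft_d hRH.counit_degree hεδ, contractRight_d hεδ,
      hRH.counit_left, hRH.counit_left, hRH.counit_right, hRH.counit_right, sub_self]
    exact ⟨rfl, rfl⟩
  obtain ⟨f, hf, hf1, hf2, hf3⟩ := K.V.exists_filtered_lift hdga
    (fun v => hδV _ _ (K.V.gen_mem_resDeg v)) (isDGA_tensorD hdga hdga)
    (K.isResFilt_tensor hH hflat hdga hres) (isDGA_tensorD hA.isDGA hA.isDGA) (hk.tensor hk)
    (K.V.qIso_tensor_square hdga hδV hA.isDGA hAflat hk hq) (f₀ := hRH.comul_hom.toAlgHom)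
    (fun v => by
      have := hRH.comul_hom.degree _ _ (K.V.gen_mem_gr v)
      rwa [add_zero] at this)
    (fun v => K.V.tensorResDeg_le_tensorResFilt le_rfl (K.comul_res _ _ (K.V.gen_mem_resDeg v)))
    (fun v => by
      have hv := K.V.gen_mem_resDeg v
      simp only [IsDGAHom.toAlgHom_apply]
      -- As Δ commutes with d, only the terms with h remain, and they lower the filtration by two.
      have e : tensorD (K.RH.d + h) (K.RH.d + h) (K.RH.comul (K.V.gen v))
          - K.RH.comul ((K.RH.d + h) (K.V.gen v))
          = tensorD h h (K.RH.comul (K.V.gen v)) - K.RH.comul (h (K.V.gen v)) := by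
        have := FreeGens.tensorD_sub (K.RH.d + h) K.RH.d (K.RH.comul (K.V.gen v))
        rw [add_sub_cancel_left] at this
        rw [← this, LinearMap.add_apply, map_add, hRH.comul_hom.map_d]
        abel
      rw [e]
      refine sub_mem ?_ ?_
      · rw [sub_eq_add_neg]
        refine K.V.tensorD_mem_tensorResFilt (fun q x hx => ?_)
          (K.V.tensorResDeg_le_tensorResFilt le_rfl (K.comul_res _ _ hv))
        rw [← sub_eq_add_neg]
        exact hres q x hx
      · have := K.V.map_mem_resFilt (f := K.RH.comul) K.V.tensorResFilt_mono (c := 0)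
          (fun q x hx => K.V.tensorResDeg_le_tensorResFilt (by omega) (K.comul_res q x hx))
          (hres _ _ hv)
        rwa [add_zero] at this)
    (hA.comul_hom.comp hk)
    (fun v hv => K.exists_comul_sub_eq i hrep (hv ▸ K.V.gen_mem_resDeg v))
    (π := (K.perturb h 0).augProj₂) hX.isIdealProj₂
    hA.toIsCounital.isAugmented.isIdealProj₂
    (fun n x hx => CoDGA.augProj₂_mem_tensorResFilt (X := K.perturb h 0) K.V hx)
    (CoDGA.augProj₂_map (X := K.perturb h 0) hk.map_one hkε)
    (fun v => (CoDGA.augProj₂_eq_self_iff (X := K.perturb h 0) hX.counit_one).2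
      (hc (K.V.gen v)))
    (fun v => (CoDGA.augProj₂_eq_self_iff hA.counit_one).2 (by
      simp only [IsDGAHom.toAlgHom_apply, map_sub, LinearMap.comp_apply]
      rw [contractLeft_tensorMap k hkε, contractRight_tensorMap k hkε, hRH.counit_left,
        hRH.counit_right, hA.counit_left, hA.counit_right, sub_self]
      exact ⟨rfl, rfl⟩))
  have hcomul : K.RH.comul + (f - K.RH.comul) = f := add_sub_cancel _ _
  have hf2' : ∀ x : K.RH.alg, contractLeft K.RH.counit (f x - K.RH.comul x) = 0 ∧
      contractRight K.RH.counit (f x - K.RH.comul x) = 0 := fun x =>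
    (CoDGA.augProj₂_eq_self_iff (X := K.perturb h 0) hX.counit_one).1 (hf2 x)
  have hcl : ∀ x, contractLeft K.RH.counit ((K.RH.comul + (f - K.RH.comul)) x) = x := fun x => by
    rw [LinearMap.add_apply, map_add, hRH.counit_left, LinearMap.sub_apply, (hf2' x).1, add_zero]
  have hcr : ∀ x, contractRight K.RH.counit ((K.RH.comul + (f - K.RH.comul)) x) = x := fun x => by
    rw [LinearMap.add_apply, map_add, hRH.counit_right, LinearMap.sub_apply, (hf2' x).2, add_zero]
  have hY : (K.perturb h (f - K.RH.comul)).IsCounital :=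
    { isDGA := hdga
      comul_hom := by
        change IsDGAHom (K.RH.d + h) _ (K.RH.comul + (f - K.RH.comul))
        rw [hcomul]; exact hf
      counit_one := hRH.counit_one
      counit_mul := hRH.counit_mul
      counit_degree := hRH.counit_degree
      counit_d := hεδ
      counit_left := hcl
      counit_right := hcr }
  have hkf : DerivationHomotopic (K.RH.d + h) A.d₂
      (tensorMap k k ∘ₗ (K.RH.comul + (f - K.RH.comul))) (A.comul ∘ₗ k) := by
    rw [hcomul]; exact hf3
  exact ⟨h, f - K.RH.comul, k,
    { isPerturbation :=
        { h_derivation := hder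
          h_res := hres
          ν_degree := hf.degree.sub hRH.comul_hom.degree
          ν_res := fun q x hx => hf1 q x (K.V.resDeg_le_resFilt le_rfl hx)
          isHah := hY.isHah (X := K.perturb h (f - K.RH.comul)) K.V hδV hA hAflat hk hq hkf }
      hom := ⟨hk, hkε, hkf⟩
      homologyIso := QIso.isHomologyIso hk.map_d hq
      restrict := hrep }⟩

theorem exists_isHahIso {A : CoDGA R} {hA : A.IsHah} (hAflat : IsKFlat A.d)
    (i : H.HomologyIso A hA) {h h' : K.RH.alg →ₗ[R] K.RH.alg}
    {ν ν' : K.RH.alg →ₗ[R] K.RH.alg.tensor K.RH.alg} {k k' : K.RH.alg →ₗ[R] A.alg}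
    (m : K.IsModel i h ν k) (m' : K.IsModel i h' ν' k') :
    ∃ p : K.RH.alg →ₗ[R] K.RH.alg,
      CoDGA.IsHahIso (K.perturb h ν) (K.perturb h' ν') p ∧
      (∀ q : ℕ, ∀ x ∈ K.V.resDeg q, p x - x ∈ K.V.resFilt (q - 1)) ∧
      DerivationHomotopic (K.perturb h ν).d A.d k (k' ∘ₗ p) := by
  have hres := m.isPerturbation.h_res
  have hres' := m'.isPerturbation.h_res
  have hX := m.isPerturbation.isHah
  have hX' := m'.isPerturbation.isHah
  have hδ : IsDGA (K.RH.d + h) := hX.isDGA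
  have hδ' : IsDGA (K.RH.d + h') := hX'.isDGA
  have hk : IsDGAHom (K.RH.d + h) A.d k := m.hom.hom
  have hk' : IsDGAHom (K.RH.d + h') A.d k' := m'.hom.hom
  have hkε : ∀ x, A.counit (k x) = K.RH.counit x := m.hom.counit
  have hkε' : ∀ x, A.counit (k' x) = K.RH.counit x := m'.hom.counit
  have hεδ : ∀ x, K.RH.counit ((K.RH.d + h) x) = 0 := hX.counit_d
  have hεδ' : ∀ x, K.RH.counit ((K.RH.d + h') x) = 0 := hX'.counit_d
  have hq' : QIso (K.RH.d + h') A.d k' := IsHomologyIso.qIso m'.homologyIso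
  have hA2 := isDGA_tensorD hA.isDGA hA.isDGA
  have hδV : ∀ v, (K.RH.d + h) (K.V.gen v) ∈ K.V.resFilt ((K.V.res v : ℤ) - 1) := fun v =>
    K.perturbed_resDeg hres (K.V.gen_mem_resDeg v)
  -- Lift k along k' with the identity as leading term. The identity fails to be a chain map only by
  -- h' - h, which lowers the filtration by two.
  obtain ⟨p, hp, hp1, hp2, hp3⟩ := K.V.exists_filtered_lift hδ hδV hδ' (K.isResFilt hδ' hres')
    hA.isDGA hk' hq' (f₀ := AlgHom.id R K.RH.alg) K.V.gen_mem_gr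
    (fun v => K.V.resDeg_le_resFilt le_rfl (K.V.gen_mem_resDeg v))
    (fun v => by
      have hv := K.V.gen_mem_resDeg v
      have e : (K.RH.d + h') (K.V.gen v) - (K.RH.d + h) (K.V.gen v)
          = h' (K.V.gen v) - h (K.V.gen v) := by
        rw [LinearMap.add_apply, LinearMap.add_apply]; abel
      rw [AlgHom.id_apply, AlgHom.id_apply, e]
      exact sub_mem (hres' _ _ hv) (hres _ _ hv))
    hk
    (fun v hv => (m'.restrict _ (hv ▸ K.V.gen_mem_resDeg v)).exists_sub_eq
      (m.restrict _ (hv ▸ K.V.gen_mem_resDeg v)))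
    hX'.toIsCounital.isAugmented.isIdealProj hA.toIsCounital.isAugmented.isIdealProj
    (fun n x hx => CoDGA.augProj_mem_resFilt (X := K.perturb h' ν') K.V hx)
    (CoDGA.augProj_map (X := K.perturb h' ν') hk'.map_one hkε')
    (fun v => (CoDGA.augProj_eq_self_iff (X := K.perturb h' ν') hX'.counit_one).2
      ((map_sub K.RH.counit _ _).trans (by
        rw [AlgHom.id_apply, AlgHom.id_apply, hεδ, hεδ', sub_self])))
    (fun v => (CoDGA.augProj_eq_self_iff hA.counit_one).2 (by
      rw [AlgHom.id_apply, map_sub, hkε, hkε', sub_self]))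
  have hpε : ∀ x, K.RH.counit (p x) = K.RH.counit x := fun x => by
    have : K.RH.counit (p x - x) = 0 :=
      (CoDGA.augProj_eq_self_iff (X := K.perturb h' ν') hX'.counit_one).1 (hp2 x)
    rwa [map_sub, sub_eq_zero] at this
  have hkp := K.V.homotopic_symm hδ hδV hA.isDGA (hk'.comp hp) hk hp3
  let e := LinearEquiv.ofBijective p (K.V.bijective_of_lowering hp1)
  have hgp : ∀ x, e.symm (p x) = x := e.symm_apply_apply
  have hpg : ∀ x, p (e.symm x) = x := e.apply_symm_apply
  have hg : IsDGAHom (K.RH.d + h') (K.RH.d + h) e.symm.toLinearMap := hp.inverse hgp hpg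
  have hΔ : IsDGAHom (K.RH.d + h) (tensorD (K.RH.d + h) (K.RH.d + h)) (K.RH.comul + ν) :=
    hX.comul_hom
  have hΔ' : IsDGAHom (K.RH.d + h') (tensorD (K.RH.d + h') (K.RH.d + h')) (K.RH.comul + ν') :=
    hX'.comul_hom
  have hc : DerivationHomotopic (K.RH.d + h) A.d₂ (tensorMap k k ∘ₗ (K.RH.comul + ν))
      (A.comul ∘ₗ k) := m.hom.comul
  have hc' : DerivationHomotopic (K.RH.d + h') A.d₂ (tensorMap k' k' ∘ₗ (K.RH.comul + ν'))
      (A.comul ∘ₗ k') := m'.hom.comul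
  have hkp' := hk'.comp hp
  have hcomul : DerivationHomotopic (K.RH.d + h) (tensorD (K.RH.d + h') (K.RH.d + h'))
      (tensorMap p p ∘ₗ (K.RH.comul + ν)) ((K.RH.comul + ν') ∘ₗ p) := by
    refine K.V.homotopic_reflect hδ hδV (isDGA_tensorD hδ' hδ') hA2 (hk'.tensor hk')
      (K.V.qIso_tensor_square hδ' (fun q x hx => K.perturbed_resDeg hres' hx) hA.isDGA hAflat hk'
        hq') ((hp.tensor hp).comp hΔ) (hΔ'.comp hp) ?_
    have h1 := (hp3.tensor_left hk.degree hkp').precomp hΔ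
    have h2 := (hp3.tensor_right hkp'.degree hk hδ.degree).precomp hΔ
    have h3 := hkp.postcomp hA.comul_hom
    have h4 := K.V.homotopic_symm hδ hδV hA2 (((hk'.tensor hk').comp hΔ').comp hp)
      ((hA.comul_hom.comp hk').comp hp) (hc'.precomp hp)
    have a0 := (hkp'.tensor hkp').comp hΔ
    have a1 := (hk.tensor hkp').comp hΔ
    have a2 := (hk.tensor hk).comp hΔ
    have a3 := hA.comul_hom.comp hk
    have a4 := hA.comul_hom.comp hkp'
    have trans := @FreeGens.homotopic_trans R _ K.RH.alg _ K.V _ hδ A.d₂ hA2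
    -- The chain is (k'p ⊗ k'p)Δ ≃ (k ⊗ k'p)Δ ≃ (k ⊗ k)Δ ≃ ψk ≃ ψk'p ≃ (k' ⊗ k')Δ'p, where Δ and Δ'
    -- denote the perturbed coproducts.
    have := trans a0 a4 (((hk'.tensor hk').comp hΔ').comp hp)
      (trans a0 a3 a4 (trans a0 a2 a3 (trans a0 a1 a2 h1 h2) hc) h3) h4
    rw [tensorMap_comp] at this
    exact this
  refine ⟨p, ⟨⟨hp, hpε, hcomul⟩, e.symm.toLinearMap, ⟨hg, fun x => ?_, ?_⟩, LinearMap.ext hgp,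
    LinearMap.ext hpg⟩, fun q x hx => hp1 q x (K.V.resDeg_le_resFilt le_rfl hx), hkp⟩
  · exact ((hpε (e.symm x)).symm.trans (congrArg K.RH.counit (hpg x)))
  -- The inverse is comultiplicative up to homotopy: reverse the homotopy for p, precompose with the
  -- inverse and postcompose with its tensor square.
  · have h1 := K.V.homotopic_symm hδ hδV (isDGA_tensorD hδ' hδ') ((hp.tensor hp).comp hΔ)
      (hΔ'.comp hp) hcomul
    have h2 := (h1.precomp hg).postcomp (hg.tensor hg)
    have e1 : p ∘ₗ e.symm.toLinearMap = LinearMap.id := LinearMap.ext hpg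
    have e2 : e.symm.toLinearMap ∘ₗ p = LinearMap.id := LinearMap.ext hgp
    have e3 : tensorMap e.symm.toLinearMap e.symm.toLinearMap ∘ₗ tensorMap p p
        = LinearMap.id := by rw [← tensorMap_comp, e2, tensorMap_id]
    rw [LinearMap.comp_assoc, e1, LinearMap.comp_id, LinearMap.comp_assoc,
      ← LinearMap.comp_assoc _ _ (tensorMap _ _), e3, LinearMap.id_comp] at h2
    exact h2

end HopfResolution

end HopfPert

open HopfPert HopfPert.GrAlg in
theorem theorem5p1 {R : Type u} [CommRing R]
    (H : CoDGA R) (hH : H.IsGradedHopf) (hflat : Module.Flat R H.alg)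
    (K : HopfResolution H)
    (A : CoDGA R) (hA : A.IsHah) (hAflat : IsKFlat A.d)
    (i : H.HomologyIso A hA) :
    (∃ (h : K.RH.alg →ₗ[R] K.RH.alg) (ν : K.RH.alg →ₗ[R] K.RH.alg.tensor K.RH.alg)
        (k : K.RH.alg →ₗ[R] A.alg), K.IsModel i h ν k) ∧
    ∀ (h : K.RH.alg →ₗ[R] K.RH.alg) (ν : K.RH.alg →ₗ[R] K.RH.alg.tensor K.RH.alg)
      (k : K.RH.alg →ₗ[R] A.alg)
      (h' : K.RH.alg →ₗ[R] K.RH.alg) (ν' : K.RH.alg →ₗ[R] K.RH.alg.tensor K.RH.alg)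
      (k' : K.RH.alg →ₗ[R] A.alg),
      K.IsModel i h ν k → K.IsModel i h' ν' k' →
      ∃ p : K.RH.alg →ₗ[R] K.RH.alg,
        CoDGA.IsHahIso (K.perturb h ν) (K.perturb h' ν') p ∧
        (∀ q : ℕ, ∀ x ∈ K.V.resDeg q, p x - x ∈ K.V.resFilt (q - 1)) ∧
        DerivationHomotopic (K.perturb h ν).d A.d k (k' ∘ₗ p) :=
  ⟨K.exists_isModel hH hflat hAflat i, fun _ _ _ _ _ _ m m' => K.exists_isHahIso hAflat i m m'⟩
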